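/- Let $w\in C^\infty(\mathbb R)$ satisfy $w\ge 0$, $\operatorname{supp} w\subset[1/2,2]$ and $w(s)=1-w(s/2)$ for $s\in[1,2]$, and for $n\in\mathbb Z$ define $W_n\in\mathcal S(\mathbb R)$ by $\int_{\mathbb R} W_n(x)e^{-ixt}\,dx=w(|t|/2^n)$. For a tempered distribution $f\in\mathcal S'(\mathbb R)$ put $f_n=f*W_n$. The Besov class $B^1_{\infty,1}(\mathbb R)$ consists of those $f\in\mathcal S'(\mathbb R)$ for which $$\|f\|_{B^1_{\infty,1}}:=\sum_{n\in\mathbb Z}2^n\|f_n\|_{L^\infty(\mathbb R)}<\infty\qquad\text{and}\qquad f'=\sum_{n\in\mathbb Z}f_n'\ \text{ in }\mathcal S'(\mathbb R)\text{ (weak topology)}.$$ For a self-adjoint operator $A$ in a complex Hilbert space with spectral measure $E_A$ and a continuous $f:\mathbb R\to\mathbb C$, put $f(A)=\int_{\mathbb R}f\,dE_A$, with domain $\{u:\int|f|^2\,d(E_Au,u)<\infty\}$. For operators $S,T$ with domains $\mathcal D_S,\mathcal D_T$, we say that $S-T$ is bounded if $\mathcal D_T\subset\mathcal D_S$ and $u\mapsto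 Su-Tu$, $u\in\mathcal D_T$, extends to a bounded operator on the whole space, which is then denoted by $S-T$. A continuous function $f$ is called operator Lipschitz if there is a constant $c$ such that $f(A)-f(B)$ is bounded and $\|f(A)-f(B)\|\le c\|A-B\|$ for all (not necessarily bounded) self-adjoint operators $A$, $B$ with bounded difference. **Theorem.** There is an absolute constant $C$ such that every $f\in B^1_{\infty,1}(\mathbb R)$ is (given by) a continuous function which is operator Lipschitz, and $$\|f(A)-f(B)\|\le C\,\|f\|_{B^1_{\infty,1}}\,\|A-B\|$$ for all (not necessarily bounded) self-adjoint operators $A$ and $B$ in a Hilbert space with bounded difference $A-B$. -/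

import Mathlib

open MeasureTheory Filter Topology
open scoped InnerProductSpace ENNReal NNReal SchwartzMap FourierTransform

theorem IsStarProjection.re_inner_self {H : Type*} [NormedAddCommGroup H] [InnerProductSpace ℂ H]
    [CompleteSpace H] {P : H →L[ℂ] H} (hP : IsStarProjection P) (u : H) :
    (⟪u, P u⟫_ℂ).re = ‖P u‖ ^ 2 := by
  have h1 : P (P u) = P u := by
    have := congrArg (fun T : H →L[ℂ] H => T u) hP.isIdempotentElem.eq
    simpa using this
  have h2 : ⟪P u, P u⟫_ℂ = ⟪u, P u⟫_ℂ := by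
    rw [← ContinuousLinearMap.adjoint_inner_right, ← ContinuousLinearMap.star_eq_adjoint,
      hP.isSelfAdjoint.star_eq, h1]
  rw [← h2]
  exact inner_self_eq_norm_sq (𝕜 := ℂ) (P u)

theorem IsSelfAdjoint.inner_eq_re {H : Type*} [NormedAddCommGroup H] [InnerProductSpace ℂ H]
    [CompleteSpace H] {T : H →L[ℂ] H} (hT : IsSelfAdjoint T) (u : H) :
    ⟪u, T u⟫_ℂ = ((⟪u, T u⟫_ℂ).re : ℂ) := by
  apply Complex.ext
  · simp
  · have h2 : ⟪T u, u⟫_ℂ = ⟪u, T u⟫_ℂ := by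
      rw [← ContinuousLinearMap.adjoint_inner_right, ← ContinuousLinearMap.star_eq_adjoint,
        hT.star_eq]
    have h3 := congrArg Complex.im (inner_conj_symm (𝕜 := ℂ) (T u) u)
    rw [h2, Complex.conj_im] at h3
    rw [Complex.ofReal_im]
    linarith

theorem ContinuousLinearMap.ext_re_inner {H : Type*} [NormedAddCommGroup H]
    [InnerProductSpace ℂ H] [CompleteSpace H] {S T : H →L[ℂ] H} (hS : IsSelfAdjoint S)
    (hT : IsSelfAdjoint T) (h : ∀ u, (⟪u, S u⟫_ℂ).re = (⟪u, T u⟫_ℂ).re) : S = T := by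
  have key : ∀ u, ⟪(S - T) u, u⟫_ℂ = 0 := by
    intro u
    rw [← inner_conj_symm, sub_apply, inner_sub_right, hS.inner_eq_re,
      hT.inner_eq_re, h u]
    simp
  have := (inner_map_self_eq_zero (S - T).toLinearMap).1 key
  have h2 : S - T = 0 := by
    ext u
    exact congrArg (fun L : H →ₗ[ℂ] H => L u) this
  exact sub_eq_zero.1 h2

theorem IsStarProjection.apply_apply_eq_zero {H : Type*} [NormedAddCommGroup H]
    [InnerProductSpace ℂ H] [CompleteSpace H] {P Q : H →L[ℂ] H}
    (hQ : IsStarProjection Q) (h : ∀ u, ‖P u‖ ^ 2 + ‖Q u‖ ^ 2 ≤ ‖u‖ ^ 2) (v : H) :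
    P (Q v) = 0 := by
  have h1 : Q (Q v) = Q v := by
    have := congrArg (fun T : H →L[ℂ] H => T v) hQ.isIdempotentElem.eq
    simpa using this
  have h2 := h (Q v)
  rw [h1] at h2
  have h3 : ‖P (Q v)‖ ^ 2 ≤ 0 := by linarith
  have h4 : ‖P (Q v)‖ = 0 := by
    have := sq_nonneg ‖P (Q v)‖
    exact pow_eq_zero_iff (two_ne_zero) |>.1 (le_antisymm h3 this)
  exact norm_eq_zero.1 h4

/-- A spectral measure (projection-valued measure) on a measurable space `X` acting in a Hilbert
space `H`. -/
structure SpectralMeasure (X : Type*) [MeasurableSpace X] (H : Type*) [NormedAddCommGroup H]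
    [InnerProductSpace ℂ H] [CompleteSpace H] where
  proj : Set X → H →L[ℂ] H
  isStarProjection : ∀ S, MeasurableSet S → IsStarProjection (proj S)
  proj_univ : proj Set.univ = 1
  hasSum_proj : ∀ s : ℕ → Set X, (∀ n, MeasurableSet (s n)) →
    Pairwise (Function.onFun Disjoint s) → ∀ u : H,
      HasSum (fun n => proj (s n) u) (proj (⋃ n, s n) u)

namespace SpectralMeasure

variable {X : Type*} [MeasurableSpace X] {H : Type*} [NormedAddCommGroup H]
  [InnerProductSpace ℂ H] [CompleteSpace H]

theorem proj_empty (E : SpectralMeasure X H) : E.proj ∅ = 0 := by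
  ext u
  have h := E.hasSum_proj (fun _ => ∅) (fun _ => MeasurableSet.empty)
    (fun _ _ _ => disjoint_bot_left) u
  have h2 := h.summable.tendsto_atTop_zero
  simpa using tendsto_nhds_unique tendsto_const_nhds h2

/-- The scalar spectral measure `S ↦ (E(S)u, u)`. -/
noncomputable def measure (E : SpectralMeasure X H) (u : H) : Measure X :=
  Measure.ofMeasurable (fun S _ => ENNReal.ofReal (⟪u, E.proj S u⟫_ℂ).re)
    (by simp [E.proj_empty])
    (by
      intro s hs hd
      have h := ((E.hasSum_proj s hs hd u).mapL (innerSL ℂ u)).mapL Complex.reCLM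
      have h' : HasSum (fun n => (⟪u, E.proj (s n) u⟫_ℂ).re) (⟪u, E.proj (⋃ n, s n) u⟫_ℂ).re := by
        simpa using h
      rw [← h'.tsum_eq, ENNReal.ofReal_tsum_of_nonneg _ h'.summable]
      intro n
      rw [(E.isStarProjection _ (hs n)).re_inner_self]
      positivity)

theorem measure_apply (E : SpectralMeasure X H) (u : H) {S : Set X} (hS : MeasurableSet S) :
    E.measure u S = ENNReal.ofReal (⟪u, E.proj S u⟫_ℂ).re :=
  Measure.ofMeasurable_apply S hS

theorem measureReal_apply (E : SpectralMeasure X H) (u : H) {S : Set X} (hS : MeasurableSet S) :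
    (E.measure u).real S = ‖E.proj S u‖ ^ 2 := by
  rw [measureReal_def, E.measure_apply u hS, (E.isStarProjection S hS).re_inner_self,
    ENNReal.toReal_ofReal (by positivity)]

instance (E : SpectralMeasure X H) (u : H) : IsFiniteMeasure (E.measure u) :=
  ⟨by rw [E.measure_apply u MeasurableSet.univ]; exact ENNReal.ofReal_lt_top⟩

/-- `T` is the integral `∫ f dE`: its domain consists of the vectors `u` with
`∫ |f|² d(Eu, u) < ∞`, and `(Tu, u) = ∫ f d(Eu, u)` there. -/
structure IsIntegral (E : SpectralMeasure X H) (f : X → ℂ) (T : H →ₗ.[ℂ] H) : Prop where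
  mem_domain_iff : ∀ u : H, u ∈ T.domain ↔ MemLp f 2 (E.measure u)
  inner_apply : ∀ u : T.domain, ⟪(u : H), T u⟫_ℂ = ∫ x, f x ∂(E.measure u)

theorem proj_union (E : SpectralMeasure X H) {S T : Set X} (hS : MeasurableSet S)
    (hT : MeasurableSet T) (h : Disjoint S T) : E.proj (S ∪ T) = E.proj S + E.proj T := by
  refine ContinuousLinearMap.ext_re_inner (E.isStarProjection _ (hS.union hT)).isSelfAdjoint
    ((E.isStarProjection _ hS).isSelfAdjoint.add (E.isStarProjection _ hT).isSelfAdjoint) ?_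
  intro u
  rw [(E.isStarProjection _ (hS.union hT)).re_inner_self, ← E.measureReal_apply u (hS.union hT),
    measureReal_union h hT, E.measureReal_apply u hS, E.measureReal_apply u hT,
    ← (E.isStarProjection _ hS).re_inner_self, ← (E.isStarProjection _ hT).re_inner_self]
  simp

theorem inner_proj_of_disjoint (E : SpectralMeasure X H) {S T : Set X} (hS : MeasurableSet S)
    (hT : MeasurableSet T) (h : Disjoint S T) (u : H) : ⟪E.proj S u, E.proj T u⟫_ℂ = 0 := by
  have h0 : E.proj S (E.proj T u) = 0 := by
    refine (E.isStarProjection T hT).apply_apply_eq_zero (fun v => ?_) u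
    rw [← E.measureReal_apply v hS, ← E.measureReal_apply v hT, ← measureReal_union h hT]
    refine (measureReal_mono (Set.subset_univ _)).trans ?_
    rw [E.measureReal_apply v MeasurableSet.univ, E.proj_univ]
    simp
  rw [← ContinuousLinearMap.adjoint_inner_right, ← ContinuousLinearMap.star_eq_adjoint,
    (E.isStarProjection S hS).isSelfAdjoint.star_eq, h0, inner_zero_right]

/-- The integral of a simple function. -/
noncomputable def simpleIntegral (E : SpectralMeasure X H) (s : SimpleFunc X ℂ) : H →L[ℂ] H :=
  ∑ c ∈ s.range, c • E.proj (s ⁻¹' {c})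

theorem simpleIntegral_sub (E : SpectralMeasure X H) (s t : SimpleFunc X ℂ) :
    E.simpleIntegral (s - t) = E.simpleIntegral s - E.simpleIntegral t := by
  let T : Set X → ℂ →L[ℝ] (H →L[ℂ] H) := fun S =>
    ((ContinuousLinearMap.id ℂ ℂ).smulRight (E.proj S)).restrictScalars ℝ
  have hT : ∀ s : SimpleFunc X ℂ, E.simpleIntegral s = SimpleFunc.setToSimpleFunc T s := by
    intro s; rfl
  rw [hT, hT, hT]
  refine SimpleFunc.setToSimpleFunc_sub (μ := (0 : Measure X)) T ?_ (by simp) (by simp)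
  intro S S' hS hS' _ _ hd
  ext c u
  simp [T, E.proj_union hS hS' hd]

theorem inner_simpleIntegral (E : SpectralMeasure X H) (s : SimpleFunc X ℂ) (u : H) :
    ⟪u, E.simpleIntegral s u⟫_ℂ = ∫ x, s x ∂(E.measure u) := by
  rw [← SimpleFunc.integral_eq_integral s (SimpleFunc.integrable_of_isFiniteMeasure s),
    SimpleFunc.integral_eq, simpleIntegral, sum_apply, inner_sum]
  refine Finset.sum_congr rfl fun c _ => ?_
  have hS := s.measurableSet_fiber c
  rw [smul_apply, inner_smul_right, (E.isStarProjection _ hS).isSelfAdjoint.inner_eq_re,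
    (E.isStarProjection _ hS).re_inner_self, ← E.measureReal_apply u hS, mul_comm,
    Complex.real_smul]

theorem norm_simpleIntegral_sq (E : SpectralMeasure X H) (s : SimpleFunc X ℂ) (u : H) :
    ‖E.simpleIntegral s u‖ ^ 2 = ∫ x, ‖s x‖ ^ 2 ∂(E.measure u) := by
  have h1 : ∫ x, ‖s x‖ ^ 2 ∂(E.measure u)
      = ∑ c ∈ s.range, (E.measure u).real (s ⁻¹' {c}) • ‖c‖ ^ 2 := by
    have h := SimpleFunc.map_integral s (fun c : ℂ => ‖c‖ ^ 2)
      (SimpleFunc.integrable_of_isFiniteMeasure (μ := E.measure u) s) (by simp)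
    rw [← h, SimpleFunc.integral_eq_integral _ (SimpleFunc.integrable_of_isFiniteMeasure _)]
    rfl
  have h2 : ∀ F : Finset ℂ, ‖∑ c ∈ F, c • E.proj (s ⁻¹' {c}) u‖ ^ 2
      = ∑ c ∈ F, ‖c • E.proj (s ⁻¹' {c}) u‖ ^ 2 := by
    intro F
    induction F using Finset.induction_on with
    | empty => simp
    | insert a F ha ih =>
      rw [Finset.sum_insert ha, Finset.sum_insert ha, ← ih, pow_two, pow_two, pow_two]
      refine norm_add_sq_eq_norm_sq_add_norm_sq_of_inner_eq_zero (𝕜 := ℂ) _ _ ?_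
      rw [inner_sum]
      refine Finset.sum_eq_zero fun c hc => ?_
      have hne : a ≠ c := fun h => ha (h ▸ hc)
      rw [inner_smul_left, inner_smul_right, E.inner_proj_of_disjoint (s.measurableSet_fiber a)
        (s.measurableSet_fiber c) ((Set.disjoint_singleton.2 hne).preimage s)]
      simp
  rw [h1, simpleIntegral, sum_apply]
  simp only [smul_apply]
  rw [h2]
  refine Finset.sum_congr rfl fun c _ => ?_
  rw [norm_smul, E.measureReal_apply u (s.measurableSet_fiber c), mul_pow, smul_eq_mul, mul_comm]

theorem measure_add_le (E : SpectralMeasure X H) (u v : H) :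
    E.measure (u + v) ≤ (2 : ℝ≥0∞) • (E.measure u + E.measure v) := by
  refine Measure.le_iff.2 fun S hS => ?_
  have hP := E.isStarProjection S hS
  rw [Measure.smul_apply, Measure.add_apply, E.measure_apply _ hS, E.measure_apply _ hS,
    E.measure_apply _ hS, hP.re_inner_self, hP.re_inner_self, hP.re_inner_self,
    ← ENNReal.ofReal_add (by positivity) (by positivity), smul_eq_mul,
    show (2 : ℝ≥0∞) = ENNReal.ofReal 2 by simp, ← ENNReal.ofReal_mul (by positivity), map_add]
  refine ENNReal.ofReal_le_ofReal ?_
  have := parallelogram_law_with_norm ℂ (E.proj S u) (E.proj S v)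
  nlinarith [norm_nonneg (E.proj S u - E.proj S v)]

theorem measure_smul_le (E : SpectralMeasure X H) (c : ℂ) (u : H) :
    E.measure (c • u) ≤ ENNReal.ofReal (‖c‖ ^ 2) • E.measure u := by
  refine Measure.le_iff.2 fun S hS => ?_
  have hP := E.isStarProjection S hS
  rw [Measure.smul_apply, E.measure_apply _ hS, E.measure_apply _ hS, hP.re_inner_self,
    hP.re_inner_self, smul_eq_mul, ← ENNReal.ofReal_mul (by positivity), map_smul, norm_smul,
    mul_pow]

theorem measure_zero (E : SpectralMeasure X H) : E.measure 0 = 0 := by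
  refine Measure.ext fun S hS => ?_
  rw [E.measure_apply _ hS]
  simp

theorem exists_isIntegral (E : SpectralMeasure X H) {f : X → ℂ} (hf : Measurable f) :
    ∃ T : H →ₗ.[ℂ] H, E.IsIntegral f T := by
  let D : Submodule ℂ H :=
    { carrier := {u | MemLp f 2 (E.measure u)}
      zero_mem' := by
        show MemLp f 2 (E.measure 0)
        rw [E.measure_zero]
        exact ⟨hf.aestronglyMeasurable, by simp⟩
      add_mem' := fun {u v} hu hv => by
        refine MemLp.of_measure_le_smul (c := 2) (by simp) (E.measure_add_le u v) ?_
        have hm : ∀ μ : Measure X, AEStronglyMeasurable f μ := fun μ => hf.aestronglyMeasurable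
        rw [Set.mem_ofPred_eq, memLp_two_iff_integrable_sq_norm (hm _)] at hu hv
        rw [memLp_two_iff_integrable_sq_norm (hm _)]
        exact hu.add_measure hv
      smul_mem' := fun c u hu =>
        MemLp.of_measure_le_smul ENNReal.ofReal_ne_top (E.measure_smul_le c u) hu }
  let s : ℕ → SimpleFunc X ℂ := fun n => SimpleFunc.approxOn f hf Set.univ 0 (Set.mem_univ _) n
  have hs : ∀ n u, MemLp (s n) 2 (E.measure u) := fun n u => SimpleFunc.memLp_of_isFiniteMeasure _ _ _
  have hcauchy : ∀ u : D, CauchySeq (fun n => E.simpleIntegral (s n) (u : H)) := by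
    intro u
    have hu : MemLp f 2 (E.measure (u : H)) := u.2
    have h1 : Tendsto (fun n => (hs n u).toLp (s n)) atTop (𝓝 (hu.toLp f)) := by
      rw [Lp.tendsto_Lp_iff_tendsto_eLpNorm'']
      exact SimpleFunc.tendsto_approxOn_Lp_eLpNorm hf (Set.mem_univ _) (by simp)
        (by simp) (by simpa using hu.2)
    have h2 : ∀ n m, dist (E.simpleIntegral (s n) (u : H)) (E.simpleIntegral (s m) (u : H))
        = dist ((hs n u).toLp (s n)) ((hs m u).toLp (s m)) := by
      intro n m
      have h3 : MemLp (s n - s m : SimpleFunc X ℂ) 2 (E.measure u) :=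
        SimpleFunc.memLp_of_isFiniteMeasure _ _ _
      rw [dist_eq_norm, dist_eq_norm, ← sub_apply, ← E.simpleIntegral_sub, ← MemLp.toLp_sub,
        ← sq_eq_sq₀ (norm_nonneg _) (norm_nonneg _), E.norm_simpleIntegral_sq]
      have h7 := h3.eLpNorm_eq_integral_rpow_norm (by simp) (by simp)
      rw [SimpleFunc.coe_sub] at h7
      rw [Lp.norm_toLp, h7, ENNReal.toReal_ofReal (by positivity), ← Real.rpow_natCast,
        ← Real.rpow_mul (by positivity)]
      simp
    have h4 := h1.cauchySeq
    rw [Metric.cauchySeq_iff] at h4 ⊢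
    simpa only [h2] using h4
  choose T hT using fun u => cauchySeq_tendsto_of_complete (hcauchy u)
  refine ⟨⟨D, { toFun := T, map_add' := ?_, map_smul' := ?_ }⟩, ⟨fun u => Iff.rfl, ?_⟩⟩
  · intro u v
    refine tendsto_nhds_unique (hT (u + v)) ?_
    simpa using (hT u).add (hT v)
  · intro c u
    refine tendsto_nhds_unique (hT (c • u)) ?_
    simpa using (hT u).const_smul c
  · intro u
    have hu : MemLp f 2 (E.measure (u : H)) := u.2
    have h5 : Tendsto (fun n => ⟪(u : H), E.simpleIntegral (s n) (u : H)⟫_ℂ) atTop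
        (𝓝 ⟪(u : H), T u⟫_ℂ) := tendsto_const_nhds.inner (hT u)
    refine tendsto_nhds_unique h5 ?_
    have h6 := tendsto_integral_approxOn_of_measurable (μ := E.measure (u : H))
      (hu.integrable (by norm_num)) hf (s := Set.univ) (by simp) (Set.mem_univ (0 : ℂ)) (by simp)
    refine h6.congr fun n => ?_
    rw [E.inner_simpleIntegral, ← SimpleFunc.integral_eq_integral _
      (SimpleFunc.integrable_of_isFiniteMeasure _)]

/-- The integral `∫ f dE`. -/
noncomputable def integral (E : SpectralMeasure X H) (f : X → ℂ) (hf : Measurable f) :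
    H →ₗ.[ℂ] H :=
  (E.exists_isIntegral hf).choose

theorem isIntegral_integral (E : SpectralMeasure X H) {f : X → ℂ} (hf : Measurable f) :
    E.IsIntegral f (E.integral f hf) :=
  (E.exists_isIntegral hf).choose_spec

end SpectralMeasure

theorem exists_isStarProjection_of_tendsto {H : Type*} [NormedAddCommGroup H]
    [InnerProductSpace ℂ H] [CompleteSpace H] {T : ℕ → H →L[ℂ] H}
    (hT : ∀ n, IsSelfAdjoint (T n)) (hc : ∀ u, CauchySeq fun n => T n u) {q : H → ℝ}
    (h1 : ∀ u, Tendsto (fun n => (⟪u, T n u⟫_ℂ).re) atTop (𝓝 (q u)))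
    (h2 : ∀ u, Tendsto (fun n => ‖T n u‖ ^ 2) atTop (𝓝 (q u))) :
    ∃ P : H →L[ℂ] H, IsStarProjection P ∧ (∀ u, Tendsto (fun n => T n u) atTop (𝓝 (P u))) ∧
      ∀ u, (⟪u, P u⟫_ℂ).re = q u := by
  choose f hf using fun u => cauchySeq_tendsto_of_complete (hc u)
  let P : H →L[ℂ] H := continuousLinearMapOfTendsto T (tendsto_pi_nhds.2 hf)
  have hP : ∀ u, Tendsto (fun n => T n u) atTop (𝓝 (P u)) := hf
  have hq : ∀ u, (⟪u, P u⟫_ℂ).re = q u := fun u =>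
    tendsto_nhds_unique ((Complex.continuous_re.tendsto _).comp
      (tendsto_const_nhds.inner (hP u))) (h1 u)
  have hn : ∀ u, ‖P u‖ ^ 2 = q u := fun u =>
    tendsto_nhds_unique ((hP u).norm.pow 2) (h2 u)
  have hsa : IsSelfAdjoint P := by
    rw [ContinuousLinearMap.isSelfAdjoint_iff_isSymmetric]
    intro u v
    refine tendsto_nhds_unique ((hP u).inner tendsto_const_nhds)
      (((tendsto_const_nhds (x := u)).inner (hP v)).congr fun n => ?_)
    exact ((ContinuousLinearMap.isSelfAdjoint_iff_isSymmetric.1 (hT n)) u v).symm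
  refine ⟨P, ⟨?_, hsa⟩, hP, hq⟩
  refine ContinuousLinearMap.ext_re_inner (by rw [isSelfAdjoint_iff, star_mul, hsa.star_eq]) hsa fun u => ?_
  have h3 : ⟪u, (P * P) u⟫_ℂ = ⟪P u, P u⟫_ℂ :=
    ((ContinuousLinearMap.isSelfAdjoint_iff_isSymmetric.1 hsa) u (P u)).symm
  rw [h3, hq, ← hn]
  exact inner_self_eq_norm_sq (𝕜 := ℂ) (P u)

namespace SpectralMeasure

variable {X : Type*} [MeasurableSpace X] {H : Type*} [NormedAddCommGroup H]
  [InnerProductSpace ℂ H] [CompleteSpace H]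

theorem exists_proj_iUnion {μ : H → Measure X} [∀ u, IsFiniteMeasure (μ u)]
    (hμ : ∀ u, (μ u).real Set.univ = ‖u‖ ^ 2) {s : ℕ → Set X} (hs : ∀ n, MeasurableSet (s n))
    (hd : Pairwise (Function.onFun Disjoint s)) {T : ℕ → H →L[ℂ] H}
    (hT : ∀ n, IsStarProjection (T n)) (hr : ∀ n u, (⟪u, T n u⟫_ℂ).re = (μ u).real (s n)) :
    ∃ P : H →L[ℂ] H, IsStarProjection P ∧ (∀ u, (⟪u, P u⟫_ℂ).re = (μ u).real (⋃ n, s n)) ∧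
      ∀ u, HasSum (fun n => T n u) (P u) := by
  have hr' : ∀ n u, ‖T n u‖ ^ 2 = (μ u).real (s n) := fun n u => by
    rw [← (hT n).re_inner_self, hr]
  have horth : ∀ n m, n ≠ m → ∀ u, ⟪T n u, T m u⟫_ℂ = 0 := by
    intro n m hnm u
    have h0 : T n (T m u) = 0 := by
      refine (hT m).apply_apply_eq_zero (fun v => ?_) u
      rw [hr', hr', ← measureReal_union (hd hnm) (hs m), ← hμ]
      exact measureReal_mono (Set.subset_univ _)
    rw [← ContinuousLinearMap.adjoint_inner_right, ← ContinuousLinearMap.star_eq_adjoint,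
      (hT n).isSelfAdjoint.star_eq, h0, inner_zero_right]
  have hsum : ∀ u (F : Finset ℕ), ‖∑ n ∈ F, T n u‖ ^ 2 = ∑ n ∈ F, (μ u).real (s n) := by
    intro u F
    induction F using Finset.induction_on with
    | empty => simp
    | insert a F ha ih =>
      rw [Finset.sum_insert ha, Finset.sum_insert ha, ← ih, ← hr', pow_two, pow_two, pow_two]
      refine norm_add_sq_eq_norm_sq_add_norm_sq_of_inner_eq_zero (𝕜 := ℂ) _ _ ?_
      rw [inner_sum]
      exact Finset.sum_eq_zero fun c hc => horth a c (fun h => ha (h ▸ hc)) u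
  have hms : ∀ u, HasSum (fun n => (μ u).real (s n)) ((μ u).real (⋃ n, s n)) := fun u => by
    have h := measure_iUnion hd hs (μ := μ u)
    have hne : ∑' n, (μ u) (s n) ≠ ∞ := h ▸ measure_ne_top _ _
    have h' := ENNReal.hasSum_toReal hne
    rwa [← ENNReal.tsum_toReal_eq fun n => measure_ne_top _ _, ← h] at h'
  have hsummable : ∀ u, Summable fun n => T n u := by
    intro u
    rw [summable_iff_vanishing_norm]
    intro ε hε
    obtain ⟨F, hF⟩ := summable_iff_vanishing_norm.1 (hms u).summable (ε ^ 2) (by positivity)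
    refine ⟨F, fun t ht => ?_⟩
    have h1 := (le_abs_self _).trans_lt (hF t ht)
    rw [← hsum] at h1
    exact lt_of_pow_lt_pow_left₀ 2 hε.le h1
  have h2 : ∀ u n, ‖(∑ k ∈ Finset.range n, T k) u‖ ^ 2
      = ∑ k ∈ Finset.range n, (μ u).real (s k) := fun u n => by
    rw [sum_apply, hsum]
  have h3 : ∀ u n, (⟪u, (∑ k ∈ Finset.range n, T k) u⟫_ℂ).re
      = ∑ k ∈ Finset.range n, (μ u).real (s k) := fun u n => by
    rw [sum_apply, inner_sum, Complex.re_sum]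
    exact Finset.sum_congr rfl fun k _ => hr k u
  obtain ⟨P, hP, hlim, hq⟩ := exists_isStarProjection_of_tendsto
    (T := fun n => ∑ k ∈ Finset.range n, T k) (q := fun u => (μ u).real (⋃ n, s n))
    (fun n => isSelfAdjoint_sum _ fun k _ => (hT k).isSelfAdjoint)
    (fun u => by
      simpa only [sum_apply] using (hsummable u).hasSum.tendsto_sum_nat.cauchySeq)
    (fun u => by simpa only [h3] using (hms u).tendsto_sum_nat)
    (fun u => by simpa only [h2] using (hms u).tendsto_sum_nat)
  refine ⟨P, hP, hq, fun u => ?_⟩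
  have h4 := (hsummable u).hasSum
  have h5 := h4.tendsto_sum_nat
  have h6 := hlim u
  simp only [sum_apply] at h6
  rwa [tendsto_nhds_unique h5 h6] at h4

/-- A family of scalar measures all of whose values are given by projections comes from a
spectral measure. -/
theorem exists_of_measures {μ : H → Measure X} [∀ u, IsFiniteMeasure (μ u)]
    (hμ : ∀ u, (μ u).real Set.univ = ‖u‖ ^ 2)
    (h : ∀ S, MeasurableSet S → ∃ P : H →L[ℂ] H, IsStarProjection P ∧
      ∀ u, (⟪u, P u⟫_ℂ).re = (μ u).real S) :
    ∃ E : SpectralMeasure X H, ∀ u, E.measure u = μ u := by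
  classical
  let p : Set X → H →L[ℂ] H := fun S => if hS : MeasurableSet S then (h S hS).choose else 0
  have hp : ∀ S, MeasurableSet S → IsStarProjection (p S) ∧
      ∀ u, (⟪u, p S u⟫_ℂ).re = (μ u).real S := fun S hS => by
    simpa only [p, dif_pos hS] using (h S hS).choose_spec
  let E : SpectralMeasure X H :=
    { proj := p
      isStarProjection := fun S hS => (hp S hS).1
      proj_univ := by
        refine ContinuousLinearMap.ext_re_inner (hp _ MeasurableSet.univ).1.isSelfAdjoint
          (IsSelfAdjoint.one _) fun u => ?_
        rw [(hp _ MeasurableSet.univ).2, hμ]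
        exact (inner_self_eq_norm_sq (𝕜 := ℂ) u).symm
      hasSum_proj := by
        intro s hs hd u
        obtain ⟨P, hP, hP', hsum⟩ := exists_proj_iUnion hμ hs hd (T := fun n => p (s n))
          (fun n => (hp _ (hs n)).1) (fun n => (hp _ (hs n)).2)
        have : P = p (⋃ n, s n) := by
          refine ContinuousLinearMap.ext_re_inner hP.isSelfAdjoint
            (hp _ (MeasurableSet.iUnion hs)).1.isSelfAdjoint fun u => ?_
          rw [hP', (hp _ (MeasurableSet.iUnion hs)).2]
        exact this ▸ hsum u }
  refine ⟨E, fun u => Measure.ext fun S hS => ?_⟩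
  rw [E.measure_apply u hS]
  show ENNReal.ofReal (⟪u, p S u⟫_ℂ).re = _
  rw [(hp S hS).2, ofReal_measureReal]

end SpectralMeasure

namespace SpectralMeasure

theorem exists_measures_of_starAlgHom {X : Type*} [MetricSpace X] [CompactSpace X]
    [MeasurableSpace X] [BorelSpace X] {H : Type*} [NormedAddCommGroup H]
    [InnerProductSpace ℂ H] [CompleteSpace H] (Φ : C(X, ℂ) →⋆ₐ[ℂ] (H →L[ℂ] H)) :
    ∃ μ : H → Measure X, (∀ u, IsFiniteMeasure (μ u)) ∧ ∀ u, ∀ φ : C(X, ℝ),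
      (⟪u, Φ ⟨fun x => (φ x : ℂ), by fun_prop⟩ u⟫_ℂ).re = ∫ x, φ x ∂(μ u) := by
  let Λ : H → (CompactlySupportedContinuousMap X ℝ →ₚ[ℝ] ℝ) := fun u =>
    PositiveLinearMap.mk₀
      { toFun := fun φ => (⟪u, Φ ⟨fun x => (φ x : ℂ), by fun_prop⟩ u⟫_ℂ).re
        map_add' := fun φ ψ => by
          have : (⟨fun x => ((φ + ψ) x : ℂ), by fun_prop⟩ : C(X, ℂ))
              = ⟨fun x => (φ x : ℂ), by fun_prop⟩ + ⟨fun x => (ψ x : ℂ), by fun_prop⟩ := by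
            ext x; simp
          rw [this, map_add, add_apply, inner_add_right, Complex.add_re]
        map_smul' := fun c φ => by
          have : (⟨fun x => ((c • φ) x : ℂ), by fun_prop⟩ : C(X, ℂ))
              = (c : ℂ) • ⟨fun x => (φ x : ℂ), by fun_prop⟩ := by
            ext x; simp
          rw [this, map_smul, smul_apply, inner_smul_right]
          simp }
      (fun φ hφ => by
        let ψ : C(X, ℂ) := ⟨fun x => (Real.sqrt (φ x) : ℂ), by fun_prop⟩
        have h1 : (⟨fun x => (φ x : ℂ), by fun_prop⟩ : C(X, ℂ)) = star ψ * ψ := by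
          ext x
          have h2 : (φ x : ℂ) = ((Real.sqrt (φ x) * Real.sqrt (φ x) : ℝ) : ℂ) := by
            rw [Real.mul_self_sqrt (hφ x)]
          simp [ψ, h2]
        show 0 ≤ (⟪u, Φ ⟨fun x => (φ x : ℂ), by fun_prop⟩ u⟫_ℂ).re
        rw [h1, map_mul, map_star, ContinuousLinearMap.star_eq_adjoint,
          mul_apply_eq_comp, ContinuousLinearMap.adjoint_inner_right]
        exact inner_self_nonneg (𝕜 := ℂ))
  refine ⟨fun u => RealRMK.rieszMeasure (Λ u), fun u => inferInstance, fun u φ => ?_⟩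
  have h := RealRMK.integral_rieszMeasure (Λ u)
    (CompactlySupportedContinuousMap.continuousMapEquiv φ)
  exact h.symm

theorem exists_of_starAlgHom {X : Type*} [MetricSpace X] [CompactSpace X]
    [MeasurableSpace X] [BorelSpace X] {H : Type*} [NormedAddCommGroup H]
    [InnerProductSpace ℂ H] [CompleteSpace H] (Φ : C(X, ℂ) →⋆ₐ[ℂ] (H →L[ℂ] H)) :
    ∃ E : SpectralMeasure X H, ∀ (φ : C(X, ℂ)) (u : H),
      ⟪u, Φ φ u⟫_ℂ = ∫ x, φ x ∂(E.measure u) := by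
  obtain ⟨μ, hfin, hμ⟩ := exists_measures_of_starAlgHom Φ
  let ι : C(X, ℝ) → C(X, ℂ) := fun φ => ⟨fun x => (φ x : ℂ), by fun_prop⟩
  have hsa : ∀ φ, IsSelfAdjoint (Φ (ι φ)) := fun φ => by
    rw [isSelfAdjoint_iff, ← map_star]
    congr 1
    ext x
    simp [ι]
  have hsq : ∀ φ u, ‖Φ (ι φ) u‖ ^ 2 = ∫ x, φ x ^ 2 ∂(μ u) := fun φ u => by
    have h := hμ u (φ ^ 2)
    have h1 : (⟨fun x => ((φ ^ 2) x : ℂ), by fun_prop⟩ : C(X, ℂ)) = star (ι φ) * ι φ := by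
      ext x
      simp [ι, pow_two]
    rw [h1, map_mul, map_star, ContinuousLinearMap.star_eq_adjoint,
      mul_apply_eq_comp, ContinuousLinearMap.adjoint_inner_right] at h
    exact (inner_self_eq_norm_sq (𝕜 := ℂ) (Φ (ι φ) u)).symm.trans h
  have hμ1 : ∀ u, (μ u).real Set.univ = ‖u‖ ^ 2 := fun u => by
    have h := hsq 1 u
    have h1 : ι 1 = 1 := by ext x; simp [ι]
    rw [h1, map_one] at h
    simpa using h.symm
  have hint : ∀ (φ : C(X, ℝ)) u, Integrable φ (μ u) := fun φ u =>
    φ.continuous.integrable_of_hasCompactSupport (HasCompactSupport.of_compactSpace _)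
  have hex : ∀ S, MeasurableSet S → ∃ P : H →L[ℂ] H, IsStarProjection P ∧
      ∀ u, (⟪u, P u⟫_ℂ).re = (μ u).real S := by
    refine MeasurableSpace.induction_on_inter (s := {s | IsClosed s})
      (by rw [← borel_eq_generateFrom_isClosed]; exact BorelSpace.measurable_eq)
      isPiSystem_isClosed ⟨0, .zero _, by simp⟩ ?_ ?_ ?_
    · intro F hF
      have hF : IsClosed F := hF
      let φ : ℕ → C(X, ℝ) := fun n => ⟨fun x => (hF.apprSeq n x : ℝ), by fun_prop⟩
      have hφ0 : ∀ n x, 0 ≤ φ n x := fun n x => NNReal.coe_nonneg _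
      have hφ1 : ∀ n x, φ n x ≤ 1 := fun n x =>
        NNReal.coe_le_coe.2 (HasOuterApproxClosed.apprSeq_apply_le_one hF n x)
      have hφt : ∀ x, Tendsto (fun n => φ n x) atTop (𝓝 (F.indicator (fun _ => (1 : ℝ)) x)) := by
        intro x
        have h := (tendsto_pi_nhds.1 (HasOuterApproxClosed.tendsto_apprSeq hF)) x
        have h' := (NNReal.continuous_coe.tendsto _).comp h
        refine (h'.congr fun n => rfl).trans_eq ?_
        by_cases hx : x ∈ F <;> simp [hx]
      have hdom : ∀ (g : ℝ → ℝ) (hg : Continuous g) (C : ℝ)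
          (hC : ∀ t, 0 ≤ t → t ≤ 1 → |g t| ≤ C) (u : H),
          Tendsto (fun n => ∫ x, g (φ n x) ∂(μ u)) atTop
            (𝓝 (∫ x, g (F.indicator (fun _ => (1 : ℝ)) x) ∂(μ u))) := by
        intro g hg C hC u
        refine tendsto_integral_of_dominated_convergence (fun _ => C)
          (fun n => (hg.comp (φ n).continuous).aestronglyMeasurable) (integrable_const _)
          (fun n => Eventually.of_forall fun x => hC _ (hφ0 n x) (hφ1 n x))
          (Eventually.of_forall fun x => (hg.tendsto _).comp (hφt x))
      have hind : ∀ u, ∫ x, F.indicator (fun _ => (1 : ℝ)) x ∂(μ u) = (μ u).real F := fun u => by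
        rw [integral_indicator_const _ hF.measurableSet]
        simp
      have ht1 : ∀ u, Tendsto (fun n => ∫ x, φ n x ∂(μ u)) atTop (𝓝 ((μ u).real F)) := fun u => by
        have h := hdom id continuous_id 1 (fun t h0 h1 => by rwa [id, abs_of_nonneg h0]) u
        simp only [id, hind] at h
        exact h
      have ht2 : ∀ u, Tendsto (fun n => ∫ x, φ n x ^ 2 ∂(μ u)) atTop
          (𝓝 ((μ u).real F)) := fun u => by
        have h := hdom (fun t => t ^ 2) (by fun_prop) 1
          (fun t h0 h1 => by rw [abs_of_nonneg (by positivity)]; exact pow_le_one₀ h0 h1) u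
        have h' : ∀ x, F.indicator (fun _ => (1 : ℝ)) x ^ 2 = F.indicator (fun _ => (1 : ℝ)) x := by
          intro x
          by_cases hx : x ∈ F <;> simp [hx]
        simp only [h', hind] at h
        exact h
      have hc : ∀ u, CauchySeq fun n => Φ (ι (φ n)) u := by
        intro u
        have hle : ∀ n m, ‖Φ (ι (φ n)) u - Φ (ι (φ m)) u‖ ^ 2
            ≤ ∫ x, φ n x ^ 2 ∂(μ u) + ∫ x, φ m x ^ 2 ∂(μ u) - 2 * (μ u).real F := by
          intro n m
          have h1 : Φ (ι (φ n)) u - Φ (ι (φ m)) u = Φ (ι (φ n - φ m)) u := by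
            rw [← sub_apply, ← map_sub]
            congr 2
            ext x
            simp [ι]
          have hi : Integrable (F.indicator fun _ => (1 : ℝ)) (μ u) :=
            (integrable_const _).indicator hF.measurableSet
          have hi2 : ∀ ψ : C(X, ℝ), Integrable (fun x => ψ x ^ 2) (μ u) := fun ψ => hint (ψ ^ 2) u
          have hi3 : Integrable (fun x => φ n x ^ 2 + φ m x ^ 2) (μ u) := (hi2 _).add (hi2 _)
          rw [h1, hsq, ← hind, ← integral_const_mul, ← integral_add (hi2 (φ n))
            (hi2 (φ m)), ← integral_sub hi3
            (hi.const_mul 2)]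
          refine integral_mono (hi2 (φ n - φ m))
            (hi3.sub (hi.const_mul 2)) fun x => ?_
          have h2 : F.indicator (fun _ => (1 : ℝ)) x ≤ φ n x * φ m x := by
            by_cases hx : x ∈ F
            · have hn : φ n x = 1 := by simp [φ, HasOuterApproxClosed.apprSeq_apply_eq_one hF n hx]
              have hm : φ m x = 1 := by simp [φ, HasOuterApproxClosed.apprSeq_apply_eq_one hF m hx]
              simp [hx, hn, hm]
            · simpa [hx] using mul_nonneg (hφ0 n x) (hφ0 m x)
          simp only [ContinuousMap.sub_apply]
          nlinarith
        rw [Metric.cauchySeq_iff]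
        intro ε hε
        obtain ⟨N, hN⟩ := (((ht2 u).eventually_lt_const
          (show (μ u).real F < (μ u).real F + ε ^ 2 / 2 by linarith [pow_pos hε 2]))).exists_forall_of_atTop
        refine ⟨N, fun n hn m hm => ?_⟩
        rw [dist_eq_norm]
        refine lt_of_pow_lt_pow_left₀ 2 hε.le ((hle n m).trans_lt ?_)
        linarith [hN n hn, hN m hm]
      obtain ⟨P, hP, -, hq⟩ := exists_isStarProjection_of_tendsto
        (T := fun n => Φ (ι (φ n))) (q := fun u => (μ u).real F) (fun n => hsa _) hc
        (fun u => (ht1 u).congr fun n => (hμ u (φ n)).symm)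
        (fun u => (ht2 u).congr fun n => (hsq (φ n) u).symm)
      exact ⟨P, hP, hq⟩
    · rintro S hS ⟨P, hP, hr⟩
      refine ⟨1 - P, hP.one_sub, fun u => ?_⟩
      rw [measureReal_compl hS, hμ1, ← hr, sub_apply, inner_sub_right, Complex.sub_re]
      congr 1
      exact inner_self_eq_norm_sq (𝕜 := ℂ) u
    · intro s hd hs hP
      choose T hT hr using hP
      obtain ⟨P, hP, hP', -⟩ := exists_proj_iUnion hμ1 hs hd hT hr
      exact ⟨P, hP, hP'⟩
  obtain ⟨E, hE⟩ := exists_of_measures hμ1 hex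
  refine ⟨E, fun φ u => ?_⟩
  rw [hE]
  let a : C(X, ℝ) := ⟨fun x => (φ x).re, by fun_prop⟩
  let b : C(X, ℝ) := ⟨fun x => (φ x).im, by fun_prop⟩
  have hφ : φ = ι a + Complex.I • ι b := by
    ext x
    have := Complex.re_add_im (φ x)
    simp [ι, a, b, mul_comm Complex.I, this]
  have h1 : ∀ c, ⟪u, Φ (ι c) u⟫_ℂ = ∫ x, ι c x ∂(μ u) := fun c => by
    rw [(hsa c).inner_eq_re]
    refine (congrArg Complex.ofReal (hμ u c)).trans ?_
    exact integral_ofReal.symm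
  have h2 : ∫ x, φ x ∂(μ u) = ∫ x, ι a x ∂(μ u) + Complex.I * ∫ x, ι b x ∂(μ u) := by
    rw [← integral_const_mul, ← integral_add]
    · refine integral_congr_ae (Eventually.of_forall fun x => ?_)
      exact congrArg (fun ψ : C(X, ℂ) => ψ x) hφ
    · exact (hint a u).ofReal
    · exact (hint b u).ofReal.const_mul _
  rw [h2, ← h1, ← h1]
  conv_lhs => rw [hφ]
  rw [map_add, map_smul, add_apply, smul_apply, inner_add_right, inner_smul_right]

end SpectralMeasure

theorem eq_zero_of_sesq {V : Type*} [AddCommGroup V] [Module ℂ V] (B : V → V → ℂ)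
    (h1 : ∀ u v w, B (u + v) w = B u w + B v w) (h2 : ∀ u v w, B u (v + w) = B u v + B u w)
    (h3 : ∀ u v, B (Complex.I • u) v = -Complex.I * B u v)
    (h4 : ∀ u v, B u (Complex.I • v) = Complex.I * B u v) (h0 : ∀ u, B u u = 0) (u v : V) :
    B u v = 0 := by
  have e1 := h0 (u + v)
  have e2 := h0 (u + Complex.I • v)
  rw [h1, h2, h2, h0, h0] at e1
  rw [h1, h2, h2, h0, h0, h3, h4] at e2
  have e3 : Complex.I * (B u v - B v u) = 0 := by linear_combination e2
  have e4 : B u v - B v u = 0 := (mul_eq_zero.1 e3).resolve_left Complex.I_ne_zero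
  linear_combination (e1 + e4) / 2

section PartialOperators

variable {H : Type*} [NormedAddCommGroup H] [InnerProductSpace ℂ H] [CompleteSpace H]

theorem pmap_inner_symm_of_isSelfAdjoint {A : H →ₗ.[ℂ] H} (hA : IsSelfAdjoint A) (x y : A.domain) :
    ⟪A x, (y : H)⟫_ℂ = ⟪(x : H), A y⟫_ℂ := by
  have h := LinearPMap.adjoint_isFormalAdjoint hA.dense_domain
  rw [LinearPMap.isSelfAdjoint_def.1 hA] at h
  exact h x y

theorem pmap_norm_add_smul_sq {A : H →ₗ.[ℂ] H} (hA : IsSelfAdjoint A) {c : ℂ} (hc : star c = -c)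
    (hc1 : ‖c‖ = 1) (x : A.domain) : ‖A x + c • (x : H)‖ ^ 2 = ‖A x‖ ^ 2 + ‖(x : H)‖ ^ 2 := by
  have h1 : (starRingEnd ℂ) ⟪A x, (x : H)⟫_ℂ = ⟪A x, (x : H)⟫_ℂ := by
    rw [inner_conj_symm, pmap_inner_symm_of_isSelfAdjoint hA]
  have h2 : (⟪A x, c • (x : H)⟫_ℂ).re = 0 := by
    have h3 : (starRingEnd ℂ) ⟪A x, c • (x : H)⟫_ℂ = - ⟪A x, c • (x : H)⟫_ℂ := by
      rw [inner_smul_right, map_mul, h1]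
      have : (starRingEnd ℂ) c = -c := hc
      rw [this, neg_mul]
    have h4 := congrArg Complex.re h3
    rw [Complex.conj_re, Complex.neg_re] at h4
    linarith
  have h5 := norm_add_sq (𝕜 := ℂ) (A x) (c • (x : H))
  rw [h5, norm_smul, hc1]
  have : RCLike.re ⟪A x, c • (x : H)⟫_ℂ = 0 := h2
  rw [this]
  ring

theorem pmap_exists_add_smul_eq {A : H →ₗ.[ℂ] H} (hA : IsSelfAdjoint A) {c : ℂ} (hc : star c = -c)
    (hc1 : ‖c‖ = 1) (v : H) : ∃ x : A.domain, A x + c • (x : H) = v := by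
  let L : A.domain →ₗ[ℂ] H := A.toFun + c • A.domain.subtype
  have hL : ∀ x, L x = A x + c • (x : H) := fun x => rfl
  let M : Submodule ℂ H := LinearMap.range L
  have hle1 : ∀ x : A.domain, ‖(x : H)‖ ≤ ‖L x‖ := fun x => by
    have := pmap_norm_add_smul_sq hA hc hc1 x
    rw [hL]
    exact pow_le_pow_iff_left₀ (norm_nonneg _) (norm_nonneg _) two_ne_zero |>.1
      (by nlinarith [sq_nonneg ‖A x‖])
  have hle2 : ∀ x : A.domain, ‖A x‖ ≤ ‖L x‖ := fun x => by
    have := pmap_norm_add_smul_sq hA hc hc1 x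
    rw [hL]
    exact pow_le_pow_iff_left₀ (norm_nonneg _) (norm_nonneg _) two_ne_zero |>.1
      (by nlinarith [sq_nonneg ‖(x : H)‖])
  have hclosed : IsClosed (M : Set H) := by
    refine isClosed_of_closure_subset fun y hy => ?_
    obtain ⟨z, hz, hzy⟩ := mem_closure_iff_seq_limit.1 hy
    choose x hx using hz
    have hcz : CauchySeq z := hzy.cauchySeq
    have hc1 : CauchySeq fun n => (x n : H) := by
      rw [Metric.cauchySeq_iff] at hcz ⊢
      intro ε hε
      obtain ⟨N, hN⟩ := hcz ε hε
      refine ⟨N, fun n hn m hm => ?_⟩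
      have := hle1 (x n - x m)
      rw [map_sub, hx, hx] at this
      rw [dist_eq_norm]
      exact this.trans_lt (by simpa [dist_eq_norm] using hN n hn m hm)
    have hc2 : CauchySeq fun n => A (x n) := by
      rw [Metric.cauchySeq_iff] at hcz ⊢
      intro ε hε
      obtain ⟨N, hN⟩ := hcz ε hε
      refine ⟨N, fun n hn m hm => ?_⟩
      have := hle2 (x n - x m)
      rw [map_sub, hx, hx, LinearPMap.map_sub] at this
      rw [dist_eq_norm]
      exact this.trans_lt (by simpa [dist_eq_norm] using hN n hn m hm)
    obtain ⟨a, ha⟩ := cauchySeq_tendsto_of_complete hc1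
    obtain ⟨b, hb⟩ := cauchySeq_tendsto_of_complete hc2
    have hg : (a, b) ∈ A.graph := by
      have hcl : _root_.IsClosed (A.graph : Set (H × H)) := hA.isClosed
      refine hcl.mem_of_tendsto (ha.prodMk_nhds hb) (Eventually.of_forall fun n => ?_)
      exact LinearPMap.mem_graph A (x n)
    obtain ⟨x0, h1, h2⟩ := (LinearPMap.mem_graph_iff A).1 hg
    refine ⟨x0, ?_⟩
    refine tendsto_nhds_unique ?_ hzy
    have h3 := hb.add (ha.const_smul c)
    rw [hL]
    simp only at h1 h2
    rw [h1, h2]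
    refine h3.congr fun n => ?_
    rw [← hx, hL]
  have horth : Mᗮ = ⊥ := by
    rw [Submodule.eq_bot_iff]
    intro w hw
    have h1 : ∀ x : A.domain, ⟪c • w, (x : H)⟫_ℂ = ⟪w, A x⟫_ℂ := fun x => by
      have h2 := Submodule.inner_left_of_mem_orthogonal (LinearMap.mem_range_self L x) hw
      rw [hL, inner_add_right, inner_smul_right] at h2
      rw [inner_smul_left]
      have : (starRingEnd ℂ) c = -c := hc
      rw [this]
      linear_combination -h2
    have hw' : w ∈ A.adjoint.domain := LinearPMap.mem_adjoint_domain_of_exists w ⟨_, h1⟩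
    have h3 : A.adjoint ⟨w, hw'⟩ = c • w :=
      LinearPMap.adjoint_apply_eq hA.dense_domain ⟨w, hw'⟩ h1
    have hg : (w, c • w) ∈ A.adjoint.graph := by
      rw [← h3]
      exact LinearPMap.mem_graph _ (⟨w, hw'⟩ : A.adjoint.domain)
    rw [LinearPMap.isSelfAdjoint_def.1 hA] at hg
    obtain ⟨x, h4, h5⟩ := (LinearPMap.mem_graph_iff A).1 hg
    simp only at h4 h5
    have h6 := pmap_norm_add_smul_sq hA (c := -c) (by rw [star_neg, hc]) (by rwa [norm_neg]) x
    rw [h5, h4] at h6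
    have h7 : c • w + -c • w = 0 := by simp
    rw [h7, norm_zero] at h6
    have h8 : ‖w‖ ^ 2 = 0 := by nlinarith [sq_nonneg ‖c • w‖, sq_nonneg ‖w‖]
    exact norm_eq_zero.1 (pow_eq_zero_iff two_ne_zero |>.1 h8)
  have : CompleteSpace M := hclosed.completeSpace_coe
  have htop : M = ⊤ := (Submodule.orthogonal_eq_bot_iff).1 horth
  have hv : v ∈ M := htop ▸ Submodule.mem_top
  exact hv

theorem pmap_exists_resolvent {A : H →ₗ.[ℂ] H} (hA : IsSelfAdjoint A) {c : ℂ} (hc : star c = -c)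
    (hc1 : ‖c‖ = 1) : ∃ R : H →L[ℂ] H, (∀ v, ∃ x : A.domain, (x : H) = R v ∧
      A x + c • (x : H) = v) ∧ ∀ x : A.domain, R (A x + c • (x : H)) = x := by
  let L : A.domain →ₗ[ℂ] H := A.toFun + c • A.domain.subtype
  have hL : ∀ x, L x = A x + c • (x : H) := fun x => rfl
  have hle : ∀ x : A.domain, ‖(x : H)‖ ≤ ‖L x‖ := fun x => by
    have := pmap_norm_add_smul_sq hA hc hc1 x
    rw [hL]
    exact pow_le_pow_iff_left₀ (norm_nonneg _) (norm_nonneg _) two_ne_zero |>.1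
      (by nlinarith [sq_nonneg ‖A x‖])
  have hinj : Function.Injective L := by
    rw [← LinearMap.ker_eq_bot, LinearMap.ker_eq_bot']
    intro x hx
    have := hle x
    rw [hx, norm_zero] at this
    exact Subtype.ext (norm_le_zero_iff.1 this)
  let e : A.domain ≃ₗ[ℂ] H := LinearEquiv.ofBijective L ⟨hinj, pmap_exists_add_smul_eq hA hc hc1⟩
  have he : ∀ x, e x = A x + c • (x : H) := fun x => rfl
  refine ⟨(A.domain.subtype ∘ₗ e.symm.toLinearMap).mkContinuous 1 fun v => ?_,
    fun v => ⟨e.symm v, rfl, ?_⟩, fun x => ?_⟩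
  · have := hle (e.symm v)
    have h2 : L (e.symm v) = v := e.apply_symm_apply v
    rw [h2] at this
    simpa using this
  · rw [← he, e.apply_symm_apply]
  · rw [← he]
    show ((e.symm (e x) : A.domain) : H) = x
    rw [e.symm_apply_apply]

theorem pmap_exists_normal_resolvent {A : H →ₗ.[ℂ] H} (hA : IsSelfAdjoint A) :
    ∃ R : H →L[ℂ] H, IsStarNormal R ∧ (∀ x : A.domain, R (A x + Complex.I • (x : H)) = x) := by
  obtain ⟨R, hR1, hR2⟩ := pmap_exists_resolvent hA (c := Complex.I) (by simp) (by simp)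
  obtain ⟨R', hR1', hR2'⟩ := pmap_exists_resolvent hA (c := -Complex.I) (by simp) (by simp)
  have hadj : R' = star R := by
    rw [ContinuousLinearMap.star_eq_adjoint, ContinuousLinearMap.eq_adjoint_iff]
    intro v w
    obtain ⟨x, hx, hv⟩ := hR1' v
    obtain ⟨y, hy, hw⟩ := hR1 w
    rw [← hx, ← hy, ← hv, ← hw, inner_add_left, inner_add_right,
      pmap_inner_symm_of_isSelfAdjoint hA, inner_smul_left, inner_smul_right]
    simp
  have hcomm : ∀ v, R (R' v) = R' (R v) := by
    intro v
    obtain ⟨x, hx, hv⟩ := hR1' v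
    obtain ⟨y, hy, hv'⟩ := hR1 v
    have e1 : R v = R' v - (2 * Complex.I) • R (R' v) := by
      have h1 : v = (A x + Complex.I • (x : H)) - (2 * Complex.I) • (x : H) := by
        rw [← hv]; module
      conv_lhs => rw [h1]
      rw [map_sub, map_smul, hR2, hx]
    have e2 : R' v = R v + (2 * Complex.I) • R' (R v) := by
      have h1 : v = (A y + (-Complex.I) • (y : H)) + (2 * Complex.I) • (y : H) := by
        rw [← hv']; module
      conv_lhs => rw [h1]
      rw [map_add, map_smul, hR2', hy]
    have e3 : (2 * Complex.I) • R (R' v) = (2 * Complex.I) • R' (R v) := by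
      have h1 : (2 * Complex.I) • R (R' v) = R' v - R v := by
        rw [eq_sub_iff_add_eq, add_comm]; exact add_eq_of_eq_sub e1
      have h2 : (2 * Complex.I) • R' (R v) = R' v - R v := by
        exact eq_sub_of_add_eq' e2.symm
      rw [h1, h2]
    exact smul_right_injective H (by simp : (2 * Complex.I) ≠ 0) e3
  refine ⟨R, ⟨?_⟩, hR2⟩
  rw [← hadj]
  ext v
  exact (hcomm v).symm

end PartialOperators

namespace SpectralMeasure

variable {X : Type*} [MeasurableSpace X] {H : Type*} [NormedAddCommGroup H]
  [InnerProductSpace ℂ H] [CompleteSpace H]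

/-- The image of a spectral measure under a measurable map. -/
def map {Y : Type*} [MeasurableSpace Y] (E : SpectralMeasure X H) (g : X → Y)
    (hg : Measurable g) : SpectralMeasure Y H where
  proj S := E.proj (g ⁻¹' S)
  isStarProjection S hS := E.isStarProjection _ (hg hS)
  proj_univ := by simpa using E.proj_univ
  hasSum_proj s hs hd u := by
    rw [Set.preimage_iUnion]
    exact E.hasSum_proj _ (fun n => hg (hs n)) (fun i j hij => (hd hij).preimage g) u

theorem measure_map {Y : Type*} [MeasurableSpace Y] (E : SpectralMeasure X H) (g : X → Y)
    (hg : Measurable g) (u : H) : (E.map g hg).measure u = (E.measure u).map g := by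
  refine Measure.ext fun S hS => ?_
  rw [measure_apply _ _ hS, Measure.map_apply hg hS, measure_apply _ _ (hg hS)]
  rfl

theorem eq_of_isIntegral_of_le (E : SpectralMeasure ℝ H) {A T : H →ₗ.[ℂ] H}
    (hA : IsSelfAdjoint A) (hT : E.IsIntegral (fun x => (x : ℂ)) T)
    (h : ∀ x : A.domain, ∃ h : (x : H) ∈ T.domain, ⟪(x : H), T ⟨x, h⟩⟫_ℂ = ⟪(x : H), A x⟫_ℂ) :
    T = A := by
  have hsymm : ∀ x y : T.domain, ⟪T x, (y : H)⟫_ℂ = ⟪(x : H), T y⟫_ℂ := by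
    intro x y
    refine sub_eq_zero.1 (eq_zero_of_sesq
      (fun x y : T.domain => ⟪T x, (y : H)⟫_ℂ - ⟪(x : H), T y⟫_ℂ) ?_ ?_ ?_ ?_ ?_ x y)
    · intro u v w
      simp only [LinearPMap.map_add, inner_add_left, Submodule.coe_add]
      ring
    · intro u v w
      simp only [LinearPMap.map_add, inner_add_right, Submodule.coe_add]
      ring
    · intro u v
      simp only [LinearPMap.map_smul, inner_smul_left, Submodule.coe_smul, Complex.conj_I]
      ring
    · intro u v
      simp only [LinearPMap.map_smul, inner_smul_right, Submodule.coe_smul]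
      ring
    · intro u
      rw [← inner_conj_symm, hT.inner_apply, integral_complex_ofReal]
      simp
  have hAT : ∀ x : A.domain, ∃ h : (x : H) ∈ T.domain, T ⟨x, h⟩ = A x := by
    choose hm hq using h
    intro x
    refine ⟨hm x, ?_⟩
    have h1 : ∀ y : A.domain, ⟪(y : H), T ⟨x, hm x⟩ - A x⟫_ℂ = 0 := by
      intro y
      have hadd : ∀ v w : A.domain, T ⟨(v + w : A.domain), hm (v + w)⟩
          = T ⟨v, hm v⟩ + T ⟨w, hm w⟩ := fun v w => by
        rw [← LinearPMap.map_add]; rfl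
      have hsmul : ∀ v : A.domain, T ⟨(Complex.I • v : A.domain), hm (Complex.I • v)⟩
          = Complex.I • T ⟨v, hm v⟩ := fun v => by
        rw [← LinearPMap.map_smul]; rfl
      refine eq_zero_of_sesq
        (fun y x : A.domain => ⟪(y : H), T ⟨x, hm x⟩ - A x⟫_ℂ) ?_ ?_ ?_ ?_ ?_ y x
      · intro u v w
        simp only [inner_add_left, Submodule.coe_add]
      · intro u v w
        simp only [hadd, LinearPMap.map_add, inner_add_right, inner_sub_right]
        ring
      · intro u v
        simp only [inner_smul_left, Submodule.coe_smul, Complex.conj_I]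
      · intro u v
        simp only [hsmul, LinearPMap.map_smul, inner_smul_right, inner_sub_right]
        ring
      · intro u
        rw [inner_sub_right, hq u, sub_self]
    have h2 := hA.dense_domain.eq_zero_of_inner_right (𝕜 := ℂ) (x := T ⟨x, hm x⟩ - A x)
      (fun y hy => h1 ⟨y, hy⟩)
    exact sub_eq_zero.1 h2
  refine le_antisymm ?_ ?_
  · have h1 : A.IsFormalAdjoint T := by
      intro x y
      obtain ⟨hx, hx'⟩ := hAT x
      rw [← hx']
      exact hsymm ⟨x, hx⟩ y
    have h2 := LinearPMap.IsFormalAdjoint.le_adjoint hA.dense_domain h1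
    rwa [LinearPMap.isSelfAdjoint_def.1 hA] at h2
  · refine ⟨fun x hx => (hAT ⟨x, hx⟩).1, ?_⟩
    intro x y hxy
    obtain ⟨h1, h2⟩ := hAT x
    rw [← h2]
    congr 1
    exact Subtype.ext hxy

/-- The spectral theorem for (unbounded) self-adjoint operators. -/
theorem exists_isIntegral_of_isSelfAdjoint {A : H →ₗ.[ℂ] H} (hA : IsSelfAdjoint A) :
    ∃ E : SpectralMeasure ℝ H, E.IsIntegral (fun x => (x : ℂ)) A := by
  obtain ⟨R, hR, hRA⟩ := pmap_exists_normal_resolvent hA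
  obtain ⟨E, hE⟩ := exists_of_starAlgHom (cfcHom (R := ℂ) (p := IsStarNormal) hR)
  have hid : ∀ v, ⟪v, R v⟫_ℂ = ∫ z : spectrum ℂ R, (z : ℂ) ∂(E.measure v) := fun v => by
    have h := hE ((ContinuousMap.id ℂ).restrict (spectrum ℂ R)) v
    rwa [cfcHom_id] at h
  have hdens : ∀ v, E.measure (R v)
      = (E.measure v).withDensity (fun z : spectrum ℂ R => ((‖(z : ℂ)‖₊ ^ 2 : ℝ≥0) : ℝ≥0∞)) := by
    intro v
    have hmeas : Measurable fun z : spectrum ℂ R => ‖(z : ℂ)‖₊ ^ 2 := by fun_prop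
    have hbd : IsFiniteMeasure ((E.measure v).withDensity
        (fun z : spectrum ℂ R => ((‖(z : ℂ)‖₊ ^ 2 : ℝ≥0) : ℝ≥0∞))) := by
      have hcont : Continuous fun z : spectrum ℂ R => ‖(z : ℂ)‖₊ ^ 2 := by fun_prop
      exact isFiniteMeasure_withDensity (BoundedContinuousFunction.lintegral_lt_top_of_nnreal
        (E.measure v) (BoundedContinuousFunction.mkOfCompact ⟨_, hcont⟩)).ne
    refine ext_of_forall_integral_eq_of_IsFiniteMeasure fun φ => ?_
    rw [integral_withDensity_eq_integral_smul hmeas]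
    let ψ : C(spectrum ℂ R, ℂ) := ⟨fun z => (φ z : ℂ), by fun_prop⟩
    let ζ : C(spectrum ℂ R, ℂ) := (ContinuousMap.id ℂ).restrict (spectrum ℂ R)
    have h1 := hE ψ (R v)
    have h2 := hE (star ζ * ψ * ζ) v
    rw [map_mul, map_mul, map_star, cfcHom_id, ContinuousLinearMap.star_eq_adjoint,
      mul_apply_eq_comp, mul_apply_eq_comp, ContinuousLinearMap.adjoint_inner_right, h1] at h2
    have h3 : ∀ z, (star ζ * ψ * ζ) z = (((‖(z : ℂ)‖₊ ^ 2) • φ z : ℝ) : ℂ) := by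
      intro z
      have : (starRingEnd ℂ) (z : ℂ) * z = ((‖(z : ℂ)‖ ^ 2 : ℝ) : ℂ) := by
        rw [mul_comm, Complex.mul_conj, Complex.normSq_eq_norm_sq]
      simp only [ψ, ζ, ContinuousMap.mul_apply, ContinuousMap.star_apply]
      simp [NNReal.smul_def]
      push_cast at this
      linear_combination (φ z : ℂ) * this
    simp only [h3] at h2
    have h4 : ∫ z, ψ z ∂(E.measure (R v)) = ((∫ z, φ z ∂(E.measure (R v)) : ℝ) : ℂ) :=
      integral_complex_ofReal
    rw [h4, integral_complex_ofReal] at h2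
    exact_mod_cast h2
  let g : spectrum ℂ R → ℝ := fun z => ((z : ℂ)⁻¹).re
  have hg : Measurable g := by fun_prop
  refine ⟨E.map g hg, ?_⟩
  obtain ⟨T, hT⟩ := (E.map g hg).exists_isIntegral (f := fun x => (x : ℂ)) (by fun_prop)
  have hgz : ∀ z : spectrum ℂ R, ‖(z : ℂ)‖ ^ 2 * g z = (z : ℂ).re := by
    intro z
    by_cases hz : (z : ℂ) = 0
    · simp [g, hz]
    · have : Complex.normSq (z : ℂ) ≠ 0 := by simpa using hz
      simp only [g, Complex.inv_re, ← Complex.normSq_eq_norm_sq]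
      field_simp
  have hTA : T = A := by
    refine eq_of_isIntegral_of_le (E.map g hg) hA hT fun x => ?_
    set v : H := A x + Complex.I • (x : H) with hv
    have hx : R v = x := hRA x
    have hm : (x : H) ∈ T.domain := by
      rw [hT.mem_domain_iff, measure_map, memLp_map_measure_iff (by fun_prop) hg.aemeasurable,
        ← hx, hdens, memLp_two_iff_integrable_sq_norm (by fun_prop),
        integrable_withDensity_iff_integrable_smul (by fun_prop)]
      refine (integrable_const (1 : ℝ)).mono' (by fun_prop) (Eventually.of_forall fun z => ?_)
      have h1 : ‖(z : ℂ)‖ * |g z| ≤ 1 := by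
        have h2 : |g z| ≤ ‖(z : ℂ)‖⁻¹ := by
          rw [← norm_inv]
          exact Complex.abs_re_le_norm _
        exact (mul_le_mul_of_nonneg_left h2 (norm_nonneg _)).trans mul_inv_le_one
      have h3 : (‖(z : ℂ)‖ * |g z|) ^ 2 ≤ 1 := pow_le_one₀ (by positivity) h1
      simp only [NNReal.smul_def, Function.comp_apply, Complex.norm_real, Real.norm_eq_abs]
      rw [smul_eq_mul, NNReal.coe_pow, coe_nnnorm, ← mul_pow, abs_of_nonneg (by positivity)]
      exact h3
    refine ⟨hm, ?_⟩
    have h1 := hT.inner_apply ⟨x, hm⟩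
    refine h1.trans ?_
    rw [measure_map, integral_map hg.aemeasurable (by fun_prop)]
    have h2 : ∫ z, ((g z : ℝ) : ℂ) ∂(E.measure (x : H))
        = ((∫ z : spectrum ℂ R, (z : ℂ).re ∂(E.measure v) : ℝ) : ℂ) := by
      rw [integral_complex_ofReal, ← hx, hdens,
        integral_withDensity_eq_integral_smul (by fun_prop)]
      congr 2
      ext z
      rw [NNReal.smul_def, smul_eq_mul, NNReal.coe_pow, coe_nnnorm, hgz]
    have h3 : (⟪v, (x : H)⟫_ℂ).re = ∫ z : spectrum ℂ R, (z : ℂ).re ∂(E.measure v) := by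
      rw [← hx, hid]
      refine (integral_re (𝕜 := ℂ) ?_).symm
      exact (continuous_subtype_val).integrable_of_hasCompactSupport
        (HasCompactSupport.of_compactSpace _)
    rw [h2, ← h3]
    have h4 : ⟪v, (x : H)⟫_ℂ = ⟪A x, (x : H)⟫_ℂ - Complex.I * ⟪(x : H), (x : H)⟫_ℂ := by
      rw [hv, inner_add_left, inner_smul_left, Complex.conj_I]
      ring
    have h5 : (starRingEnd ℂ) ⟪(x : H), A x⟫_ℂ = ⟪(x : H), A x⟫_ℂ := by
      rw [inner_conj_symm, pmap_inner_symm_of_isSelfAdjoint hA]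
    rw [h4, pmap_inner_symm_of_isSelfAdjoint hA]
    rw [inner_self_eq_norm_sq_to_K]
    refine Eq.trans ?_ (Complex.conj_eq_iff_re.1 h5)
    congr 1
    simp [← Complex.ofReal_pow]
  rw [← hTA]
  exact hT

/-- The spectral measure `E_A` of a self-adjoint operator `A`, i.e. `A = ∫ x dE_A(x)`. -/
noncomputable def ofSelfAdjoint (A : H →ₗ.[ℂ] H) (hA : IsSelfAdjoint A) : SpectralMeasure ℝ H :=
  (exists_isIntegral_of_isSelfAdjoint hA).choose

theorem isIntegral_ofSelfAdjoint {A : H →ₗ.[ℂ] H} (hA : IsSelfAdjoint A) :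
    (ofSelfAdjoint A hA).IsIntegral (fun x => (x : ℂ)) A :=
  (exists_isIntegral_of_isSelfAdjoint hA).choose_spec

end SpectralMeasure

/-- The function `f(A) = ∫ f dE_A` of a self-adjoint operator `A`. -/
noncomputable def selfAdjointFun {H : Type*} [NormedAddCommGroup H] [InnerProductSpace ℂ H]
    [CompleteSpace H] (f : ℝ → ℂ) (hf : Measurable f) (A : H →ₗ.[ℂ] H) (hA : IsSelfAdjoint A) :
    H →ₗ.[ℂ] H :=
  (SpectralMeasure.ofSelfAdjoint A hA).integral f hf

/-- `S - T` is a bounded operator, equal to `K`: the domain of `T` is contained in the domain of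
`S`, and `Ku = Su - Tu` for all `u` in the domain of `T`. -/
def IsBoundedDifference {H : Type*} [NormedAddCommGroup H] [InnerProductSpace ℂ H]
    (S T : H →ₗ.[ℂ] H) (K : H →L[ℂ] H) : Prop :=
  ∃ h : T.domain ≤ S.domain, ∀ u : T.domain, K u = S ⟨u, h u.2⟩ - T u

/-- `‖f(A) - f(B)‖ ≤ c ‖A - B‖` for all self-adjoint operators `A` and `B` (in Hilbert spaces of
the universe `v`) with bounded difference. -/
def OperatorLipschitzWith.{v} (c : ℝ) (f : ℝ → ℂ) (hf : Continuous f) : Prop :=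
  ∀ (H : Type v) [NormedAddCommGroup H] [InnerProductSpace ℂ H] [CompleteSpace H]
    (A B : H →ₗ.[ℂ] H) (hA : IsSelfAdjoint A) (hB : IsSelfAdjoint B) (K : H →L[ℂ] H),
    IsBoundedDifference A B K →
      ∃ L : H →L[ℂ] H, IsBoundedDifference (selfAdjointFun f hf.measurable A hA)
        (selfAdjointFun f hf.measurable B hB) L ∧ ‖L‖ ≤ c * ‖K‖

/-- A function `w` generating a Littlewood–Paley decomposition. -/
structure LittlewoodPaleyWindow where
  toFun : ℝ → ℝ
  contDiff : ContDiff ℝ (⊤ : ℕ∞) toFun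
  nonneg : ∀ s, 0 ≤ toFun s
  tsupport_subset : tsupport toFun ⊆ Set.Icc (1 / 2) 2
  eq_one_sub : ∀ s ∈ Set.Icc (1 : ℝ) 2, toFun s = 1 - toFun (s / 2)

namespace LittlewoodPaleyWindow

theorem eq_zero_of_nonpos (w : LittlewoodPaleyWindow) {s : ℝ} (hs : s ≤ 0) : w.toFun s = 0 := by
  refine image_eq_zero_of_notMem_tsupport fun h => ?_
  have := (w.tsupport_subset h).1
  linarith

theorem comp_abs_eq (w : LittlewoodPaleyWindow) (c : ℝ) (hc : 0 < c) :
    (fun ξ : ℝ => ((w.toFun (c * |ξ|) : ℝ) : ℂ))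
      = fun ξ : ℝ => ((w.toFun (c * ξ) + w.toFun (-(c * ξ)) : ℝ) : ℂ) := by
  ext ξ
  rcases le_total 0 ξ with h | h
  · rw [abs_of_nonneg h, w.eq_zero_of_nonpos (s := -(c * ξ)) (by nlinarith), add_zero]
  · rw [abs_of_nonpos h, w.eq_zero_of_nonpos (s := c * ξ) (by nlinarith), zero_add, mul_neg]

theorem contDiff_symbol (w : LittlewoodPaleyWindow) (c : ℝ) (hc : 0 < c) :
    ContDiff ℝ (⊤ : ℕ∞) fun ξ : ℝ => ((w.toFun (c * |ξ|) : ℝ) : ℂ) := by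
  rw [w.comp_abs_eq c hc]
  have := w.contDiff
  exact Complex.ofRealCLM.contDiff.comp
    ((this.comp (contDiff_const.mul contDiff_id)).add
      (this.comp (contDiff_const.mul contDiff_id).neg))

theorem hasCompactSupport_symbol (w : LittlewoodPaleyWindow) (c : ℝ) (hc : 0 < c) :
    HasCompactSupport fun ξ : ℝ => ((w.toFun (c * |ξ|) : ℝ) : ℂ) := by
  refine HasCompactSupport.intro (isCompact_Icc (a := -(2 / c)) (b := 2 / c)) fun ξ hξ => ?_
  have h : w.toFun (c * |ξ|) = 0 := by
    refine image_eq_zero_of_notMem_tsupport fun h => hξ ?_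
    have h2 := (w.tsupport_subset h).2
    rw [Set.mem_Icc, ← abs_le, le_div_iff₀ hc]
    linarith
  simp [h]

/-- The function `W_n` with `∫ W_n(x) exp(-ixt) dx = w(|t| / 2 ^ n)`. Since `𝓕` is normalized by
`(𝓕 f)(ξ) = ∫ f(x) exp(-2πixξ) dx`, this says `(𝓕 W_n)(ξ) = w(2π|ξ| / 2 ^ n)`. -/
noncomputable def kernel (w : LittlewoodPaleyWindow) (n : ℤ) : 𝓢(ℝ, ℂ) :=
  𝓕⁻ ((w.hasCompactSupport_symbol (2 * Real.pi / 2 ^ n) (by positivity)).toSchwartzMap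
    (w.contDiff_symbol (2 * Real.pi / 2 ^ n) (by positivity)))

end LittlewoodPaleyWindow

/-- The convolution `(f * φ)(x) = ⟨f, φ(x - ·)⟩` of a tempered distribution and a Schwartz
function. -/
noncomputable def temperedConvolution (f : 𝓢'(ℝ, ℂ)) (φ : 𝓢(ℝ, ℂ)) (x : ℝ) : ℂ :=
  f (SchwartzMap.compSubConstCLM ℂ x
    (SchwartzMap.compCLMOfContinuousLinearEquiv ℂ (ContinuousLinearEquiv.neg ℝ) φ))

theorem temperedConvolution_test (φ : 𝓢(ℝ, ℂ)) (x y : ℝ) :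
    SchwartzMap.compSubConstCLM ℂ x
      (SchwartzMap.compCLMOfContinuousLinearEquiv ℂ (ContinuousLinearEquiv.neg ℝ) φ) y
      = φ (x - y) := by
  simp

/-- The Littlewood–Paley piece `f_n = f * W_n`. -/
noncomputable def besovPiece (w : LittlewoodPaleyWindow) (f : 𝓢'(ℝ, ℂ)) (n : ℤ) : ℝ → ℂ :=
  temperedConvolution f (w.kernel n)

/-- The (semi)norm `‖f‖ = ∑ₙ 2 ^ n ‖f_n‖_{L^∞}` of the Besov class `B^1_{∞,1}(ℝ)`. -/
noncomputable def besovNorm (w : LittlewoodPaleyWindow) (f : 𝓢'(ℝ, ℂ)) : ℝ≥0∞ :=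
  ∑' n : ℤ, (2 : ℝ≥0∞) ^ n * eLpNorm (besovPiece w f n) ⊤ volume

/-- The Besov class `B^1_{∞,1}(ℝ)`: tempered distributions `f` with `‖f‖ < ∞` such that
`f' = ∑ₙ f_n'` in the space of tempered distributions (with its weak topology). -/
structure MemBesov (w : LittlewoodPaleyWindow) (f : 𝓢'(ℝ, ℂ)) : Prop where
  norm_lt_top : besovNorm w f < ⊤
  hasSum_deriv : ∀ φ : 𝓢(ℝ, ℂ), HasSum (fun n : ℤ => ∫ x, deriv (besovPiece w f n) x * φ x)
    (TemperedDistribution.derivCLM ℂ f φ)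

/-- The tempered distribution `u` is given by the function `f`. -/
def IsGivenBy (u : 𝓢'(ℝ, ℂ)) (f : ℝ → ℂ) : Prop :=
  ∀ φ : 𝓢(ℝ, ℂ), Integrable (fun x => f x * φ x) ∧ u φ = ∫ x, f x * φ x

/-- `f` is operator Lipschitz on the real line. -/
def IsOperatorLipschitz.{v} (f : ℝ → ℂ) (hf : Continuous f) : Prop :=
  ∃ c : ℝ, OperatorLipschitzWith.{v} c f hf

universe v

/-!
The pieces `f_n = f * W_n` of a distribution in the Besov class are restrictions of entire functions
of exponential type, and the estimate is proved for each piece and then summed.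

*One piece.* Let `g` be entire of exponential type `τ` and bounded by `M` on the real line. If `T`
is self-adjoint and `Y` skew-adjoint in a C⋆-algebra, then `[T, Y]` is self-adjoint, so
`z ↦ g(T + z [T, Y])` is an entire function of exponential type `τ ‖[T, Y]‖` which is bounded by
`M` on the real line, by the functional calculus. Its derivative at zero is `[g(T), Y]`. Bernstein's
inequality, which up to a factor `e` follows from the Phragmén–Lindelöf principle and Cauchy's
estimate, therefore gives `‖[g(T), Y]‖ ≤ e τ M ‖[T, Y]‖` (`IsExpTypeSeries.norm_commutator_le`).
Applied to `T = diag(a, b)` and `Y = [[0, x], [-x⋆, 0]]`, this becomes the quasicommutator estimate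
`‖g(a) x - x g(b)‖ ≤ e τ M ‖a x - x b‖` (`IsExpTypeSeries.norm_mul_sub_mul_le`). No Schur
multipliers or double operator integrals are needed. For the piece `f_n` one can take
`τ = 4 * 2 ^ n` (`exists_isExpTypeSeries_besovPiece`), whence the constant `4 e` in the theorem.

*Summation.* For operators `a` and `b` with finite spectrum the quasicommutator estimate only
involves the values of the function at finitely many points, and constants do not contribute. It is
therefore inherited by `∑ (f_n - f_n(0))`, a series which converges pointwise because each `f_n` is
Lipschitz with constant `4 e 2 ^ n ‖f_n‖` (`IsSimpleOperatorLipschitz.of_hasSum`).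

*Unbounded operators.* Let `E` and `G` be the spectral measures of `A` and `B`. For
`X = E [-a, a] G [-b, b]` the operator `A X - X B` is a compression of `A - B`, and `A` and `B` are
bounded on the ranges of the projections, so that they can be approximated in norm by operators with
finite spectrum. Letting `b → ∞` and then `a → ∞` gives the estimate for `f(A) - f(B)`; the bound
is uniform in the truncations, and so the inclusion of the domains comes with it
(`IsSimpleOperatorLipschitz.exists_mem_domain`).

*Identification of the distribution.* The condition `f' = ∑ f_n'` says that the distribution and
the function `∑ (f_n - f_n(0))` have the same derivative, hence differ by a constant
(`MemBesov.exists_isGivenBy`).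
-/

/-! ### Bernstein's inequality for vector-valued entire functions -/

/-- The Phragmén–Lindelöf estimate in the upper half-plane: an entire function of exponential type
`σ` which is bounded by `M` on the real line is bounded by `M * exp (σ * Im z)` for `Im z ≥ 0`. -/
theorem norm_le_mul_exp_im_of_exponentialType {E : Type*} [NormedAddCommGroup E] [NormedSpace ℂ E]
    {F : ℂ → E} (hF : Differentiable ℂ F) {D σ M : ℝ} (hσ : 0 ≤ σ)
    (hgrowth : ∀ z, ‖F z‖ ≤ D * Real.exp (σ * ‖z‖)) (hreal : ∀ t : ℝ, ‖F t‖ ≤ M)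
    {z : ℂ} (hz : 0 ≤ z.im) : ‖F z‖ ≤ M * Real.exp (σ * z.im) := by
  have hD : 0 ≤ D := by simpa using (norm_nonneg _).trans (hgrowth 0)
  -- The upper half-plane is rotated to the right one, where the exponential factor is removed.
  let f : ℂ → E := fun ζ => Complex.exp (-(σ * ζ)) • F (Complex.I * ζ)
  have hf : Differentiable ℂ f := by
    refine Differentiable.smul (by fun_prop) (hF.comp (by fun_prop))
  have hnorm : ∀ ζ, ‖f ζ‖ = Real.exp (-(σ * ζ.re)) * ‖F (Complex.I * ζ)‖ := fun ζ => by
    simp [f, norm_smul, Complex.norm_exp]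
  have key : ‖f (-Complex.I * z)‖ ≤ M := by
    refine PhragmenLindelof.right_half_plane_of_bounded_on_real hf.diffContOnCl
      ⟨1, by norm_num, 2 * σ, ?_⟩ ?_ (fun x => ?_) (by simpa using hz)
    · refine Asymptotics.IsBigO.of_bound D (Eventually.of_forall fun ζ => ?_)
      rw [hnorm, Real.rpow_one, Real.norm_eq_abs, Real.abs_exp]
      have h1 := hgrowth (Complex.I * ζ)
      rw [norm_mul, Complex.norm_I, one_mul] at h1
      have h2 : Real.exp (-(σ * ζ.re)) ≤ Real.exp (σ * ‖ζ‖) := by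
        rw [Real.exp_le_exp, ← mul_neg]
        exact mul_le_mul_of_nonneg_left
          ((neg_le_abs _).trans (Complex.abs_re_le_norm ζ)) hσ
      calc _ ≤ Real.exp (σ * ‖ζ‖) * (D * Real.exp (σ * ‖ζ‖)) :=
            mul_le_mul h2 h1 (norm_nonneg _) (Real.exp_pos _).le
        _ = D * Real.exp (2 * σ * ‖ζ‖) := by
            rw [show 2 * σ * ‖ζ‖ = σ * ‖ζ‖ + σ * ‖ζ‖ by ring, Real.exp_add]; ring
    · refine ⟨D, ?_⟩
      rw [eventually_map]
      filter_upwards [eventually_ge_atTop 0] with x hx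
      have h1 := hgrowth (Complex.I * x)
      rw [norm_mul, Complex.norm_I, one_mul, Complex.norm_real, Real.norm_eq_abs,
        abs_of_nonneg hx] at h1
      rw [hnorm, Complex.ofReal_re]
      calc _ ≤ Real.exp (-(σ * x)) * (D * Real.exp (σ * x)) := by gcongr
        _ = D := by rw [mul_left_comm, ← Real.exp_add]; simp
    · have h1 : Complex.I * (x * Complex.I) = ((-x : ℝ) : ℂ) := by
        push_cast; linear_combination (x : ℂ) * Complex.I_mul_I
      rw [hnorm, h1]
      simpa using hreal (-x)
  rw [hnorm] at key
  have h1 : Complex.I * (-Complex.I * z) = z := by linear_combination -z * Complex.I_mul_I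
  have h2 : (-Complex.I * z).re = z.im := by simp
  rw [h1, h2, Real.exp_neg, ← div_eq_inv_mul, div_le_iff₀ (Real.exp_pos _)] at key
  exact key

/-- Bernstein's inequality, up to the factor `e`. -/
theorem norm_deriv_le_of_exponentialType {E : Type*} [NormedAddCommGroup E] [NormedSpace ℂ E]
    {F : ℂ → E} (hF : Differentiable ℂ F) {D σ M : ℝ} (hσ : 0 < σ)
    (hgrowth : ∀ z, ‖F z‖ ≤ D * Real.exp (σ * ‖z‖)) (hreal : ∀ t : ℝ, ‖F t‖ ≤ M) :
    ‖deriv F 0‖ ≤ Real.exp 1 * σ * M := by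
  have hM : 0 ≤ M := (norm_nonneg _).trans (hreal 0)
  have h1 : ∀ z, ‖F z‖ ≤ M * Real.exp (σ * ‖z‖) := by
    intro z
    rcases le_total 0 z.im with hz | hz
    · refine (norm_le_mul_exp_im_of_exponentialType hF hσ.le hgrowth hreal hz).trans ?_
      gcongr
      exact (le_abs_self _).trans (Complex.abs_im_le_norm z)
    · have h2 := norm_le_mul_exp_im_of_exponentialType (F := fun z => F (-z)) (z := -z)
        (hF.comp differentiable_neg) hσ.le (fun z => by simpa using hgrowth (-z))
        (fun t => by simpa using hreal (-t)) (by simpa using hz)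
      rw [neg_neg] at h2
      refine h2.trans ?_
      gcongr
      rw [Complex.neg_im]
      exact (neg_le_abs _).trans (Complex.abs_im_le_norm z)
  -- Cauchy's estimate on the circle of radius `1 / σ`.
  have h2 := Complex.norm_deriv_le_of_forall_mem_sphere_norm_le (c := 0) (R := σ⁻¹)
    (C := M * Real.exp 1) (inv_pos.2 hσ) hF.diffContOnCl fun z hz => by
      refine (h1 z).trans_eq ?_
      rw [mem_sphere_zero_iff_norm.1 hz, mul_inv_cancel₀ hσ.ne']
  refine h2.trans_eq ?_
  rw [div_inv_eq_mul]
  ring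

/-! ### Entire functions of exponential type in Banach algebras -/

/-- The coefficients `c` are those of an entire function `∑ c n * z ^ n` of exponential type at
most `τ`, with the constant `D` in the bound. -/
def IsExpTypeSeries (c : ℕ → ℂ) (D τ : ℝ) : Prop :=
  ∀ n, ‖c n‖ ≤ D * (τ ^ n / n.factorial)

namespace IsExpTypeSeries

variable {c : ℕ → ℂ} {D τ : ℝ}

theorem nonneg (hc : IsExpTypeSeries c D τ) : 0 ≤ D := by
  simpa using (norm_nonneg _).trans (hc 0)

variable {𝔸 : Type*} [NormedRing 𝔸] [NormedAlgebra ℂ 𝔸]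

theorem norm_smul_pow_le (hc : IsExpTypeSeries c D τ) (hτ : 0 ≤ τ) {a : 𝔸} {r : ℝ} (ha : ‖a‖ ≤ r)
    (n : ℕ) : ‖c n • a ^ n‖ ≤ max 1 ‖(1 : 𝔸)‖ * D * ((τ * r) ^ n / n.factorial) := by
  have h1 : ‖a ^ n‖ ≤ max 1 ‖(1 : 𝔸)‖ * r ^ n := by
    rcases n.eq_zero_or_pos with rfl | hn
    · simp
    · refine (norm_pow_le' a hn).trans ((pow_le_pow_left₀ (norm_nonneg a) ha n).trans ?_)
      exact le_mul_of_one_le_left (pow_nonneg ((norm_nonneg a).trans ha) n) (le_max_left _ _)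
  have hD := hc.nonneg
  calc ‖c n • a ^ n‖ = ‖c n‖ * ‖a ^ n‖ := norm_smul _ _
    _ ≤ (D * (τ ^ n / n.factorial)) * (max 1 ‖(1 : 𝔸)‖ * r ^ n) :=
        mul_le_mul (hc n) h1 (norm_nonneg _) (by positivity)
    _ = _ := by rw [mul_pow]; ring

theorem summable_bound (K : ℝ) (r : ℝ) :
    Summable fun n : ℕ => K * (r ^ n / n.factorial) :=
  (Real.summable_pow_div_factorial r).mul_left K

theorem summable [CompleteSpace 𝔸] (hc : IsExpTypeSeries c D τ) (hτ : 0 ≤ τ) (a : 𝔸) :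
    Summable fun n => c n • a ^ n :=
  Summable.of_norm_bounded (summable_bound _ _) (hc.norm_smul_pow_le hτ le_rfl)

theorem norm_tsum_le (hc : IsExpTypeSeries c D τ) (hτ : 0 ≤ τ) {a : 𝔸} {r : ℝ} (ha : ‖a‖ ≤ r) :
    ‖∑' n, c n • a ^ n‖ ≤ max 1 ‖(1 : 𝔸)‖ * D * Real.exp (τ * r) := by
  refine tsum_of_norm_bounded ?_ (hc.norm_smul_pow_le hτ ha)
  refine HasSum.mul_left _ ?_
  rw [Real.exp_eq_exp_ℝ]
  exact NormedSpace.expSeries_div_hasSum_exp (τ * r)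

theorem hasDerivAt_pow_add_smul_commutator (T Y : 𝔸) (n : ℕ) :
    HasDerivAt (fun z : ℂ => (T + z • (T * Y - Y * T)) ^ n) (T ^ n * Y - Y * T ^ n) 0 := by
  induction n with
  | zero => simpa using hasDerivAt_const (0 : ℂ) (1 : 𝔸)
  | succ n ih =>
    have h1 : HasDerivAt (fun z : ℂ => T + z • (T * Y - Y * T)) (T * Y - Y * T) 0 := by
      simpa using ((hasDerivAt_id (0 : ℂ)).smul_const (T * Y - Y * T)).const_add T
    have h2 := ih.mul h1
    simp only [zero_smul, add_zero] at h2
    convert h2 using 1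
    · ext z; simp [pow_succ]
    · simp only [pow_succ]; noncomm_ring

theorem norm_add_smul_le (T S : 𝔸) (z : ℂ) : ‖T + z • S‖ ≤ ‖T‖ + ‖z‖ * ‖S‖ :=
  (norm_add_le _ _).trans (by rw [norm_smul])

variable [CompleteSpace 𝔸]

theorem differentiable_tsum_add_smul (hc : IsExpTypeSeries c D τ) (hτ : 0 ≤ τ) (T S : 𝔸) :
    Differentiable ℂ fun z : ℂ => ∑' n, c n • (T + z • S) ^ n := by
  intro z
  have h := Complex.differentiableOn_tsum_of_summable_norm (U := Metric.ball 0 (‖z‖ + 1))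
    (F := fun n (z : ℂ) => c n • (T + z • S) ^ n) (summable_bound _ _) (fun n => by fun_prop)
    Metric.isOpen_ball (fun n w hw => hc.norm_smul_pow_le hτ (r := ‖T‖ + (‖z‖ + 1) * ‖S‖) ?_ n)
  · exact h.differentiableAt (Metric.isOpen_ball.mem_nhds (by simp))
  · refine (norm_add_smul_le T S w).trans ?_
    gcongr
    exact (mem_ball_zero_iff.1 hw).le

/-- The derivative of `g (T + z [T, Y])` at `z = 0` is the commutator `[g(T), Y]`. -/
theorem deriv_tsum_add_smul_commutator (hc : IsExpTypeSeries c D τ) (hτ : 0 ≤ τ) (T Y : 𝔸) :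
    deriv (fun z : ℂ => ∑' n, c n • (T + z • (T * Y - Y * T)) ^ n) 0
      = (∑' n, c n • T ^ n) * Y - Y * ∑' n, c n • T ^ n := by
  set S := T * Y - Y * T with hS
  have h := Complex.hasSum_deriv_of_summable_norm (U := Metric.ball 0 1) (z := 0)
    (F := fun n (z : ℂ) => c n • (T + z • S) ^ n) (summable_bound _ _) (fun n => by fun_prop)
    Metric.isOpen_ball (fun n w hw => hc.norm_smul_pow_le hτ (r := ‖T‖ + 1 * ‖S‖)
      ((norm_add_smul_le T S w).trans (by gcongr; exact (mem_ball_zero_iff.1 hw).le)) n)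
      (Metric.mem_ball_self one_pos)
  have h2 := (hc.summable hτ T).hasSum
  refine h.unique ?_
  refine ((h2.mul_right Y).sub (h2.mul_left Y)).congr_fun ?_
  intro n
  have h3 : HasDerivAt (fun z : ℂ => c n • (T + z • S) ^ n) _ 0 :=
    (hasDerivAt_pow_add_smul_commutator T Y n).const_smul (c n)
  rw [h3.deriv, smul_sub, smul_mul_assoc, mul_smul_comm]

/-- An entire function of exponential type which is bounded by `M` on the real line is bounded by
`M` at the self-adjoint elements of a C⋆-algebra. -/
theorem norm_tsum_le_of_isSelfAdjoint {𝔸 : Type*} [CStarAlgebra 𝔸]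
    (hc : IsExpTypeSeries c D τ) (hτ : 0 ≤ τ) {M : ℝ}
    (hM : ∀ x : ℝ, ‖∑' n, c n * (x : ℂ) ^ n‖ ≤ M) {y : 𝔸} (hy : IsSelfAdjoint y) :
    ‖∑' n, c n • y ^ n‖ ≤ M := by
  have hM0 : 0 ≤ M := (norm_nonneg _).trans (hM 0)
  have hn : IsStarNormal y := hy.isStarNormal
  let p : Finset ℕ → ℂ → ℂ := fun s z => ∑ n ∈ s, c n * z ^ n
  have hp : ∀ s, cfc (p s) y = ∑ n ∈ s, c n • y ^ n := by
    intro s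
    have : p s = ∑ n ∈ s, fun z => c n * z ^ n := by ext; simp [p]
    rw [this, cfc_sum (fun n (z : ℂ) => c n * z ^ n) y s (fun n _ => by fun_prop)]
    refine Finset.sum_congr rfl fun n _ => ?_
    rw [cfc_const_mul (c n) (fun z : ℂ => z ^ n) y (by fun_prop), cfc_pow_id y n]
  have hlim : Tendsto (fun s => cfc (p s) y) atTop
      (𝓝 (cfc (fun z => ∑' n, c n * z ^ n) y)) := by
    refine tendsto_cfc_fun ?_ (Eventually.of_forall fun s => by fun_prop)
    refine tendstoUniformlyOn_tsum (summable_bound _ _)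
      (fun n z hz => hc.norm_smul_pow_le (𝔸 := ℂ) hτ (r := ‖y‖ * ‖(1 : 𝔸)‖) ?_ n)
    exact spectrum.norm_le_norm_mul_of_mem hz
  simp only [hp] at hlim
  rw [tendsto_nhds_unique (hc.summable hτ y).hasSum hlim]
  refine norm_cfc_le hM0 fun z hz => ?_
  rw [hy.mem_spectrum_eq_re hz]
  exact hM _

/-- Bernstein's inequality for commutators: the entire function `z ↦ g (T + z [T, Y])` has
exponential type `τ ‖[T, Y]‖` and is bounded by `M` on the real line, because `[T, Y]` is
self-adjoint. Its derivative at zero is `[g(T), Y]`. -/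
theorem norm_commutator_le {𝔸 : Type*} [CStarAlgebra 𝔸]
    (hc : IsExpTypeSeries c D τ) (hτ : 0 < τ) {M : ℝ}
    (hM : ∀ x : ℝ, ‖∑' n, c n * (x : ℂ) ^ n‖ ≤ M) {T Y : 𝔸} (hT : IsSelfAdjoint T)
    (hY : star Y = -Y) :
    ‖(∑' n, c n • T ^ n) * Y - Y * ∑' n, c n • T ^ n‖
      ≤ Real.exp 1 * τ * M * ‖T * Y - Y * T‖ := by
  have hM0 : 0 ≤ M := (norm_nonneg _).trans (hM 0)
  have hS : IsSelfAdjoint (T * Y - Y * T) := by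
    rw [isSelfAdjoint_iff, star_sub, star_mul, star_mul, hY, hT.star_eq]
    noncomm_ring
  rw [← hc.deriv_tsum_add_smul_commutator hτ.le]
  set S := T * Y - Y * T with hSdef
  -- Any type `τ r` with `r > ‖S‖` is positive, even if `S = 0`.
  have key : ∀ r, ‖S‖ < r → ‖deriv (fun z : ℂ => ∑' n, c n • (T + z • S) ^ n) 0‖
      ≤ Real.exp 1 * (τ * r) * M := by
    intro r hr
    refine norm_deriv_le_of_exponentialType (hc.differentiable_tsum_add_smul hτ.le T S)
      (D := max 1 ‖(1 : 𝔸)‖ * D * Real.exp (τ * ‖T‖))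
      (mul_pos hτ ((norm_nonneg S).trans_lt hr)) (fun z => ?_) (fun t => ?_)
    · refine (hc.norm_tsum_le hτ.le (r := ‖T‖ + ‖z‖ * r)
        ((norm_add_smul_le T S z).trans (by gcongr))).trans_eq ?_
      rw [mul_add, Real.exp_add]
      ring_nf
    · refine hc.norm_tsum_le_of_isSelfAdjoint hτ.le hM (hT.add ?_)
      exact IsSelfAdjoint.smul (by simp [isSelfAdjoint_iff]) hS
  have h1 : Tendsto (fun r => Real.exp 1 * (τ * r) * M) (𝓝[>] ‖S‖)
      (𝓝 (Real.exp 1 * (τ * ‖S‖) * M)) :=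
    (Continuous.tendsto (by fun_prop) _).mono_left nhdsWithin_le_nhds
  refine (ge_of_tendsto h1 (eventually_mem_nhdsWithin.mono key)).trans_eq ?_
  ring

end IsExpTypeSeries

/-! ### Quasicommutators via block matrices -/

section BlockMatrices

variable {A : Type*} [CStarAlgebra A]

/-- The embedding of `A × A` in the C⋆-algebra of `2 × 2` matrices as diagonal matrices. -/
def CStarMatrix.diagPair : A × A →⋆ₐ[ℂ] CStarMatrix (Fin 2) (Fin 2) A where
  toFun p := CStarMatrix.ofMatrix !![p.1, 0; 0, p.2]
  map_one' := by ext i j; fin_cases i <;> fin_cases j <;> simp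
  map_mul' p q := by
    ext i j; fin_cases i <;> fin_cases j <;> simp [CStarMatrix.mul_apply]
  map_zero' := by ext i j; fin_cases i <;> fin_cases j <;> simp
  map_add' p q := by ext i j; fin_cases i <;> fin_cases j <;> simp
  commutes' r := by
    ext i j; fin_cases i <;> fin_cases j <;> simp [CStarMatrix.algebraMap_apply]
  map_star' p := by ext i j; fin_cases i <;> fin_cases j <;> simp [CStarMatrix.star_apply]

theorem CStarMatrix.diagPair_apply (p : A × A) :
    diagPair p = CStarMatrix.ofMatrix !![p.1, 0; 0, p.2] := rfl

variable [PartialOrder A] [StarOrderedRing A]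

/-- The matrix is the product of `diag(d, d⋆)` and the unitary that swaps the coordinates. -/
theorem CStarMatrix.norm_antidiag_le (d : A) :
    ‖CStarMatrix.ofMatrix !![0, d; star d, 0]‖ ≤ ‖d‖ := by
  let J : CStarMatrix (Fin 2) (Fin 2) A := CStarMatrix.ofMatrix !![0, 1; 1, 0]
  have hJ : star J * J = 1 := by
    ext i j
    fin_cases i <;> fin_cases j <;>
      simp [J, CStarMatrix.mul_apply, CStarMatrix.star_apply]
  have h1 : (CStarMatrix.ofMatrix !![0, d; star d, 0] : CStarMatrix (Fin 2) (Fin 2) A)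
      = diagPair (d, star d) * J := by
    ext i j
    fin_cases i <;> fin_cases j <;> simp [J, CStarMatrix.mul_apply, diagPair_apply]
  have h2 : ‖J‖ ≤ 1 := by
    have h3 := CStarRing.norm_star_mul_self (x := J)
    rw [hJ] at h3
    rcases subsingleton_or_nontrivial (CStarMatrix (Fin 2) (Fin 2) A) with h | h
    · rw [Subsingleton.elim J 0, norm_zero]; exact zero_le_one
    · rw [CStarRing.norm_one] at h3
      nlinarith [norm_nonneg J]
  rw [h1]
  calc _ ≤ ‖diagPair (d, star d)‖ * ‖J‖ := norm_mul_le _ _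
    _ ≤ ‖(d, star d)‖ * 1 := by
        gcongr
        exact NonUnitalStarAlgHom.norm_apply_le diagPair (d, star d)
    _ = ‖d‖ := by simp [Prod.norm_def]

/-- If `g` is an entire function of exponential type `τ`, bounded by `M` on the real line, and
`a`, `b` are self-adjoint, then `‖g(a) x - x g(b)‖ ≤ e τ M ‖a x - x b‖`. This is the commutator
estimate for the block matrices `diag(a, b)` and `[[0, x], [-x⋆, 0]]`. -/
theorem IsExpTypeSeries.norm_mul_sub_mul_le {c : ℕ → ℂ} {D τ : ℝ}
    (hc : IsExpTypeSeries c D τ) (hτ : 0 < τ) {M : ℝ}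
    (hM : ∀ x : ℝ, ‖∑' n, c n * (x : ℂ) ^ n‖ ≤ M) {a b : A} (ha : IsSelfAdjoint a)
    (hb : IsSelfAdjoint b) (x : A) :
    ‖(∑' n, c n • a ^ n) * x - x * ∑' n, c n • b ^ n‖ ≤ Real.exp 1 * τ * M * ‖a * x - x * b‖ := by
  have hM0 : 0 ≤ M := (norm_nonneg _).trans (hM 0)
  let T : CStarMatrix (Fin 2) (Fin 2) A := CStarMatrix.diagPair (a, b)
  let Y : CStarMatrix (Fin 2) (Fin 2) A := CStarMatrix.ofMatrix !![0, x; -star x, 0]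
  have hT : IsSelfAdjoint T :=
    (show IsSelfAdjoint (a, b) from Prod.ext ha.star_eq hb.star_eq).map CStarMatrix.diagPair
  have hY : star Y = -Y := by
    ext i j
    fin_cases i <;> fin_cases j <;> simp [Y, CStarMatrix.star_apply]
  have hcomm : T * Y - Y * T
      = CStarMatrix.ofMatrix !![0, a * x - x * b; star (a * x - x * b), 0] := by
    ext i j
    fin_cases i <;> fin_cases j <;>
      simp [T, Y, CStarMatrix.mul_apply, CStarMatrix.diagPair_apply, ha.star_eq, hb.star_eq]
    abel
  have hcont : Continuous (CStarMatrix.diagPair : A × A →⋆ₐ[ℂ] _) :=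
    AddMonoidHomClass.continuous_of_bound CStarMatrix.diagPair 1 fun p => by
      rw [one_mul]; exact NonUnitalStarAlgHom.norm_apply_le CStarMatrix.diagPair p
  have hg : ∑' n, c n • T ^ n
      = CStarMatrix.diagPair (∑' n, c n • a ^ n, ∑' n, c n • b ^ n) := by
    have h1 := ((hc.summable hτ.le a).hasSum.prodMk (hc.summable hτ.le b).hasSum).map
      CStarMatrix.diagPair hcont
    refine HasSum.tsum_eq (h1.congr_fun fun n => ?_)
    simp only [Function.comp_apply, T, ← map_pow, ← map_smul]
    rfl
  have h1 := hc.norm_commutator_le hτ hM hT hY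
  rw [hcomm, hg] at h1
  have h2 := h1.trans (mul_le_mul_of_nonneg_left (CStarMatrix.norm_antidiag_le _)
    (by positivity))
  refine le_trans (le_of_eq ?_) ((CStarMatrix.norm_entry_le_norm (i := 0) (j := 1)).trans h2)
  simp [Y, CStarMatrix.mul_apply, CStarMatrix.diagPair_apply]

end BlockMatrices

/-! ### Integrals of simple functions with respect to a spectral measure -/

theorem ContinuousLinearMap.ext_inner_self {H : Type*} [NormedAddCommGroup H]
    [InnerProductSpace ℂ H] {S T : H →L[ℂ] H} (h : ∀ u, ⟪u, S u⟫_ℂ = ⟪u, T u⟫_ℂ) : S = T := by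
  refine ContinuousLinearMap.coe_injective ((ext_inner_map _ _).1 fun u => ?_)
  rw [← inner_conj_symm, ← inner_conj_symm (T.toLinearMap u)]
  exact congrArg _ (h u)

namespace SpectralMeasure

variable {X : Type*} [MeasurableSpace X] {H : Type*} [NormedAddCommGroup H]
  [InnerProductSpace ℂ H] [CompleteSpace H]

theorem proj_mul_of_disjoint (E : SpectralMeasure X H) {S T : Set X} (hS : MeasurableSet S)
    (hT : MeasurableSet T) (h : Disjoint S T) : E.proj S * E.proj T = 0 := by
  ext u
  refine ext_inner_left ℂ fun v => ?_
  rw [mul_apply_eq_comp, zero_apply, inner_zero_right]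
  refine eq_zero_of_sesq (fun v u => ⟪v, E.proj S (E.proj T u)⟫_ℂ) ?_ ?_ ?_ ?_ (fun u => ?_) v u
  · intro u v w; exact inner_add_left _ _ _
  · intro u v w; simp only [map_add, inner_add_right]
  · intro u v; simp only [inner_smul_left, Complex.conj_I]
  · intro u v; simp only [map_smul, inner_smul_right]
  · rw [← E.inner_proj_of_disjoint hS hT h u, ← ContinuousLinearMap.adjoint_inner_left,
      ← ContinuousLinearMap.star_eq_adjoint, (E.isStarProjection S hS).isSelfAdjoint.star_eq]

theorem proj_mul (E : SpectralMeasure X H) {S T : Set X} (hS : MeasurableSet S)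
    (hT : MeasurableSet T) : E.proj S * E.proj T = E.proj (S ∩ T) := by
  have h1 : E.proj S = E.proj (S ∩ T) + E.proj (S \ T) := by
    rw [← E.proj_union (hS.inter hT) (hS.diff hT) Set.disjoint_sdiff_inter.symm,
      Set.inter_union_sdiff]
  have h2 : E.proj T = E.proj (S ∩ T) + E.proj (T \ S) := by
    rw [Set.inter_comm, ← E.proj_union (hT.inter hS) (hT.diff hS) Set.disjoint_sdiff_inter.symm,
      Set.inter_union_sdiff]
  rw [h1, h2, add_mul, mul_add, mul_add, (E.isStarProjection _ (hS.inter hT)).isIdempotentElem.eq,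
    E.proj_mul_of_disjoint (hS.inter hT) (hT.diff hS),
    E.proj_mul_of_disjoint (hS.diff hT) (hS.inter hT),
    E.proj_mul_of_disjoint (hS.diff hT) (hT.diff hS)]
  · simp
  · exact Set.disjoint_left.2 fun x h h' => h.2 h'.1
  · exact Set.disjoint_left.2 fun x h h' => h.2 h'.2
  · exact Set.disjoint_left.2 fun x h h' => h'.2 h.1

theorem norm_proj_apply_le (E : SpectralMeasure X H) {S : Set X} (hS : MeasurableSet S) (u : H) :
    ‖E.proj S u‖ ≤ ‖u‖ := by
  have h := measureReal_mono (μ := E.measure u) (Set.subset_univ S)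
  rw [E.measureReal_apply u hS, E.measureReal_apply u MeasurableSet.univ, E.proj_univ] at h
  exact pow_le_pow_iff_left₀ (norm_nonneg _) (norm_nonneg _) two_ne_zero |>.1 h

theorem measure_univ (E : SpectralMeasure X H) (u : H) :
    E.measure u Set.univ = ENNReal.ofReal (‖u‖ ^ 2) := by
  rw [← ofReal_measureReal, E.measureReal_apply u MeasurableSet.univ, E.proj_univ]
  rfl

/-- The integral of `f ∘ s`, for a simple function `s`, as a sum over the values of `s`. -/
theorem simpleIntegral_map (E : SpectralMeasure X H) {Y : Type*} (s : SimpleFunc X Y) (f : Y → ℂ) :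
    E.simpleIntegral (s.map f) = ∑ y ∈ s.range, f y • E.proj (s ⁻¹' {y}) := by
  refine ContinuousLinearMap.ext_inner_self fun u => ?_
  have h1 : ∀ x, s.map f x = ∑ y ∈ s.range, (s ⁻¹' {y}).indicator (fun _ => f y) x := by
    intro x
    rw [Finset.sum_eq_single (s x)]
    · simp
    · intro y _ hy
      exact Set.indicator_of_notMem (fun h => hy h.symm) _
    · intro h
      exact absurd (s.mem_range_self x) h
  rw [E.inner_simpleIntegral, sum_apply, inner_sum]
  simp only [h1]
  rw [integral_finsetSum _ fun y _ => (integrable_const _).indicator (s.measurableSet_fiber y)]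
  refine Finset.sum_congr rfl fun y _ => ?_
  have hS := s.measurableSet_fiber y
  rw [integral_indicator_const _ hS, smul_apply, inner_smul_right,
    (E.isStarProjection _ hS).isSelfAdjoint.inner_eq_re, (E.isStarProjection _ hS).re_inner_self,
    ← E.measureReal_apply u hS, mul_comm, Complex.real_smul]

theorem simpleIntegral_mul (E : SpectralMeasure X H) (s t : SimpleFunc X ℂ) :
    E.simpleIntegral (s * t) = E.simpleIntegral s * E.simpleIntegral t := by
  let p := s.pair t
  have hs : s = p.map Prod.fst := by ext x; rfl
  have ht : t = p.map Prod.snd := by ext x; rfl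
  have hst : s * t = p.map fun y => y.1 * y.2 := by ext x; rfl
  rw [hst]
  conv_rhs => rw [hs, ht]
  rw [simpleIntegral_map, simpleIntegral_map, simpleIntegral_map, Finset.sum_mul]
  refine Finset.sum_congr rfl fun y hy => ?_
  rw [Finset.mul_sum, Finset.sum_eq_single y]
  · rw [smul_mul_smul_comm, (E.isStarProjection _ (p.measurableSet_fiber y)).isIdempotentElem.eq]
  · intro z _ hz
    rw [smul_mul_smul_comm, E.proj_mul_of_disjoint (p.measurableSet_fiber y)
      (p.measurableSet_fiber z) ((Set.disjoint_singleton.2 hz.symm).preimage p), smul_zero]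
  · exact fun h => absurd hy h

theorem simpleIntegral_const (E : SpectralMeasure X H) (c : ℂ) :
    E.simpleIntegral (SimpleFunc.const X c) = c • 1 := by
  refine ContinuousLinearMap.ext_inner_self fun u => ?_
  rw [E.inner_simpleIntegral, SimpleFunc.coe_const]
  simp only [Function.const_apply, integral_const, smul_apply, inner_smul_right]
  rw [E.measureReal_apply u MeasurableSet.univ, E.proj_univ, Complex.real_smul, mul_comm]
  congr 1
  have := inner_self_eq_norm_sq_to_K (𝕜 := ℂ) u
  rw [one_apply_eq_self, this]
  norm_cast

theorem simpleIntegral_pow (E : SpectralMeasure X H) (s : SimpleFunc X ℂ) (n : ℕ) :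
    E.simpleIntegral (s ^ n) = E.simpleIntegral s ^ n := by
  induction n with
  | zero =>
    rw [pow_zero, pow_zero]
    exact (E.simpleIntegral_const 1).trans (one_smul _ _)
  | succ n ih => rw [pow_succ, pow_succ, simpleIntegral_mul, ih]

theorem simpleIntegral_mul_proj (E : SpectralMeasure X H) (s : SimpleFunc X ℂ) {S : Set X}
    (hS : MeasurableSet S) : E.simpleIntegral s * E.proj S = E.proj S * E.simpleIntegral s := by
  rw [simpleIntegral, Finset.sum_mul, Finset.mul_sum]
  refine Finset.sum_congr rfl fun c _ => ?_
  rw [smul_mul_assoc, mul_smul_comm, E.proj_mul (s.measurableSet_fiber c) hS,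
    E.proj_mul hS (s.measurableSet_fiber c), Set.inter_comm]

theorem isSelfAdjoint_simpleIntegral (E : SpectralMeasure X H) (s : SimpleFunc X ℝ) :
    IsSelfAdjoint (E.simpleIntegral (s.map fun x : ℝ => (x : ℂ))) := by
  rw [simpleIntegral_map]
  refine isSelfAdjoint_sum _ fun c _ => ?_
  exact IsSelfAdjoint.smul (by simp [isSelfAdjoint_iff])
    (E.isStarProjection _ (s.measurableSet_fiber c)).isSelfAdjoint

/-- An entire function of a bounded operator `∫ s dE`, with `s` simple, given by its power series,
agrees with the spectral integral. -/
theorem tsum_smul_simpleIntegral_pow (E : SpectralMeasure X H) {c : ℕ → ℂ} {D τ : ℝ}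
    (hc : IsExpTypeSeries c D τ) (hτ : 0 ≤ τ) (s : SimpleFunc X ℂ) :
    ∑' n, c n • E.simpleIntegral s ^ n = E.simpleIntegral (s.map fun z => ∑' n, c n * z ^ n) := by
  refine ContinuousLinearMap.ext_inner_self fun u => ?_
  obtain ⟨r, hr⟩ : ∃ r, ∀ x, ‖s x‖ ≤ r := s.exists_forall_norm_le
  have hint : ∀ n, Integrable (fun x => c n * s x ^ n) (E.measure u) := fun n =>
    (SimpleFunc.integrable_of_isFiniteMeasure (s ^ n)).const_mul (c n)
  have h1 : HasSum (fun n => ∫ x, c n * s x ^ n ∂(E.measure u))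
      (∫ x, ∑' n, c n * s x ^ n ∂(E.measure u)) := by
    refine hasSum_integral_of_summable_integral_norm hint ?_
    refine Summable.of_nonneg_of_le (fun n => by positivity) (fun n => ?_)
      (IsExpTypeSeries.summable_bound
        ((E.measure u).real Set.univ * (max 1 ‖(1 : ℂ)‖ * D)) (τ * r))
    have h2 := integral_mono (hint n).norm (integrable_const _)
      fun x => hc.norm_smul_pow_le hτ (hr x) n
    refine h2.trans_eq ?_
    rw [integral_const, smul_eq_mul]
    ring
  have h2 := (hc.summable hτ (E.simpleIntegral s)).hasSum.mapL
    ((innerSL ℂ u).comp (ContinuousLinearMap.apply ℂ H u))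
  rw [E.inner_simpleIntegral]
  refine HasSum.unique (f := fun n => ∫ x, c n * s x ^ n ∂(E.measure u))
    (h2.congr_fun fun n => ?_) h1
  have h3 : ⟪u, E.simpleIntegral s ^ n • u⟫_ℂ = ∫ x, (s ^ n) x ∂(E.measure u) := by
    rw [← E.simpleIntegral_pow]; exact E.inner_simpleIntegral (s ^ n) u
  rw [integral_const_mul]
  simp only [ContinuousLinearMap.comp_apply, ContinuousLinearMap.apply_apply, smul_apply,
    innerSL_apply_apply, inner_smul_right]
  exact congrArg (c n * ·) h3.symm

end SpectralMeasure

/-! ### Operator Lipschitz estimates for operators with finite spectrum -/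

/-- The quasicommutator form of the operator Lipschitz condition for self-adjoint operators with
finite spectrum: `‖f(a) x - x f(b)‖ ≤ c ‖a x - x b‖`, where `a = ∫ s dE` and `b = ∫ t dG` with
simple functions `s` and `t`. It only involves the values of `f` at finitely many points, and hence
survives pointwise limits. -/
def IsSimpleOperatorLipschitz.{u} (f : ℝ → ℂ) (c : ℝ) : Prop :=
  ∀ (H : Type u) [NormedAddCommGroup H] [InnerProductSpace ℂ H] [CompleteSpace H]
    (E G : SpectralMeasure ℝ H) (s t : SimpleFunc ℝ ℝ) (x : H →L[ℂ] H),
    ‖E.simpleIntegral (s.map f) * x - x * G.simpleIntegral (t.map f)‖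
      ≤ c * ‖E.simpleIntegral (s.map fun y : ℝ => (y : ℂ)) * x
        - x * G.simpleIntegral (t.map fun y : ℝ => (y : ℂ))‖

theorem IsExpTypeSeries.isSimpleOperatorLipschitz {c : ℕ → ℂ} {D τ : ℝ}
    (hc : IsExpTypeSeries c D τ) (hτ : 0 < τ) {M : ℝ} {f : ℝ → ℂ}
    (hf : ∀ x : ℝ, f x = ∑' n, c n * (x : ℂ) ^ n) (hM : ∀ x : ℝ, ‖f x‖ ≤ M) :
    IsSimpleOperatorLipschitz.{v} f (Real.exp 1 * τ * M) := by
  intro H _ _ _ E G s t x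
  have h := hc.norm_mul_sub_mul_le hτ (M := M) (fun x => by rw [← hf]; exact hM x)
    (E.isSelfAdjoint_simpleIntegral s) (G.isSelfAdjoint_simpleIntegral t) x
  rw [E.tsum_smul_simpleIntegral_pow hc hτ.le, G.tsum_smul_simpleIntegral_pow hc hτ.le,
    SimpleFunc.map_map, SimpleFunc.map_map] at h
  have hf' : f = (fun z : ℂ => ∑' n, c n * z ^ n) ∘ fun y : ℝ => (y : ℂ) := funext hf
  rw [hf']
  exact h

/-- Summation of functions satisfying the Lipschitz condition; the additive constants needed to
make the series converge pointwise do not affect the commutators. -/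
theorem IsSimpleOperatorLipschitz.of_hasSum {ι : Type*} {f : ι → ℝ → ℂ} {c : ι → ℝ}
    (hf : ∀ i, IsSimpleOperatorLipschitz.{v} (f i) (c i)) (hc : Summable c) {g : ℝ → ℂ} (a : ℂ)
    (hg : ∀ x, HasSum (fun i => f i x - f i 0) (g x - a)) :
    IsSimpleOperatorLipschitz.{v} g (∑' i, c i) := by
  intro H _ _ _ E G s t x
  have hsub : ∀ (E : SpectralMeasure ℝ H) (s : SimpleFunc ℝ ℝ) (φ : ℝ → ℂ) (b : ℂ),
      ∑ y ∈ s.range, (φ y - b) • E.proj (s ⁻¹' {y}) = E.simpleIntegral (s.map φ) - b • 1 := by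
    intro E s φ b
    have h1 : s.map (fun y => φ y - b) = s.map φ - SimpleFunc.const ℝ b := by ext; simp
    rw [← E.simpleIntegral_map s fun y => φ y - b, h1, E.simpleIntegral_sub,
      E.simpleIntegral_const]
  have hE : ∀ (E : SpectralMeasure ℝ H) (s : SimpleFunc ℝ ℝ), HasSum
      (fun i => E.simpleIntegral (s.map (f i)) - f i 0 • 1)
      (E.simpleIntegral (s.map g) - a • 1) := by
    intro E s
    have h := hasSum_sum (s := s.range) fun y _ => (hg y).smul_const (E.proj (s ⁻¹' {y}))
    simpa only [hsub] using h
  have h1 := ((hE E s).mul_right x).sub ((hE G t).mul_left x)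
  have h2 : ∀ (p q : H →L[ℂ] H) (b : ℂ), (p - b • 1) * x - x * (q - b • 1) = p * x - x * q := by
    intro p q b
    rw [sub_mul, mul_sub, smul_mul_assoc, mul_smul_comm, one_mul, mul_one]
    abel
  simp only [h2] at h1
  rw [← h1.tsum_eq]
  exact tsum_of_norm_bounded (hc.hasSum.mul_right _) fun i => hf i H E G s t x

/-! ### Integrals of unbounded functions with respect to a spectral measure -/

namespace SpectralMeasure

variable {X : Type*} [MeasurableSpace X] {H : Type*} [NormedAddCommGroup H]
  [InnerProductSpace ℂ H] [CompleteSpace H]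

theorem measure_proj_apply (E : SpectralMeasure X H) {S : Set X} (hS : MeasurableSet S) (u : H) :
    E.measure (E.proj S u) = (E.measure u).restrict S := by
  refine Measure.ext fun R hR => ?_
  have h1 : E.proj R (E.proj S u) = E.proj (R ∩ S) u := by
    rw [← E.proj_mul hR hS]; rfl
  rw [Measure.restrict_apply hR, ← ofReal_measureReal, ← ofReal_measureReal (s := R ∩ S),
    E.measureReal_apply _ hR, E.measureReal_apply _ (hR.inter hS), h1]

theorem tendsto_proj_apply (E : SpectralMeasure X H) {S : ℕ → Set X} (hS : ∀ k, MeasurableSet (S k))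
    (hmono : Monotone S) (hU : ⋃ k, S k = Set.univ) (u : H) :
    Tendsto (fun k => E.proj (S k) u) atTop (𝓝 u) := by
  have h1 : ∀ k, ‖E.proj (S k) u - u‖ ^ 2 = (E.measure u).real (S k)ᶜ := by
    intro k
    have h2 : E.proj (S k) u - u = -(E.proj (S k)ᶜ u) := by
      have h3 := E.proj_union (hS k) (hS k).compl disjoint_compl_right
      rw [Set.union_compl_self, E.proj_univ] at h3
      have h4 := congrArg (fun T : H →L[ℂ] H => T u) h3
      simp only [one_apply_eq_self, add_apply] at h4
      rw [eq_neg_iff_add_eq_zero, sub_add_eq_add_sub, ← h4, sub_self]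
    rw [h2, norm_neg, E.measureReal_apply u (hS k).compl]
  have h2 : Tendsto (fun k => E.measure u (S k)ᶜ) atTop (𝓝 0) := by
    have h3 := tendsto_measure_iInter_atTop (μ := E.measure u) (s := fun k => (S k)ᶜ)
      (fun k => (hS k).compl.nullMeasurableSet)
      (fun i j hij => Set.compl_subset_compl.2 (hmono hij)) ⟨0, measure_ne_top _ _⟩
    rwa [← Set.compl_iUnion, hU, Set.compl_univ, measure_empty] at h3
  have h3 : Tendsto (fun k => ‖E.proj (S k) u - u‖ ^ 2) atTop (𝓝 0) := by
    simp only [h1]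
    simpa [measureReal_def, Function.comp_def] using
      (ENNReal.tendsto_toReal ENNReal.zero_ne_top).comp h2
  rw [tendsto_iff_norm_sub_tendsto_zero]
  simpa using h3.sqrt

theorem dist_simpleIntegral_apply (E : SpectralMeasure X H) (s t : SimpleFunc X ℂ) (u : H) :
    ‖E.simpleIntegral s u - E.simpleIntegral t u‖
      = (eLpNorm (⇑s - ⇑t) 2 (E.measure u)).toReal := by
  have h3 : MemLp (s - t : SimpleFunc X ℂ) 2 (E.measure u) :=
    SimpleFunc.memLp_of_isFiniteMeasure _ _ _
  have h7 := h3.eLpNorm_eq_integral_rpow_norm (by simp) (by simp)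
  rw [SimpleFunc.coe_sub] at h7
  rw [← sub_apply, ← E.simpleIntegral_sub, h7, ENNReal.toReal_ofReal (by positivity),
    ← sq_eq_sq₀ (norm_nonneg _) (by positivity), E.norm_simpleIntegral_sq, ← Real.rpow_natCast,
    ← Real.rpow_mul (by positivity)]
  simp

variable {E : SpectralMeasure X H} {f : X → ℂ} {T : H →ₗ.[ℂ] H}

theorem measure_proj_le (E : SpectralMeasure X H) {S : Set X} (hS : MeasurableSet S) (u : H) :
    E.measure (E.proj S u) ≤ E.measure u := by
  rw [E.measure_proj_apply hS]
  exact Measure.restrict_le_self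

namespace IsIntegral

theorem proj_mem_domain (hT : E.IsIntegral f T) {S : Set X} (hS : MeasurableSet S) {u : H}
    (hu : u ∈ T.domain) : E.proj S u ∈ T.domain := by
  rw [hT.mem_domain_iff] at hu ⊢
  exact hu.mono_measure (E.measure_proj_le hS u)

theorem proj_mem_domain_of_bounded (hT : E.IsIntegral f T) (hf : Measurable f) {S : Set X}
    (hS : MeasurableSet S) {r : ℝ} (hr : ∀ x ∈ S, ‖f x‖ ≤ r) (u : H) :
    E.proj S u ∈ T.domain := by
  rw [hT.mem_domain_iff, E.measure_proj_apply hS]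
  exact MemLp.of_bound hf.aestronglyMeasurable r
    ((ae_restrict_iff' hS).2 (Eventually.of_forall hr))

theorem dense_domain (hT : E.IsIntegral f T) (hf : Measurable f) : Dense (T.domain : Set H) := by
  intro u
  have hS : ∀ k : ℕ, MeasurableSet {x | ‖f x‖ ≤ k} := fun k =>
    measurableSet_le hf.norm measurable_const
  refine mem_closure_of_tendsto (E.tendsto_proj_apply hS ?_ ?_ u)
    (Eventually.of_forall fun k => hT.proj_mem_domain_of_bounded hf (hS k) (fun x hx => hx) u)
  · intro i j hij x hx
    exact le_trans (show ‖f x‖ ≤ i from hx) (by exact_mod_cast hij)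
  · exact Set.eq_univ_of_forall fun x => Set.mem_iUnion.2 (exists_nat_ge ‖f x‖)

/-- The quadratic form in the definition of the integral determines the operator: it is the strong
limit of the integrals of approximating simple functions. -/
theorem tendsto_simpleIntegral (hT : E.IsIntegral f T) (hf : Measurable f) (u : T.domain) :
    Tendsto (fun n => E.simpleIntegral
      (SimpleFunc.approxOn f hf Set.univ 0 (Set.mem_univ _) n) (u : H)) atTop (𝓝 (T u)) := by
  set s : ℕ → SimpleFunc X ℂ :=
    fun n => SimpleFunc.approxOn f hf Set.univ 0 (Set.mem_univ _) n with hs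
  have hsm : ∀ n u, MemLp (s n) 2 (E.measure u) := fun n u =>
    SimpleFunc.memLp_of_isFiniteMeasure _ _ _
  have hcauchy : ∀ u : T.domain, CauchySeq fun n => E.simpleIntegral (s n) (u : H) := by
    intro u
    have hu : MemLp f 2 (E.measure (u : H)) := (hT.mem_domain_iff u).1 u.2
    have h1 : Tendsto (fun n => (hsm n u).toLp (s n)) atTop (𝓝 (hu.toLp f)) := by
      rw [Lp.tendsto_Lp_iff_tendsto_eLpNorm'']
      exact SimpleFunc.tendsto_approxOn_Lp_eLpNorm hf (Set.mem_univ _) (by simp)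
        (by simp) (by simpa using hu.2)
    have h2 : ∀ n m, dist (E.simpleIntegral (s n) (u : H)) (E.simpleIntegral (s m) (u : H))
        = dist ((hsm n u).toLp (s n)) ((hsm m u).toLp (s m)) := by
      intro n m
      rw [dist_eq_norm, dist_eq_norm, E.dist_simpleIntegral_apply, ← MemLp.toLp_sub, Lp.norm_toLp]
    have h4 := h1.cauchySeq
    rw [Metric.cauchySeq_iff] at h4 ⊢
    simpa only [h2] using h4
  choose R hR using fun u => cauchySeq_tendsto_of_complete (hcauchy u)
  have hadd : ∀ u v, R (u + v) = R u + R v := fun u v =>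
    tendsto_nhds_unique (hR (u + v)) (by simpa using (hR u).add (hR v))
  have hsmul : ∀ (c : ℂ) u, R (c • u) = c • R u := fun c u =>
    tendsto_nhds_unique (hR (c • u)) (by simpa using (hR u).const_smul c)
  have hdiag : ∀ u : T.domain, ⟪(u : H), R u⟫_ℂ = ⟪(u : H), T u⟫_ℂ := by
    intro u
    have hu : MemLp f 2 (E.measure (u : H)) := (hT.mem_domain_iff u).1 u.2
    rw [hT.inner_apply]
    refine tendsto_nhds_unique (tendsto_const_nhds.inner (hR u)) ?_
    have h6 := tendsto_integral_approxOn_of_measurable (μ := E.measure (u : H))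
      (hu.integrable (by norm_num)) hf (s := Set.univ) (by simp) (Set.mem_univ (0 : ℂ)) (by simp)
    refine h6.congr fun n => ?_
    rw [E.inner_simpleIntegral, ← SimpleFunc.integral_eq_integral _
      (SimpleFunc.integrable_of_isFiniteMeasure _)]
  have hpol : ∀ v u : T.domain, ⟪(v : H), R u - T u⟫_ℂ = 0 := by
    refine eq_zero_of_sesq (fun v u : T.domain => ⟪(v : H), R u - T u⟫_ℂ) ?_ ?_ ?_ ?_ ?_
    · intro u v w
      simp only [inner_add_left, Submodule.coe_add]
    · intro u v w
      simp only [hadd, LinearPMap.map_add, inner_add_right, inner_sub_right]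
      ring
    · intro u v
      simp only [inner_smul_left, Submodule.coe_smul, Complex.conj_I]
    · intro u v
      simp only [hsmul, LinearPMap.map_smul, inner_smul_right, inner_sub_right]
      ring
    · intro u
      rw [inner_sub_right, hdiag, sub_self]
  have h : R u - T u = 0 :=
    (hT.dense_domain hf).eq_zero_of_inner_right (𝕜 := ℂ) fun v hv => hpol ⟨v, hv⟩ u
  rw [← sub_eq_zero.1 h]
  exact hR u

theorem norm_apply_sub_simpleIntegral (hT : E.IsIntegral f T) (hf : Measurable f) (u : T.domain)
    (t : SimpleFunc X ℂ) : ‖T u - E.simpleIntegral t (u : H)‖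
      = (eLpNorm (f - ⇑t) 2 (E.measure (u : H))).toReal := by
  have hu : MemLp f 2 (E.measure (u : H)) := (hT.mem_domain_iff u).1 u.2
  have hm : ∀ s : SimpleFunc X ℂ, MemLp s 2 (E.measure (u : H)) := fun s =>
    SimpleFunc.memLp_of_isFiniteMeasure _ _ _
  let s : ℕ → SimpleFunc X ℂ :=
    fun n => SimpleFunc.approxOn f hf Set.univ 0 (Set.mem_univ _) n
  have h1 : Tendsto (fun n => (hm (s n)).toLp (s n)) atTop (𝓝 (hu.toLp f)) := by
    rw [Lp.tendsto_Lp_iff_tendsto_eLpNorm'']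
    exact SimpleFunc.tendsto_approxOn_Lp_eLpNorm hf (Set.mem_univ _) (by simp)
      (by simp) (by simpa using hu.2)
  have h2 := ((hT.tendsto_simpleIntegral hf u).sub_const (E.simpleIntegral t (u : H))).norm
  have h3 := (h1.sub_const ((hm t).toLp t)).norm
  rw [← MemLp.toLp_sub, Lp.norm_toLp] at h3
  refine tendsto_nhds_unique h2 (h3.congr fun n => ?_)
  rw [← MemLp.toLp_sub, Lp.norm_toLp, ← E.dist_simpleIntegral_apply]

theorem norm_apply (hT : E.IsIntegral f T) (hf : Measurable f) (u : T.domain) :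
    ‖T u‖ = (eLpNorm f 2 (E.measure (u : H))).toReal := by
  have h := hT.norm_apply_sub_simpleIntegral hf u (SimpleFunc.const X 0)
  rw [E.simpleIntegral_const] at h
  have h0 : f - ⇑(SimpleFunc.const X (0 : ℂ)) = f := by ext; simp
  rw [h0] at h
  simpa using h

theorem apply_proj (hT : E.IsIntegral f T) (hf : Measurable f) {S : Set X} (hS : MeasurableSet S)
    (u : T.domain) (h : E.proj S u ∈ T.domain) : T ⟨E.proj S u, h⟩ = E.proj S (T u) := by
  refine tendsto_nhds_unique (hT.tendsto_simpleIntegral hf ⟨E.proj S u, h⟩) ?_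
  refine (((E.proj S).continuous.tendsto _).comp (hT.tendsto_simpleIntegral hf u)).congr fun n => ?_
  exact congrArg (fun T : H →L[ℂ] H => T u) (E.simpleIntegral_mul_proj _ hS).symm

theorem eLpNorm_measure_proj_le {g : X → ℂ} {S : Set X} (hS : MeasurableSet S) {r : ℝ}
    (hr0 : 0 ≤ r) (hr : ∀ x ∈ S, ‖g x‖ ≤ r) (u : H) :
    (eLpNorm g 2 (E.measure (E.proj S u))).toReal ≤ r * ‖u‖ := by
  have h1 : eLpNorm g 2 (E.measure (E.proj S u))
      ≤ E.measure (E.proj S u) Set.univ ^ (2 : ℝ≥0∞).toReal⁻¹ * ENNReal.ofReal r := by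
    refine eLpNorm_le_of_ae_bound ?_
    rw [E.measure_proj_apply hS]
    exact (ae_restrict_iff' hS).2 (Eventually.of_forall hr)
  have h2 : E.measure (E.proj S u) Set.univ ^ (2 : ℝ≥0∞).toReal⁻¹
      = ENNReal.ofReal ‖E.proj S u‖ := by
    rw [E.measure_univ, ENNReal.ofReal_rpow_of_nonneg (by positivity) (by positivity),
      ENNReal.toReal_ofNat, ← Real.rpow_natCast, ← Real.rpow_mul (norm_nonneg _)]
    simp
  rw [h2, ← ENNReal.ofReal_mul (norm_nonneg _)] at h1
  refine (ENNReal.toReal_le_of_le_ofReal (by positivity) h1).trans ?_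
  rw [mul_comm]
  exact mul_le_mul_of_nonneg_left (E.norm_proj_apply_le hS u) hr0

theorem norm_apply_proj_sub_simpleIntegral_le (hT : E.IsIntegral f T) (hf : Measurable f)
    {S : Set X} (hS : MeasurableSet S) {t : SimpleFunc X ℂ} {r : ℝ} (hr0 : 0 ≤ r)
    (hr : ∀ x ∈ S, ‖f x - t x‖ ≤ r) (u : H) (h : E.proj S u ∈ T.domain) :
    ‖T ⟨E.proj S u, h⟩ - E.simpleIntegral t (E.proj S u)‖ ≤ r * ‖u‖ := by
  rw [hT.norm_apply_sub_simpleIntegral hf ⟨E.proj S u, h⟩]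
  exact eLpNorm_measure_proj_le hS hr0 hr u

theorem norm_apply_proj_le (hT : E.IsIntegral f T) (hf : Measurable f)
    {S : Set X} (hS : MeasurableSet S) {r : ℝ} (hr0 : 0 ≤ r)
    (hr : ∀ x ∈ S, ‖f x‖ ≤ r) (u : H) (h : E.proj S u ∈ T.domain) :
    ‖T ⟨E.proj S u, h⟩‖ ≤ r * ‖u‖ := by
  rw [hT.norm_apply hf ⟨E.proj S u, h⟩]
  exact eLpNorm_measure_proj_le hS hr0 hr u

/-- A vector lies in the domain of `∫ f dE` as soon as its spectral truncations are mapped to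
vectors of bounded norm. -/
theorem mem_domain_of_bounded (hT : E.IsIntegral f T) (hf : Measurable f) {S : ℕ → Set X}
    (hS : ∀ k, MeasurableSet (S k)) (hmono : Monotone S) (hU : ⋃ k, S k = Set.univ) {u : H} {r : ℝ}
    (hm : ∀ k, E.proj (S k) u ∈ T.domain) (hr : ∀ k, ‖T ⟨E.proj (S k) u, hm k⟩‖ ≤ r) :
    u ∈ T.domain := by
  rw [hT.mem_domain_iff]
  refine ⟨hf.aestronglyMeasurable, ?_⟩
  have h1 : ∀ k, eLpNorm ((S k).indicator f) 2 (E.measure u) ≤ ENNReal.ofReal r := by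
    intro k
    rw [eLpNorm_indicator_eq_eLpNorm_restrict (hS k), ← E.measure_proj_apply (hS k)]
    have h2 := (hT.mem_domain_iff _).1 (hm k)
    rw [← ENNReal.ofReal_toReal h2.2.ne]
    refine ENNReal.ofReal_le_ofReal ?_
    rw [← hT.norm_apply hf ⟨_, hm k⟩]
    exact hr k
  have h2 := Lp.eLpNorm_lim_le_liminf_eLpNorm (p := 2) (μ := E.measure u)
    (f := fun k => (S k).indicator f) (fun k => (hf.indicator (hS k)).aestronglyMeasurable) f
    (Eventually.of_forall fun x => by
      obtain ⟨k, hk⟩ := Set.mem_iUnion.1 (hU.symm ▸ Set.mem_univ x : x ∈ ⋃ k, S k)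
      refine tendsto_const_nhds.congr' ?_
      filter_upwards [eventually_ge_atTop k] with n hn
      rw [Set.indicator_of_mem (hmono hn hk)])
  refine h2.trans_lt ?_
  refine (liminf_le_of_frequently_le' (Frequently.of_forall h1)).trans_lt ENNReal.ofReal_lt_top

end IsIntegral

end SpectralMeasure

/-! ### Passage to unbounded self-adjoint operators -/

/-- On a bounded interval the identity can be approximated uniformly by simple functions `s` in
such a way that `f ∘ s` approximates `f` uniformly as well. -/
theorem exists_simpleFunc_approx {f : ℝ → ℂ} (hf : Continuous f) {r ε : ℝ}
    (hε : 0 < ε) :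
    ∃ s : SimpleFunc ℝ ℝ, ∀ x ∈ Set.Icc (-r) r, |x - s x| ≤ ε ∧ ‖f x - f (s x)‖ ≤ ε := by
  have huc : UniformContinuousOn f (Set.Icc (-(r + 1)) (r + 1)) :=
    isCompact_Icc.uniformContinuousOn_of_continuous hf.continuousOn
  obtain ⟨η, hη, h⟩ := Metric.uniformContinuousOn_iff.1 huc ε hε
  obtain ⟨δ, hδ, hδ1, hδε, hδη⟩ : ∃ δ : ℝ, 0 < δ ∧ δ ≤ 1 ∧ δ ≤ ε ∧ δ < η :=
    ⟨min (min 1 ε) (η / 2), by positivity, by simp, by simp,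
      (min_le_right _ _).trans_lt (by linarith)⟩
  refine ⟨SimpleFunc.nearestPt (fun k : ℕ => -r + k * δ) ⌊2 * r / δ⌋₊, fun x hx => ?_⟩
  set s := SimpleFunc.nearestPt (fun k : ℕ => -r + k * δ) ⌊2 * r / δ⌋₊
  have h1 : |x - s x| ≤ δ := by
    have hk : ⌊(x + r) / δ⌋₊ ≤ ⌊2 * r / δ⌋₊ := by
      refine Nat.floor_le_floor ?_
      gcongr
      linarith [hx.2]
    have h2 := SimpleFunc.edist_nearestPt_le (fun k : ℕ => -r + k * δ) x hk
    rw [edist_dist, edist_dist, ENNReal.ofReal_le_ofReal_iff dist_nonneg] at h2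
    rw [← Real.dist_eq, dist_comm]
    refine h2.trans ?_
    have h3 : (⌊(x + r) / δ⌋₊ : ℝ) * δ ≤ x + r :=
      (le_div_iff₀ hδ).1 (Nat.floor_le (div_nonneg (by linarith [hx.1]) hδ.le))
    have h4 : x + r < (⌊(x + r) / δ⌋₊ + 1 : ℝ) * δ := (div_lt_iff₀ hδ).1 (Nat.lt_floor_add_one _)
    rw [Real.dist_eq, abs_le]
    constructor <;> nlinarith
  refine ⟨h1.trans hδε, ?_⟩
  rw [← dist_eq_norm]
  have h2 := abs_le.1 h1
  refine (h x ⟨by linarith [hx.1], by linarith [hx.2]⟩ (s x)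
    ⟨by linarith [hx.1], by linarith [hx.2]⟩ ?_).le
  rw [Real.dist_eq]
  exact h1.trans_lt hδη

section

variable {H : Type v} [NormedAddCommGroup H] [InnerProductSpace ℂ H] [CompleteSpace H]
  {E G : SpectralMeasure ℝ H} {A B Tf Rf : H →ₗ.[ℂ] H} {K : H →L[ℂ] H} {f : ℝ → ℂ} {c : ℝ}

/-- The operator Lipschitz estimate between spectral subspaces on which both operators are bounded.
It comes from the finite-spectrum estimate for `X = E [-a, a] * G [-b, b]`, for which `A X - X B`
is a compression of `A - B`. -/
theorem IsSimpleOperatorLipschitz.norm_apply_proj_sub_le (hf : IsSimpleOperatorLipschitz.{v} f c)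
    (hc : 0 ≤ c) (hfc : Continuous f) (hA : E.IsIntegral (fun x => (x : ℂ)) A)
    (hB : G.IsIntegral (fun x => (x : ℂ)) B) (hTf : E.IsIntegral f Tf) (hRf : G.IsIntegral f Rf)
    (hK : IsBoundedDifference A B K) {a b : ℝ} (u : H)
    (h1 : G.proj (Set.Icc (-b) b) u ∈ Rf.domain)
    (h2 : E.proj (Set.Icc (-a) a) (G.proj (Set.Icc (-b) b) u) ∈ Tf.domain) :
    ‖Tf ⟨_, h2⟩ - E.proj (Set.Icc (-a) a) (Rf ⟨_, h1⟩)‖ ≤ c * ‖K‖ * ‖u‖ := by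
  obtain ⟨hdom, hK⟩ := hK
  have hid : Measurable fun x : ℝ => (x : ℂ) := by fun_prop
  have hS : MeasurableSet (Set.Icc (-a) a) := measurableSet_Icc
  have hR : MeasurableSet (Set.Icc (-b) b) := measurableSet_Icc
  set Q := E.proj (Set.Icc (-a) a) with hQ
  set P := G.proj (Set.Icc (-b) b) with hP
  have key : ∀ ε : ℝ, 0 < ε → ‖Tf ⟨_, h2⟩ - Q (Rf ⟨_, h1⟩)‖
      ≤ (c * (‖K‖ + 2 * ε) + 2 * ε) * ‖u‖ := by
    intro ε hε
    obtain ⟨s, hs⟩ := exists_simpleFunc_approx hfc (r := a) hε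
    obtain ⟨t, ht⟩ := exists_simpleFunc_approx hfc (r := b) hε
    have hop := hf H E G s t (Q * P)
    set s₁ := E.simpleIntegral (s.map fun y : ℝ => (y : ℂ)) with hs₁
    set t₁ := G.simpleIntegral (t.map fun y : ℝ => (y : ℂ)) with ht₁
    have hcommt : ∀ (φ : SimpleFunc ℝ ℂ) v,
        (Q * P * G.simpleIntegral φ) v = Q (G.simpleIntegral φ (P v)) := by
      intro φ v
      rw [mul_assoc, ← G.simpleIntegral_mul_proj φ hR]
      rfl
    have hN : ‖s₁ * (Q * P) - Q * P * t₁‖ ≤ ‖K‖ + 2 * ε := by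
      refine ContinuousLinearMap.opNorm_le_bound _ (by positivity) fun v => ?_
      have hBd : P v ∈ B.domain := hB.proj_mem_domain_of_bounded hid hR (r := b)
        (fun x hx => by rw [Complex.norm_real]; exact abs_le.2 hx) v
      have hAd : Q (P v) ∈ A.domain := hA.proj_mem_domain hS (hdom hBd)
      have e1 : ‖A ⟨Q (P v), hAd⟩ - s₁ (Q (P v))‖ ≤ ε * ‖P v‖ :=
        hA.norm_apply_proj_sub_simpleIntegral_le hid hS hε.le (fun x hx => by
          rw [SimpleFunc.map_apply, ← Complex.ofReal_sub, Complex.norm_real]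
          exact (hs x hx).1) (P v) hAd
      have e2 : ‖B ⟨P v, hBd⟩ - t₁ (P v)‖ ≤ ε * ‖v‖ :=
        hB.norm_apply_proj_sub_simpleIntegral_le hid hR hε.le (fun x hx => by
          rw [SimpleFunc.map_apply, ← Complex.ofReal_sub, Complex.norm_real]
          exact (ht x hx).1) v hBd
      have e3 : A ⟨Q (P v), hAd⟩ = Q (A ⟨P v, hdom hBd⟩) :=
        hA.apply_proj hid hS ⟨P v, hdom hBd⟩ hAd
      have e4 : K (P v) = A ⟨P v, hdom hBd⟩ - B ⟨P v, hBd⟩ := hK ⟨P v, hBd⟩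
      have e5 : (s₁ * (Q * P) - Q * P * t₁) v = -(A ⟨Q (P v), hAd⟩ - s₁ (Q (P v)))
          + Q (K (P v)) + Q (B ⟨P v, hBd⟩ - t₁ (P v)) := by
        rw [sub_apply, hcommt, e4, e3, map_sub, map_sub]
        simp only [mul_apply_eq_comp]
        abel
      have e6 := G.norm_proj_apply_le hR v
      rw [← hP] at e6
      rw [e5]
      refine (norm_add₃_le).trans ?_
      have e7 : ‖Q (K (P v))‖ ≤ ‖K‖ * ‖v‖ := (E.norm_proj_apply_le hS _).trans
        ((K.le_opNorm _).trans (by gcongr))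
      have e8 := (E.norm_proj_apply_le hS (B ⟨P v, hBd⟩ - t₁ (P v))).trans e2
      rw [norm_neg]
      have e9 : ε * ‖P v‖ ≤ ε * ‖v‖ := by gcongr
      linarith
    have hu := G.norm_proj_apply_le hR u
    rw [← hP] at hu
    have e1 : ‖Tf ⟨_, h2⟩ - E.simpleIntegral (s.map f) (Q (P u))‖ ≤ ε * ‖P u‖ :=
      hTf.norm_apply_proj_sub_simpleIntegral_le hfc.measurable hS hε.le
        (fun x hx => (hs x hx).2) (P u) h2
    have e2 : ‖Rf ⟨_, h1⟩ - G.simpleIntegral (t.map f) (P u)‖ ≤ ε * ‖u‖ :=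
      hRf.norm_apply_proj_sub_simpleIntegral_le hfc.measurable hR hε.le
        (fun x hx => (ht x hx).2) u h1
    have e3 : Tf ⟨_, h2⟩ - Q (Rf ⟨_, h1⟩) = (Tf ⟨_, h2⟩ - E.simpleIntegral (s.map f) (Q (P u)))
        + (E.simpleIntegral (s.map f) * (Q * P) - Q * P * G.simpleIntegral (t.map f)) u
        + -(Q (Rf ⟨_, h1⟩ - G.simpleIntegral (t.map f) (P u))) := by
      rw [sub_apply, hcommt, map_sub]
      simp only [mul_apply_eq_comp]
      abel
    rw [e3]
    refine (norm_add₃_le).trans ?_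
    rw [norm_neg]
    have e4 := (E.norm_proj_apply_le hS (Rf ⟨_, h1⟩ - G.simpleIntegral (t.map f) (P u))).trans e2
    have e5 := ContinuousLinearMap.le_of_opNorm_le _
      (hop.trans (mul_le_mul_of_nonneg_left hN hc)) u
    have e6 : ε * ‖P u‖ ≤ ε * ‖u‖ := by gcongr
    linarith
  have h3 : Tendsto (fun ε => (c * (‖K‖ + 2 * ε) + 2 * ε) * ‖u‖) (𝓝[>] 0)
      (𝓝 ((c * (‖K‖ + 2 * 0) + 2 * 0) * ‖u‖)) :=
    (Continuous.tendsto (by fun_prop) _).mono_left nhdsWithin_le_nhds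
  simpa using ge_of_tendsto h3 (eventually_mem_nhdsWithin.mono key)

theorem monotone_Icc_neg_natCast : Monotone fun k : ℕ => Set.Icc (-(k : ℝ)) k := fun i j hij => by
  have : (i : ℝ) ≤ j := by exact_mod_cast hij
  exact Set.Icc_subset_Icc (neg_le_neg this) this

theorem iUnion_Icc_neg_natCast : ⋃ k : ℕ, Set.Icc (-(k : ℝ)) k = Set.univ :=
  Set.eq_univ_of_forall fun x => Set.mem_iUnion.2
    ((exists_nat_ge |x|).imp fun _ h => abs_le.1 h)

/-- The finite-spectrum estimate implies the operator Lipschitz estimate for all self-adjoint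
operators; it also yields the inclusion of the domains. -/
theorem IsSimpleOperatorLipschitz.exists_mem_domain (hf : IsSimpleOperatorLipschitz.{v} f c)
    (hc : 0 ≤ c) (hfc : Continuous f) (hA : E.IsIntegral (fun x => (x : ℂ)) A)
    (hB : G.IsIntegral (fun x => (x : ℂ)) B) (hTf : E.IsIntegral f Tf) (hRf : G.IsIntegral f Rf)
    (hK : IsBoundedDifference A B K) (u : Rf.domain) :
    ∃ h : (u : H) ∈ Tf.domain, ‖Tf ⟨u, h⟩ - Rf u‖ ≤ c * ‖K‖ * ‖(u : H)‖ := by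
  have hS : ∀ k : ℕ, MeasurableSet (Set.Icc (-(k : ℝ)) k) := fun k => measurableSet_Icc
  have hbd : ∀ k : ℕ, ∃ r : ℝ, 0 ≤ r ∧ ∀ x ∈ Set.Icc (-(k : ℝ)) k, ‖f x‖ ≤ r := fun k => by
    obtain ⟨r, hr⟩ := isCompact_Icc.exists_bound_of_continuousOn
      (hfc.continuousOn (s := Set.Icc (-(k : ℝ)) k))
    exact ⟨max r 0, le_max_right _ _, fun x hx => (hr x hx).trans (le_max_left _ _)⟩
  choose r hr0 hr using hbd
  have hm : ∀ (k : ℕ) v, E.proj (Set.Icc (-(k : ℝ)) k) v ∈ Tf.domain := fun k v =>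
    hTf.proj_mem_domain_of_bounded hfc.measurable (hS k) (hr k) v
  have hQ : ∀ v, Tendsto (fun k : ℕ => E.proj (Set.Icc (-(k : ℝ)) k) v) atTop (𝓝 v) :=
    E.tendsto_proj_apply hS monotone_Icc_neg_natCast iUnion_Icc_neg_natCast
  have hP : ∀ v, Tendsto (fun k : ℕ => G.proj (Set.Icc (-(k : ℝ)) k) v) atTop (𝓝 v) :=
    G.tendsto_proj_apply hS monotone_Icc_neg_natCast iUnion_Icc_neg_natCast
  -- The truncation of `A` is fixed and that of `B` is removed first.
  have h1 : ∀ j : ℕ, ‖Tf ⟨E.proj (Set.Icc (-(j : ℝ)) j) u, hm j u⟩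
      - E.proj (Set.Icc (-(j : ℝ)) j) (Rf u)‖ ≤ c * ‖K‖ * ‖(u : H)‖ := by
    intro j
    have hPd : ∀ k : ℕ, G.proj (Set.Icc (-(k : ℝ)) k) u ∈ Rf.domain := fun k =>
      hRf.proj_mem_domain (hS k) u.2
    have h2 : Tendsto (fun k : ℕ =>
        Tf ⟨E.proj (Set.Icc (-(j : ℝ)) j) (G.proj (Set.Icc (-(k : ℝ)) k) u), hm j _⟩) atTop
        (𝓝 (Tf ⟨E.proj (Set.Icc (-(j : ℝ)) j) u, hm j u⟩)) := by
      rw [tendsto_iff_norm_sub_tendsto_zero]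
      have h3 := ((tendsto_iff_norm_sub_tendsto_zero.1 (hP u)).const_mul (r j))
      rw [mul_zero] at h3
      refine squeeze_zero (fun _ => norm_nonneg _) (fun k => ?_) h3
      have h4 := hTf.norm_apply_proj_le hfc.measurable (hS j) (hr0 j) (hr j)
        (G.proj (Set.Icc (-(k : ℝ)) k) u - u) (hm j _)
      refine le_of_eq_of_le ?_ h4
      rw [← LinearPMap.map_sub]
      congr 2
      exact Subtype.ext (map_sub _ _ _).symm
    have h3 : Tendsto (fun k : ℕ =>
        E.proj (Set.Icc (-(j : ℝ)) j) (Rf ⟨G.proj (Set.Icc (-(k : ℝ)) k) u, hPd k⟩)) atTop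
        (𝓝 (E.proj (Set.Icc (-(j : ℝ)) j) (Rf u))) := by
      refine ((E.proj _).continuous.tendsto _).comp ((hP (Rf u)).congr fun k => ?_)
      exact (hRf.apply_proj hfc.measurable (hS k) u (hPd k)).symm
    exact le_of_tendsto (h2.sub h3).norm (Eventually.of_forall fun k =>
      hf.norm_apply_proj_sub_le hc hfc hA hB hTf hRf hK u (hPd k) (hm j _))
  have hu : (u : H) ∈ Tf.domain := by
    refine hTf.mem_domain_of_bounded hfc.measurable hS monotone_Icc_neg_natCast
      iUnion_Icc_neg_natCast (fun k => hm k u) (r := c * ‖K‖ * ‖(u : H)‖ + ‖Rf u‖) fun k => ?_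
    have h2 := norm_le_norm_sub_add (Tf ⟨E.proj (Set.Icc (-(k : ℝ)) k) u, hm k u⟩)
      (E.proj (Set.Icc (-(k : ℝ)) k) (Rf u))
    exact h2.trans (add_le_add (h1 k) (E.norm_proj_apply_le (hS k) _))
  refine ⟨hu, ?_⟩
  refine le_of_tendsto ((hQ (Tf ⟨u, hu⟩)).sub (hQ (Rf u))).norm (Eventually.of_forall fun j => ?_)
  rw [← hTf.apply_proj hfc.measurable (hS j) ⟨u, hu⟩ (hm j u)]
  exact h1 j

end

theorem IsSimpleOperatorLipschitz.operatorLipschitzWith {f : ℝ → ℂ} {c : ℝ}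
    (hf : IsSimpleOperatorLipschitz.{v} f c) (hc : 0 ≤ c) (hfc : Continuous f) :
    OperatorLipschitzWith.{v} c f hfc := by
  intro H _ _ _ A B hA hB K hK
  have hTf := (SpectralMeasure.ofSelfAdjoint A hA).isIntegral_integral hfc.measurable
  have hRf := (SpectralMeasure.ofSelfAdjoint B hB).isIntegral_integral hfc.measurable
  have key := hf.exists_mem_domain hc hfc (SpectralMeasure.isIntegral_ofSelfAdjoint hA)
    (SpectralMeasure.isIntegral_ofSelfAdjoint hB) hTf hRf hK
  set Tf := (SpectralMeasure.ofSelfAdjoint A hA).integral f hfc.measurable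
  set Rf := (SpectralMeasure.ofSelfAdjoint B hB).integral f hfc.measurable
  have hdom : Rf.domain ≤ Tf.domain := fun u hu => (key ⟨u, hu⟩).1
  let d : Rf.domain →ₗ[ℂ] H := Tf.toFun ∘ₗ Submodule.inclusion hdom - Rf.toFun
  have hd : ∀ u, ‖d u‖ ≤ c * ‖K‖ * ‖Rf.domain.subtype u‖ := fun u => (key u).2
  have hdense : DenseRange Rf.domain.subtype := by
    simpa [DenseRange] using hRf.dense_domain hfc.measurable
  refine ⟨d.extendOfNorm Rf.domain.subtype, ⟨hdom, fun u => ?_⟩, ?_⟩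
  · exact LinearMap.extendOfNorm_eq hdense ⟨_, hd⟩ u
  · exact ContinuousLinearMap.opNorm_le_bound _ (by positivity)
      (LinearMap.norm_extendOfNorm_apply_le hdense _ hd)

/-! ### Band-limited pieces of tempered distributions -/

theorem SchwartzMap.hasSum_iteratedFDeriv {ι : Type*} {ψ : ι → 𝓢(ℝ, ℂ)} {φ : 𝓢(ℝ, ℂ)}
    (hs : ∀ l, Summable fun n => SchwartzMap.seminorm ℂ 0 l (ψ n))
    (h : ∀ x, HasSum (fun n => ψ n x) (φ x)) (l : ℕ) (x : ℝ) :
    HasSum (fun n => iteratedFDeriv ℝ l (ψ n) x) (iteratedFDeriv ℝ l φ x) := by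
  have h1 : (φ : ℝ → ℂ) = fun y => ∑' n, ψ n y := funext fun y => (h y).tsum_eq.symm
  have hb : ∀ l n x, ‖iteratedFDeriv ℝ l (ψ n) x‖ ≤ SchwartzMap.seminorm ℂ 0 l (ψ n) :=
    fun l n x => SchwartzMap.norm_iteratedFDeriv_le_seminorm ℂ (ψ n) l x
  rw [h1, iteratedFDeriv_tsum_apply (N := ⊤) (v := fun l n => SchwartzMap.seminorm ℂ 0 l (ψ n))
    (fun n => (ψ n).smooth ⊤) (fun l _ => hs l) (fun l n x _ => hb l n x) le_top]
  exact (Summable.of_norm_bounded (hs l) fun n => hb l n x).hasSum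

theorem SchwartzMap.seminorm_le_tsum {ι : Type*} {ψ : ι → 𝓢(ℝ, ℂ)} {φ : 𝓢(ℝ, ℂ)}
    (hs : ∀ k l, Summable fun n => SchwartzMap.seminorm ℂ k l (ψ n))
    (h : ∀ x, HasSum (fun n => ψ n x) (φ x)) (k l : ℕ) :
    SchwartzMap.seminorm ℂ k l φ ≤ ∑' n, SchwartzMap.seminorm ℂ k l (ψ n) := by
  refine SchwartzMap.seminorm_le_bound ℂ k l _ (tsum_nonneg fun n => apply_nonneg _ _) fun x => ?_
  have h3 := (SchwartzMap.hasSum_iteratedFDeriv (hs 0) h l x).const_smul (‖x‖ ^ k)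
  rw [← norm_smul_of_nonneg (by positivity), ← h3.tsum_eq]
  refine tsum_of_norm_bounded (hs k l).hasSum fun n => ?_
  rw [norm_smul_of_nonneg (by positivity)]
  exact SchwartzMap.le_seminorm ℂ k l (ψ n) x

/-- A pointwise convergent series of Schwartz functions, all of whose seminorms are summable,
converges in the Schwartz space. -/
theorem SchwartzMap.hasSum_of_summable_seminorm {ι : Type*} {ψ : ι → 𝓢(ℝ, ℂ)} {φ : 𝓢(ℝ, ℂ)}
    (hs : ∀ k l, Summable fun n => SchwartzMap.seminorm ℂ k l (ψ n))
    (h : ∀ x, HasSum (fun n => ψ n x) (φ x)) : HasSum ψ φ := by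
  refine ((schwartz_withSeminorms ℂ ℝ ℂ).tendsto_nhds _ _).2 ?_
  rintro ⟨k, l⟩ ε hε
  filter_upwards [(tendsto_order.1 (tendsto_tsum_compl_atTop_zero
    fun n => SchwartzMap.seminorm ℂ k l (ψ n))).2 ε hε] with F hF
  refine lt_of_le_of_lt ?_ hF
  rw [map_sub_rev]
  refine SchwartzMap.seminorm_le_tsum (fun k l => (hs k l).subtype _) (fun x => ?_) k l
  have h1 : (φ - ∑ n ∈ F, ψ n) x = φ x - ∑ n ∈ F, ψ n x := by
    rw [sub_apply, sum_apply]
  rw [h1]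
  refine (F.hasSum_compl_iff (f := fun n => ψ n x)).2 ?_
  rw [sub_add_cancel]
  exact h x

/-- The derivatives of `ξ ^ n * m ξ`, for `m` supported in `[-R, R]`, grow like `R ^ n` up to
polynomial factors. -/
theorem exists_norm_iteratedDeriv_pow_mul_le {R : ℝ} (hR : 0 < R) (l : ℕ) :
    ∀ m : 𝓢(ℝ, ℂ), (∀ ξ, R < |ξ| → m ξ = 0) → ∃ C : ℝ, 0 ≤ C ∧ ∀ (n : ℕ) (ξ : ℝ),
      ‖iteratedDeriv l (fun ξ : ℝ => (ξ : ℂ) ^ n * m ξ) ξ‖ ≤ C * ((n + 1) ^ l * R ^ n) := by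
  induction l with
  | zero =>
    intro m hm
    refine ⟨SchwartzMap.seminorm ℂ 0 0 m, apply_nonneg _ _, fun n ξ => ?_⟩
    rw [iteratedDeriv_zero, norm_mul, norm_pow, Complex.norm_real, pow_zero, one_mul,
      mul_comm]
    by_cases h : R < |ξ|
    · rw [hm ξ h, norm_zero, zero_mul]
      exact mul_nonneg (apply_nonneg _ _) (by positivity)
    · exact mul_le_mul (SchwartzMap.norm_le_seminorm ℂ m ξ)
        (pow_le_pow_left₀ (norm_nonneg _) (not_lt.1 h) n) (by positivity) (apply_nonneg _ _)
  | succ l ih =>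
    intro m hm
    obtain ⟨C, hC0, hC⟩ := ih m hm
    obtain ⟨C', hC0', hC'⟩ := ih (SchwartzMap.derivCLM ℂ ℂ m) (fun ξ hξ => by
      rw [SchwartzMap.derivCLM_apply]
      have h1 : (m : ℝ → ℂ) =ᶠ[𝓝 ξ] fun _ => 0 := by
        filter_upwards [(isOpen_lt continuous_const continuous_abs).mem_nhds hξ] with y hy
        exact hm y hy
      rw [h1.deriv_eq, deriv_const])
    refine ⟨C / R + C', by positivity, fun n ξ => ?_⟩
    have hd : deriv (fun ξ : ℝ => (ξ : ℂ) ^ n * m ξ) = (fun ξ : ℝ => (n : ℂ) *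
        ((ξ : ℂ) ^ (n - 1) * m ξ)) + fun ξ : ℝ => (ξ : ℂ) ^ n * SchwartzMap.derivCLM ℂ ℂ m ξ := by
      ext ξ
      have h1 : HasDerivAt (fun ξ : ℝ => (ξ : ℂ) ^ n) (n * (ξ : ℂ) ^ (n - 1)) ξ :=
        (hasDerivAt_pow n (ξ : ℂ)).comp_ofReal
      have h2 : HasDerivAt (fun ξ : ℝ => (ξ : ℂ) ^ n * m ξ) _ ξ := h1.mul (m.hasDerivAt ξ)
      rw [h2.deriv, Pi.add_apply, SchwartzMap.derivCLM_apply]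
      ring
    have hsm : ∀ (m : 𝓢(ℝ, ℂ)) (n : ℕ), ContDiff ℝ l fun ξ : ℝ => (ξ : ℂ) ^ n * m ξ := by
      intro m n
      exact (Complex.ofRealCLM.contDiff.pow n).mul ((m.smooth ⊤).of_le (by exact_mod_cast le_top))
    rw [iteratedDeriv_succ', hd, iteratedDeriv_add
      (contDiff_const.mul (hsm m (n - 1))).contDiffAt (hsm _ n).contDiffAt,
      iteratedDeriv_const_mul_field]
    refine (norm_add_le _ _).trans ?_
    rw [norm_mul, Complex.norm_natCast, add_mul]
    have hl : ((n : ℝ) + 1) ^ l ≤ (n + 1) ^ (l + 1) := by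
      rw [pow_succ]
      exact le_mul_of_one_le_right (by positivity) (by linarith [Nat.cast_nonneg (α := ℝ) n])
    refine add_le_add ?_ ((hC' n ξ).trans (by gcongr))
    rcases n with _ | n
    · simp only [Nat.cast_zero, zero_mul]
      positivity
    · rw [Nat.add_sub_cancel]
      calc ((n + 1 : ℕ) : ℝ) * ‖iteratedDeriv l (fun ξ : ℝ => (ξ : ℂ) ^ n * m ξ) ξ‖
          ≤ ((n + 1 : ℕ) : ℝ) * (C * ((n + 1) ^ l * R ^ n)) := by gcongr; exact hC n ξ
        _ = C / R * ((n + 1) ^ (l + 1) * R ^ (n + 1)) := by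
            push_cast; field_simp; ring
        _ ≤ C / R * ((((n + 1 : ℕ) : ℝ) + 1) ^ (l + 1) * R ^ (n + 1)) := by
            push_cast; gcongr; linarith

/-- Multiplication of a Schwartz function by `ξ ^ n`. -/
noncomputable def SchwartzMap.powMul (n : ℕ) (m : 𝓢(ℝ, ℂ)) : 𝓢(ℝ, ℂ) :=
  SchwartzMap.smulLeftCLM ℂ (fun ξ : ℝ => (ξ : ℂ) ^ n) m

theorem SchwartzMap.powMul_apply (n : ℕ) (m : 𝓢(ℝ, ℂ)) (ξ : ℝ) :
    SchwartzMap.powMul n m ξ = (ξ : ℂ) ^ n * m ξ :=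
  SchwartzMap.smulLeftCLM_apply_apply (by fun_prop) m ξ

theorem exists_succ_pow_le_mul_two_pow (l : ℕ) :
    ∃ C : ℝ, 0 ≤ C ∧ ∀ n : ℕ, ((n : ℝ) + 1) ^ l ≤ C * 2 ^ n := by
  have h := (tendsto_pow_const_div_const_pow_of_one_lt l (one_lt_two (α := ℝ))).bddAbove_range
  obtain ⟨C, hC⟩ := h
  have h1 : ∀ n : ℕ, (n : ℝ) ^ l ≤ C * 2 ^ n := fun n =>
    (div_le_iff₀ (by positivity)).1 (hC ⟨n, rfl⟩)
  refine ⟨2 * C, ?_, fun n => ?_⟩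
  · have := h1 1
    norm_num at this
    linarith
  · have := h1 (n + 1)
    push_cast at this
    rw [pow_succ] at this
    linarith

theorem SchwartzMap.exists_seminorm_powMul_le {R : ℝ} (hR : 0 < R) {m : 𝓢(ℝ, ℂ)}
    (hm : ∀ ξ, R < |ξ| → m ξ = 0) (k l : ℕ) : ∃ C : ℝ, 0 ≤ C ∧ ∀ n : ℕ,
      SchwartzMap.seminorm ℂ k l (SchwartzMap.powMul n m) ≤ C * (2 * R) ^ n := by
  obtain ⟨C, hC0, hC⟩ := exists_norm_iteratedDeriv_pow_mul_le hR l m hm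
  obtain ⟨C', hC0', hC'⟩ := exists_succ_pow_le_mul_two_pow l
  refine ⟨R ^ k * (C * C'), by positivity, fun n => ?_⟩
  refine SchwartzMap.seminorm_le_bound' ℂ k l _ (by positivity) fun ξ => ?_
  have h0 : ⇑(SchwartzMap.powMul n m) = fun ξ : ℝ => (ξ : ℂ) ^ n * m ξ :=
    funext (SchwartzMap.powMul_apply n m)
  rw [h0]
  by_cases h : R < |ξ|
  · have h1 : (fun ξ : ℝ => (ξ : ℂ) ^ n * m ξ) =ᶠ[𝓝 ξ] fun _ => 0 := by
      filter_upwards [(isOpen_lt continuous_const continuous_abs).mem_nhds h] with y hy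
      rw [hm y hy, mul_zero]
    rw [h1.iteratedDeriv_eq]
    simp only [iteratedDeriv_fun_const_zero, norm_zero, mul_zero]
    positivity
  · calc _ ≤ R ^ k * (C * ((n + 1) ^ l * R ^ n)) := by
          gcongr
          · exact not_lt.1 h
          · exact hC n ξ
      _ ≤ R ^ k * (C * ((C' * 2 ^ n) * R ^ n)) := by gcongr; exact hC' n
      _ = _ := by rw [mul_pow]; ring

/-- A Schwartz function `m` supported in `[-R, R]`, multiplied by the character `exp (2πixξ)`, is
the sum of the exponential series in the Schwartz space. -/
theorem SchwartzMap.hasSum_powMul {R : ℝ} (hR : 0 < R) {m φ : 𝓢(ℝ, ℂ)}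
    (hm : ∀ ξ, R < |ξ| → m ξ = 0) {x : ℝ}
    (hφ : ∀ ξ : ℝ, φ ξ = Complex.exp (2 * Real.pi * Complex.I * x * ξ) * m ξ) :
    HasSum (fun n : ℕ => ((2 * Real.pi * Complex.I * x) ^ n / n.factorial : ℂ) •
      SchwartzMap.powMul n m) φ := by
  refine SchwartzMap.hasSum_of_summable_seminorm (fun k l => ?_) fun ξ => ?_
  · obtain ⟨C, hC0, hC⟩ := SchwartzMap.exists_seminorm_powMul_le hR hm k l
    refine Summable.of_nonneg_of_le (fun n => apply_nonneg _ _) (fun n => ?_)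
      (IsExpTypeSeries.summable_bound C (‖2 * Real.pi * Complex.I * x‖ * (2 * R)))
    rw [map_smul_eq_mul, norm_div, norm_pow, Complex.norm_natCast, mul_pow]
    refine (mul_le_mul_of_nonneg_left (hC n) (by positivity)).trans_eq ?_
    ring
  · have h1 := (NormedSpace.expSeries_div_hasSum_exp
      (2 * Real.pi * Complex.I * x * ξ : ℂ)).mul_right (m ξ)
    rw [← Complex.exp_eq_exp_ℂ, ← hφ] at h1
    refine h1.congr_fun fun n => ?_
    rw [smul_apply, SchwartzMap.powMul_apply, smul_eq_mul, mul_pow]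
    ring

/-- A continuous functional on Schwartz functions is controlled by finitely many seminorms; hence
its values at `ξ ^ n * m ξ` grow at most exponentially. -/
theorem TemperedDistribution.exists_norm_powMul_le (v : 𝓢'(ℝ, ℂ)) {R : ℝ} (hR : 0 < R)
    {m : 𝓢(ℝ, ℂ)} (hm : ∀ ξ, R < |ξ| → m ξ = 0) :
    ∃ C : ℝ, 0 ≤ C ∧ ∀ n : ℕ, ‖v (SchwartzMap.powMul n m)‖ ≤ C * (2 * R) ^ n := by
  let q : Seminorm ℂ 𝓢(ℝ, ℂ) := (normSeminorm ℂ ℂ).comp v.toLinearMap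
  have hq : Continuous q := continuous_norm.comp v.continuous
  obtain ⟨s, C, -, hsC⟩ := Seminorm.bound_of_continuous (schwartz_withSeminorms ℂ ℝ ℂ) q hq
  choose K hK0 hK using fun i : ℕ × ℕ => SchwartzMap.exists_seminorm_powMul_le hR hm i.1 i.2
  refine ⟨C * ∑ i ∈ s, K i, mul_nonneg C.2 (Finset.sum_nonneg fun i _ => hK0 i), fun n => ?_⟩
  have h1 : q (SchwartzMap.powMul n m)
      ≤ C * (s.sup (schwartzSeminormFamily ℂ ℝ ℂ)) (SchwartzMap.powMul n m) := hsC _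
  refine h1.trans ?_
  rw [mul_assoc]
  refine mul_le_mul_of_nonneg_left ?_ C.2
  refine Seminorm.finset_sup_apply_le (mul_nonneg (Finset.sum_nonneg fun i _ => hK0 i)
    (by positivity)) fun i hi => (hK i n).trans ?_
  gcongr
  exact Finset.single_le_sum (fun i _ => hK0 i) hi

/-- The convolution of a tempered distribution with a function whose Fourier transform is supported
in `[-R, R]` is an entire function of exponential type. The type `2πR` is doubled, which absorbs the
polynomial factors in the estimates of the derivatives of `ξ ^ n * m ξ`. -/
theorem exists_isExpTypeSeries_temperedConvolution (u : 𝓢'(ℝ, ℂ)) {R : ℝ} (hR : 0 < R)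
    {m : 𝓢(ℝ, ℂ)} (hm : ∀ ξ, R < |ξ| → m ξ = 0) :
    ∃ (c : ℕ → ℂ) (D : ℝ), IsExpTypeSeries c D (4 * Real.pi * R) ∧
      ∀ x : ℝ, temperedConvolution u (𝓕⁻ m) x = ∑' n, c n * (x : ℂ) ^ n := by
  obtain ⟨D, hD0, hD⟩ := TemperedDistribution.exists_norm_powMul_le (𝓕 u) hR hm
  refine ⟨fun n => (2 * Real.pi * Complex.I) ^ n / n.factorial * 𝓕 u (SchwartzMap.powMul n m), D,
    fun n => ?_, fun x => ?_⟩
  · rw [norm_mul, norm_div, norm_pow, Complex.norm_natCast]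
    refine (mul_le_mul_of_nonneg_left (hD n) (by positivity)).trans_eq ?_
    have : ‖(2 * Real.pi * Complex.I : ℂ)‖ = 2 * Real.pi := by
      simp [abs_of_pos Real.pi_pos]
    rw [this, show 4 * Real.pi * R = 2 * Real.pi * (2 * R) by ring, mul_pow (2 * Real.pi)]
    ring
  · have hm' : HasCompactSupport fun ξ : ℝ =>
        Complex.exp (2 * Real.pi * Complex.I * x * ξ) * m ξ := by
      refine HasCompactSupport.intro (isCompact_Icc (a := -R) (b := R)) fun ξ hξ => ?_
      rw [Set.mem_Icc, ← abs_le, not_le] at hξ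
      rw [hm ξ hξ, mul_zero]
    let φ : 𝓢(ℝ, ℂ) := hm'.toSchwartzMap (by
      refine ContDiff.mul ?_ (m.smooth ⊤)
      exact (contDiff_const.mul Complex.ofRealCLM.contDiff).cexp)
    have hφ : ∀ ξ : ℝ, φ ξ = Complex.exp (2 * Real.pi * Complex.I * x * ξ) * m ξ := fun ξ => rfl
    have h1 : SchwartzMap.compSubConstCLM ℂ x (SchwartzMap.compCLMOfContinuousLinearEquiv ℂ
        (ContinuousLinearEquiv.neg ℝ) (𝓕⁻ m)) = 𝓕 φ := by
      ext y
      rw [temperedConvolution_test, SchwartzMap.fourierInv_coe, SchwartzMap.fourier_coe,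
        Real.fourierInv_eq', Real.fourier_eq']
      refine integral_congr_ae (Eventually.of_forall fun ξ => ?_)
      simp only [hφ, smul_eq_mul]
      rw [← mul_assoc, ← Complex.exp_add]
      congr 2
      simp
      ring
    have h2 : temperedConvolution u (𝓕⁻ m) x = 𝓕 u φ := congrArg u h1
    have h3 : HasSum (fun n : ℕ => 𝓕 u (((2 * Real.pi * Complex.I * x) ^ n / n.factorial : ℂ) •
        SchwartzMap.powMul n m)) (𝓕 u φ) := (SchwartzMap.hasSum_powMul hR hm hφ).mapL (𝓕 u)
    refine h2.trans (h3.tsum_eq.symm.trans (tsum_congr fun n => ?_))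
    have h4 := (𝓕 u).map_smul ((2 * Real.pi * Complex.I * x) ^ n / n.factorial : ℂ)
      (SchwartzMap.powMul n m)
    refine h4.trans ?_
    rw [smul_eq_mul, mul_pow _ (x : ℂ), mul_div_right_comm, mul_right_comm]
    rfl

/-- In the normalization `exp (2πixξ)` of the Fourier transform, the symbol of the `n`-th piece
vanishes for `|ξ| > 2 ^ n / π`. -/
theorem exists_isExpTypeSeries_besovPiece (w : LittlewoodPaleyWindow) (u : 𝓢'(ℝ, ℂ)) (n : ℤ) :
    ∃ (c : ℕ → ℂ) (D : ℝ), IsExpTypeSeries c D (4 * 2 ^ n) ∧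
      ∀ x : ℝ, besovPiece w u n x = ∑' j, c j * (x : ℂ) ^ j := by
  have hpos : 0 < (2 : ℝ) ^ n / Real.pi := by positivity
  have h := exists_isExpTypeSeries_temperedConvolution u hpos
    (m := (w.hasCompactSupport_symbol (2 * Real.pi / 2 ^ n) (by positivity)).toSchwartzMap
      (w.contDiff_symbol (2 * Real.pi / 2 ^ n) (by positivity))) (fun ξ hξ => by
    have h1 : w.toFun (2 * Real.pi / 2 ^ n * |ξ|) = 0 := by
      refine image_eq_zero_of_notMem_tsupport fun h => ?_
      have h2 := (w.tsupport_subset h).2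
      rw [div_lt_iff₀ Real.pi_pos] at hξ
      rw [div_mul_eq_mul_div, div_le_iff₀ (by positivity)] at h2
      linarith
    show ((w.toFun (2 * Real.pi / 2 ^ n * |ξ|) : ℝ) : ℂ) = 0
    rw [h1, Complex.ofReal_zero])
  have h4 : 4 * Real.pi * ((2 : ℝ) ^ n / Real.pi) = 4 * 2 ^ n := by field_simp
  rwa [h4] at h

/-! ### Bernstein's inequality for the pieces -/

namespace IsExpTypeSeries

variable {c : ℕ → ℂ} {D τ : ℝ}

theorem hasDerivAt_ofReal (hc : IsExpTypeSeries c D τ) (hτ : 0 ≤ τ) {g : ℝ → ℂ}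
    (hg : ∀ x : ℝ, g x = ∑' n, c n * (x : ℂ) ^ n) (x : ℝ) :
    HasDerivAt g (deriv (fun z : ℂ => ∑' n, c n * z ^ n) x) x := by
  have h1 : Differentiable ℂ fun z : ℂ => ∑' n, c n * z ^ n := by
    simpa using hc.differentiable_tsum_add_smul hτ (0 : ℂ) 1
  have h2 := (h1 (x : ℂ)).hasDerivAt.comp_ofReal
  have h3 : g = fun y : ℝ => ∑' n, c n * (y : ℂ) ^ n := funext hg
  rw [h3]
  exact h2

theorem contDiff_ofReal (hc : IsExpTypeSeries c D τ) (hτ : 0 ≤ τ) {g : ℝ → ℂ}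
    (hg : ∀ x : ℝ, g x = ∑' n, c n * (x : ℂ) ^ n) : ContDiff ℝ 1 g := by
  have h1 : Differentiable ℂ fun z : ℂ => ∑' n, c n * z ^ n := by
    simpa using hc.differentiable_tsum_add_smul hτ (0 : ℂ) 1
  have h2 : ContDiff ℝ 1 fun z : ℂ => ∑' n, c n * z ^ n := h1.contDiff.restrict_scalars ℝ
  have h3 : g = fun y : ℝ => ∑' n, c n * (y : ℂ) ^ n := funext hg
  rw [h3]
  exact h2.comp Complex.ofRealCLM.contDiff

theorem norm_deriv_ofReal_le (hc : IsExpTypeSeries c D τ) (hτ : 0 < τ) {g : ℝ → ℂ}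
    (hg : ∀ x : ℝ, g x = ∑' n, c n * (x : ℂ) ^ n) {M : ℝ} (hM : ∀ x, ‖g x‖ ≤ M) (x : ℝ) :
    ‖deriv g x‖ ≤ Real.exp 1 * τ * M := by
  rw [(hc.hasDerivAt_ofReal hτ.le hg x).deriv]
  have h1 : deriv (fun z : ℂ => ∑' n, c n * z ^ n) x
      = deriv (fun z : ℂ => ∑' n, c n • ((x : ℂ) + z • (1 : ℂ)) ^ n) 0 := by
    have h := deriv_comp_const_add (fun z : ℂ => ∑' n, c n * z ^ n) (x : ℂ) 0
    rw [add_zero] at h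
    rw [← h]
    simp
  rw [h1]
  refine norm_deriv_le_of_exponentialType (hc.differentiable_tsum_add_smul hτ.le (x : ℂ) 1)
    (D := max 1 ‖(1 : ℂ)‖ * D * Real.exp (τ * ‖(x : ℂ)‖)) hτ (fun z => ?_) (fun t => ?_)
  · refine (hc.norm_tsum_le hτ.le (norm_add_smul_le (x : ℂ) 1 z)).trans_eq ?_
    rw [norm_one, mul_one, mul_add, Real.exp_add, mul_assoc (max 1 1 * D)]
  · have h2 := hM (x + t)
    rw [hg] at h2
    simpa using h2

theorem norm_sub_ofReal_le (hc : IsExpTypeSeries c D τ) (hτ : 0 < τ) {g : ℝ → ℂ}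
    (hg : ∀ x : ℝ, g x = ∑' n, c n * (x : ℂ) ^ n) {M : ℝ} (hM : ∀ x, ‖g x‖ ≤ M) (x y : ℝ) :
    ‖g y - g x‖ ≤ Real.exp 1 * τ * M * ‖y - x‖ :=
  convex_univ.norm_image_sub_le_of_norm_deriv_le
    (fun x _ => (hc.hasDerivAt_ofReal hτ.le hg x).differentiableAt)
    (fun x _ => hc.norm_deriv_ofReal_le hτ hg hM x) (Set.mem_univ x) (Set.mem_univ y)

end IsExpTypeSeries

theorem Continuous.norm_le_eLpNorm_top {g : ℝ → ℂ} (hg : Continuous g)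
    (h : eLpNorm g ⊤ volume ≠ ⊤) (x : ℝ) : ‖g x‖ ≤ (eLpNorm g ⊤ volume).toReal := by
  rw [eLpNorm_exponent_top] at h ⊢
  have h1 : ∀ᵐ x, ‖g x‖ ≤ (eLpNormEssSup g volume).toReal := by
    filter_upwards [enorm_ae_le_eLpNormEssSup g volume] with x hx
    rw [← toReal_enorm]
    exact ENNReal.toReal_mono h hx
  by_contra hx
  have h2 : IsOpen {x | ¬ ‖g x‖ ≤ (eLpNormEssSup g volume).toReal} := by
    simp only [not_le]
    exact isOpen_lt continuous_const hg.norm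
  have h3 := (h2.measure_eq_zero_iff volume).1 (ae_iff.1 h1)
  exact Set.notMem_empty x (h3 ▸ hx)

/-! ### Distributions with vanishing derivative -/

theorem SchwartzMap.integrable_norm_pow_mul (φ : 𝓢(ℝ, ℂ)) (k : ℕ) :
    Integrable fun x : ℝ => |x| ^ k * ‖φ x‖ :=
  φ.integrable_pow_mul volume k

/-- A Schwartz function with vanishing integral is the derivative of a Schwartz function. -/
theorem SchwartzMap.exists_derivCLM_eq {φ : 𝓢(ℝ, ℂ)} (hφ : ∫ x, φ x = 0) :
    ∃ ψ : 𝓢(ℝ, ℂ), SchwartzMap.derivCLM ℂ ℂ ψ = φ := by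
  let ψ : ℝ → ℂ := fun x => ∫ t in Set.Iic x, φ t
  have hd : ∀ x, HasDerivAt ψ (φ x) x := by
    intro x
    have h1 : ψ = fun y => (∫ t in Set.Iic 0, φ t) + ∫ t in (0 : ℝ)..y, φ t := by
      ext y
      rw [← intervalIntegral.integral_Iic_sub_Iic φ.integrable.integrableOn
        φ.integrable.integrableOn]
      simp [ψ]
    rw [h1]
    exact (φ.continuous.integral_hasStrictDerivAt 0 x).hasDerivAt.const_add _
  have hderiv : deriv ψ = φ := funext fun x => (hd x).deriv
  have hsmooth : ContDiff ℝ ((⊤ : ℕ∞) : WithTop ℕ∞) ψ := by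
    rw [contDiff_infty_iff_deriv, hderiv]
    exact ⟨fun x => (hd x).differentiableAt, φ.smooth ⊤⟩
  -- The integral over `(-∞, x]` is used for `x ≤ 0` and that over `(x, ∞)` for `x > 0`.
  have hzero : ∀ (k : ℕ) (x : ℝ), |x| ^ k * ‖ψ x‖ ≤ ∫ t, |t| ^ k * ‖φ t‖ := by
    intro k x
    have key : ∀ S : Set ℝ, MeasurableSet S → (∀ t ∈ S, |x| ≤ |t|) →
        |x| ^ k * ‖∫ t in S, φ t‖ ≤ ∫ t, |t| ^ k * ‖φ t‖ := by
      intro S hS h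
      calc |x| ^ k * ‖∫ t in S, φ t‖ ≤ |x| ^ k * ∫ t in S, ‖φ t‖ := by
            gcongr; exact norm_integral_le_integral_norm _
        _ = ∫ t in S, |x| ^ k * ‖φ t‖ := (integral_const_mul _ _).symm
        _ ≤ ∫ t in S, |t| ^ k * ‖φ t‖ := by
            refine setIntegral_mono_on (φ.integrable.norm.const_mul _).integrableOn
              (φ.integrable_norm_pow_mul k).integrableOn hS fun t ht => ?_
            exact mul_le_mul_of_nonneg_right (pow_le_pow_left₀ (abs_nonneg x) (h t ht) k)
              (norm_nonneg _)
        _ ≤ ∫ t, |t| ^ k * ‖φ t‖ := setIntegral_le_integral (φ.integrable_norm_pow_mul k)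
            (Eventually.of_forall fun t => by positivity)
    rcases le_or_gt x 0 with hx | hx
    · refine key (Set.Iic x) measurableSet_Iic fun t ht => ?_
      rw [abs_of_nonpos hx, abs_of_nonpos (le_trans ht hx)]
      exact neg_le_neg ht
    · have h1 : ψ x = -∫ t in Set.Ioi x, φ t := by
        have h2 := intervalIntegral.integral_Iic_add_Ioi (μ := volume) (b := x) (f := fun t => φ t)
          (φ.integrable (μ := volume)).integrableOn (φ.integrable (μ := volume)).integrableOn
        rw [hφ] at h2
        exact eq_neg_of_add_eq_zero_left h2
      rw [h1, norm_neg]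
      refine key (Set.Ioi x) measurableSet_Ioi fun t ht => ?_
      rw [abs_of_pos hx, abs_of_pos (hx.trans ht)]
      exact (Set.mem_Ioi.1 ht).le
  refine ⟨⟨ψ, hsmooth, fun k l => ?_⟩, ?_⟩
  · rcases l with _ | l
    · exact ⟨_, fun x => by simpa using hzero k x⟩
    · refine ⟨SchwartzMap.seminorm ℂ k l φ, fun x => ?_⟩
      rw [norm_iteratedFDeriv_eq_norm_iteratedDeriv, iteratedDeriv_succ', hderiv]
      exact SchwartzMap.le_seminorm' ℂ k l φ x
  · ext x
    rw [SchwartzMap.derivCLM_apply]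
    exact (hd x).deriv

theorem SchwartzMap.exists_integral_eq_one : ∃ ρ : 𝓢(ℝ, ℂ), ∫ x, ρ x = 1 := by
  let b : ContDiffBump (0 : ℝ) := ⟨1, 2, one_pos, one_lt_two⟩
  have hc : HasCompactSupport fun x : ℝ => ((b.normed volume x : ℝ) : ℂ) :=
    b.hasCompactSupport_normed.comp_left (g := fun x : ℝ => (x : ℂ)) Complex.ofReal_zero
  refine ⟨hc.toSchwartzMap (Complex.ofRealCLM.contDiff.comp b.contDiff_normed), ?_⟩
  have h : ∫ x, ((b.normed volume x : ℝ) : ℂ) = 1 := by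
    rw [integral_complex_ofReal, b.integral_normed, Complex.ofReal_one]
  exact h

/-- Two linear functionals which agree on the derivatives of Schwartz functions differ by a constant
function. -/
theorem exists_sub_eq_mul_integral {u v : 𝓢(ℝ, ℂ) →ₗ[ℂ] ℂ}
    (h : ∀ φ, u (SchwartzMap.derivCLM ℂ ℂ φ) = v (SchwartzMap.derivCLM ℂ ℂ φ)) :
    ∃ a : ℂ, ∀ φ : 𝓢(ℝ, ℂ), u φ = v φ + a * ∫ x, φ x := by
  obtain ⟨ρ, hρ⟩ := SchwartzMap.exists_integral_eq_one
  refine ⟨u ρ - v ρ, fun φ => ?_⟩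
  have h1 : ∫ x, (φ - (∫ x, φ x) • ρ) x = 0 := by
    simp only [sub_apply, smul_apply, smul_eq_mul]
    rw [integral_sub φ.integrable (ρ.integrable.const_mul _), integral_const_mul, hρ, mul_one,
      sub_self]
  obtain ⟨ψ, hψ⟩ := SchwartzMap.exists_derivCLM_eq h1
  have h2 := h ψ
  rw [hψ, map_sub, map_sub, map_smul, map_smul, smul_eq_mul, smul_eq_mul] at h2
  linear_combination h2

/-! ### Functions in the Besov class -/

theorem ENNReal.toReal_two_zpow (n : ℤ) : ((2 : ℝ≥0∞) ^ n).toReal = 2 ^ n := by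
  rw [show (2 : ℝ≥0∞) = ((2 : ℝ≥0) : ℝ≥0∞) from rfl, ← ENNReal.coe_zpow two_ne_zero,
    ENNReal.coe_toReal, NNReal.coe_zpow, NNReal.coe_two]

namespace MemBesov

variable {w : LittlewoodPaleyWindow} {u : 𝓢'(ℝ, ℂ)}

theorem eLpNorm_besovPiece_ne_top (hu : MemBesov w u) (n : ℤ) :
    eLpNorm (besovPiece w u n) ⊤ volume ≠ ⊤ := by
  intro h
  have h1 := ENNReal.ne_top_of_tsum_ne_top hu.norm_lt_top.ne n
  rw [h, ENNReal.mul_top (ENNReal.zpow_pos (by simp) (by simp) n).ne'] at h1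
  exact h1 rfl

theorem continuous_besovPiece (w : LittlewoodPaleyWindow) (u : 𝓢'(ℝ, ℂ)) (n : ℤ) :
    Continuous (besovPiece w u n) := by
  obtain ⟨c, D, hc, hg⟩ := exists_isExpTypeSeries_besovPiece w u n
  exact (hc.contDiff_ofReal (by positivity) hg).continuous

theorem norm_besovPiece_le (hu : MemBesov w u) (n : ℤ) (x : ℝ) :
    ‖besovPiece w u n x‖ ≤ (eLpNorm (besovPiece w u n) ⊤ volume).toReal :=
  (continuous_besovPiece w u n).norm_le_eLpNorm_top (hu.eLpNorm_besovPiece_ne_top n) x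

theorem hasSum_toReal (hu : MemBesov w u) :
    HasSum (fun n : ℤ => (2 : ℝ) ^ n * (eLpNorm (besovPiece w u n) ⊤ volume).toReal)
      (besovNorm w u).toReal := by
  have h := ENNReal.hasSum_toReal hu.norm_lt_top.ne
  rw [← ENNReal.tsum_toReal_eq fun n => ENNReal.ne_top_of_tsum_ne_top hu.norm_lt_top.ne n] at h
  simpa only [ENNReal.toReal_mul, ENNReal.toReal_two_zpow, besovNorm] using h

end MemBesov

/-- The Lipschitz constant of a piece provided by Bernstein's inequality. -/
noncomputable def bernsteinConst (w : LittlewoodPaleyWindow) (u : 𝓢'(ℝ, ℂ)) (n : ℤ) : ℝ :=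
  Real.exp 1 * (4 * 2 ^ n) * (eLpNorm (besovPiece w u n) ⊤ volume).toReal

namespace MemBesov

variable {w : LittlewoodPaleyWindow} {u : 𝓢'(ℝ, ℂ)}

theorem hasSum_bernsteinConst (hu : MemBesov w u) :
    HasSum (bernsteinConst w u) (Real.exp 1 * 4 * (besovNorm w u).toReal) := by
  refine (hu.hasSum_toReal.mul_left (Real.exp 1 * 4)).congr_fun fun n => ?_
  rw [bernsteinConst]
  ring

theorem isSimpleOperatorLipschitz_besovPiece (hu : MemBesov w u) (n : ℤ) :
    IsSimpleOperatorLipschitz.{v} (besovPiece w u n) (bernsteinConst w u n) := by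
  obtain ⟨c, D, hc, hg⟩ := exists_isExpTypeSeries_besovPiece w u n
  exact hc.isSimpleOperatorLipschitz (by positivity) hg (hu.norm_besovPiece_le n)

theorem norm_besovPiece_sub_le (hu : MemBesov w u) (n : ℤ) (x y : ℝ) :
    ‖besovPiece w u n y - besovPiece w u n x‖ ≤ bernsteinConst w u n * ‖y - x‖ := by
  obtain ⟨c, D, hc, hg⟩ := exists_isExpTypeSeries_besovPiece w u n
  exact hc.norm_sub_ofReal_le (by positivity) hg (hu.norm_besovPiece_le n) x y

/-- Integration by parts; the constant `besovPiece w u n 0` is harmless because the integral of the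
derivative of a Schwartz function vanishes. -/
theorem integral_deriv_besovPiece_mul (hu : MemBesov w u) (n : ℤ) (φ : 𝓢(ℝ, ℂ)) :
    ∫ x, deriv (besovPiece w u n) x * φ x
      = -∫ x, (besovPiece w u n x - besovPiece w u n 0) * SchwartzMap.derivCLM ℂ ℂ φ x := by
  obtain ⟨c, D, hc, hg⟩ := exists_isExpTypeSeries_besovPiece w u n
  have hM := hu.norm_besovPiece_le n
  set g := besovPiece w u n
  set M := (eLpNorm g ⊤ volume).toReal
  have hcont : ContDiff ℝ 1 g := hc.contDiff_ofReal (by positivity) hg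
  have hd : ∀ x, HasDerivAt (fun x => g x - g 0) (deriv g x) x := fun x =>
    ((hc.hasDerivAt_ofReal (by positivity) hg x).differentiableAt.hasDerivAt).sub_const (g 0)
  have hbd : ∀ x, ‖g x - g 0‖ ≤ M + M := fun x =>
    (norm_sub_le _ _).trans (add_le_add (hM x) (hM 0))
  have hgm : AEStronglyMeasurable (fun x => g x - g 0) :=
    (hcont.continuous.sub continuous_const).aestronglyMeasurable
  have h := integral_mul_deriv_eq_deriv_mul_of_integrable (u := fun x => g x - g 0) (v := φ)
    (u' := deriv g) (v' := deriv φ) (fun x _ => hd x) (fun x _ => φ.hasDerivAt x)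
    ((SchwartzMap.derivCLM ℂ ℂ φ).integrable.bdd_mul hgm (Eventually.of_forall hbd))
    (φ.integrable.bdd_mul (hcont.continuous_deriv le_rfl).aestronglyMeasurable
      (Eventually.of_forall fun x => hc.norm_deriv_ofReal_le (by positivity) hg hM x))
    (φ.integrable.bdd_mul hgm (Eventually.of_forall hbd))
  simp only [SchwartzMap.derivCLM_apply]
  rw [h, neg_neg]

/-- The normalized sum `∑ (f_n - f_n(0))` of the pieces. -/
theorem hasSum_besovPiece_sub (hu : MemBesov w u) (x : ℝ) :
    HasSum (fun n => besovPiece w u n x - besovPiece w u n 0)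
      (∑' n, (besovPiece w u n x - besovPiece w u n 0)) :=
  (Summable.of_norm_bounded (hu.hasSum_bernsteinConst.summable.mul_right ‖x - 0‖)
    fun n => hu.norm_besovPiece_sub_le n 0 x).hasSum

theorem continuous_tsum_besovPiece_sub (hu : MemBesov w u) :
    Continuous fun x => ∑' n, (besovPiece w u n x - besovPiece w u n 0) := by
  have h := hu.hasSum_bernsteinConst
  refine (LipschitzWith.of_dist_le_mul (K := ⟨Real.exp 1 * 4 * (besovNorm w u).toReal,
    by positivity⟩) fun x y => ?_).continuous
  have h1 := (hu.hasSum_besovPiece_sub x).sub (hu.hasSum_besovPiece_sub y)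
  rw [dist_eq_norm, dist_eq_norm, ← h1.tsum_eq]
  refine tsum_of_norm_bounded (h.mul_right ‖x - y‖) fun n => ?_
  rw [sub_sub_sub_cancel_right]
  exact hu.norm_besovPiece_sub_le n y x

theorem hasSum_integral_besovPiece_sub_mul (hu : MemBesov w u) (φ : 𝓢(ℝ, ℂ)) :
    HasSum (fun n => ∫ x, (besovPiece w u n x - besovPiece w u n 0) * φ x)
      (∫ x, (∑' n, (besovPiece w u n x - besovPiece w u n 0)) * φ x) := by
  have hb : ∀ n x, ‖(besovPiece w u n x - besovPiece w u n 0) * φ x‖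
      ≤ bernsteinConst w u n * (|x| ^ 1 * ‖φ x‖) := fun n x => by
    rw [norm_mul, pow_one, ← mul_assoc]
    have h := hu.norm_besovPiece_sub_le n 0 x
    rw [sub_zero, Real.norm_eq_abs] at h
    exact mul_le_mul_of_nonneg_right h (norm_nonneg _)
  have hi := φ.integrable_norm_pow_mul 1
  have hint : ∀ n, Integrable fun x => (besovPiece w u n x - besovPiece w u n 0) * φ x :=
    fun n => (hi.const_mul (bernsteinConst w u n)).mono'
      (((continuous_besovPiece w u n).sub continuous_const).mul φ.continuous).aestronglyMeasurable
      (Eventually.of_forall (hb n))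
  have h := hasSum_integral_of_summable_integral_norm hint (by
    refine Summable.of_nonneg_of_le (fun n => by positivity) (fun n => ?_)
      (hu.hasSum_bernsteinConst.summable.mul_right (∫ x, |x| ^ 1 * ‖φ x‖))
    rw [← integral_const_mul]
    exact integral_mono (hint n).norm (hi.const_mul _) (hb n))
  simpa only [tsum_mul_right] using h

theorem integrable_tsum_besovPiece_sub_mul (hu : MemBesov w u) (φ : 𝓢(ℝ, ℂ)) :
    Integrable fun x => (∑' n, (besovPiece w u n x - besovPiece w u n 0)) * φ x := by
  refine ((φ.integrable_norm_pow_mul 1).const_mul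
    (Real.exp 1 * 4 * (besovNorm w u).toReal)).mono'
    (hu.continuous_tsum_besovPiece_sub.mul φ.continuous).aestronglyMeasurable
    (Eventually.of_forall fun x => ?_)
  rw [norm_mul, pow_one, ← mul_assoc]
  refine mul_le_mul_of_nonneg_right ?_ (norm_nonneg _)
  refine tsum_of_norm_bounded (hu.hasSum_bernsteinConst.mul_right |x|) fun n => ?_
  simpa using hu.norm_besovPiece_sub_le n 0 x

/-- A distribution of the Besov class is, up to an additive constant, the normalized sum of its
pieces. This is where the condition `f' = ∑ f_n'` enters: it excludes the addition of
nonconstant polynomials. -/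
theorem exists_isGivenBy (hu : MemBesov w u) : ∃ (f : ℝ → ℂ) (a : ℂ), Continuous f ∧
    IsGivenBy u f ∧
    ∀ x, HasSum (fun n => besovPiece w u n x - besovPiece w u n 0) (f x - a) := by
  set h : ℝ → ℂ := fun x => ∑' n, (besovPiece w u n x - besovPiece w u n 0) with hh
  have hint : ∀ φ : 𝓢(ℝ, ℂ), Integrable fun x => h x * φ x :=
    hu.integrable_tsum_besovPiece_sub_mul
  let V : 𝓢(ℝ, ℂ) →ₗ[ℂ] ℂ :=
    { toFun := fun φ => ∫ x, h x * φ x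
      map_add' := fun φ ψ => by
        rw [← integral_add (hint φ) (hint ψ)]
        simp only [add_apply, mul_add]
      map_smul' := fun c φ => by
        rw [RingHom.id_apply, smul_eq_mul, ← integral_const_mul]
        simp only [smul_apply, smul_eq_mul, mul_left_comm] }
  obtain ⟨a, ha⟩ := exists_sub_eq_mul_integral (u := u.toLinearMap) (v := V) fun φ => by
    have h1 := hu.hasSum_deriv φ
    simp only [hu.integral_deriv_besovPiece_mul] at h1
    have h2 := h1.unique (hu.hasSum_integral_besovPiece_sub_mul (SchwartzMap.derivCLM ℂ ℂ φ)).neg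
    rw [TemperedDistribution.derivCLM_apply_apply] at h2
    exact neg_injective ((map_neg u.toLinearMap _).symm.trans h2)
  refine ⟨fun x => h x + a, a, hu.continuous_tsum_besovPiece_sub.add continuous_const,
    fun φ => ?_, fun x => ?_⟩
  · have h1 : (fun x => (h x + a) * φ x) = fun x => h x * φ x + a * φ x := by
      ext x; ring
    rw [h1]
    have h2 := φ.integrable (μ := volume) |>.const_mul a
    refine ⟨(hint φ).add h2, ?_⟩
    rw [integral_add (hint φ) h2, integral_const_mul]
    exact ha φ
  · rw [add_sub_cancel_right]
    exact hu.hasSum_besovPiece_sub x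

end MemBesov

theorem mainTheorem2 :
    ∃ C : ℝ, 0 ≤ C ∧ ∀ (w : LittlewoodPaleyWindow) (u : 𝓢'(ℝ, ℂ)), MemBesov w u →
      ∃ (f : ℝ → ℂ) (hf : Continuous f), IsGivenBy u f ∧ IsOperatorLipschitz.{v} f hf ∧
        ∀ (H : Type v) [NormedAddCommGroup H] [InnerProductSpace ℂ H] [CompleteSpace H]
          (A B : H →ₗ.[ℂ] H) (hA : IsSelfAdjoint A) (hB : IsSelfAdjoint B) (K : H →L[ℂ] H),
          IsBoundedDifference A B K →
            ∃ L : H →L[ℂ] H,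
              IsBoundedDifference (selfAdjointFun f hf.measurable A hA)
                (selfAdjointFun f hf.measurable B hB) L ∧
              ‖L‖ ≤ C * (besovNorm w u).toReal * ‖K‖ := by
  refine ⟨Real.exp 1 * 4, by positivity, fun w u hu => ?_⟩
  obtain ⟨f, a, hf, hgiven, hsum⟩ := hu.exists_isGivenBy
  have h1 := IsSimpleOperatorLipschitz.of_hasSum.{v} hu.isSimpleOperatorLipschitz_besovPiece
    hu.hasSum_bernsteinConst.summable a hsum
  rw [hu.hasSum_bernsteinConst.tsum_eq] at h1
  have h2 := h1.operatorLipschitzWith (by positivity) hf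
  exact ⟨f, hf, hgiven, ⟨_, h2⟩, h2⟩
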